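/- **Conventions.** A box is a pair $(i,j)\in\mathbb Z_{>0}^2$ (row $i$, numbered downwards; column $j$, numbered to the right), and boxes are ordered componentwise. A *skew shape* is a finite set of boxes closed under taking intervals; it is *connected* if its Hasse diagram is connected. For a connected skew shape $\sigma$, $\lambda\supseteq\sigma$ means that $\lambda$ is a skew shape containing $\sigma$, every box of which is in the same column as some box of $\sigma$. Then $A(\lambda/\sigma)$ and $B(\lambda/\sigma)$ denote the sets of boxes of $\lambda\setminus\sigma$ lying above, respectively below, a box of $\sigma$ in the same column. A *tableau* on a shape assigns a positive integer to each box. It is *reverse row-strict* if its rows strictly decrease from left to right and its columns weakly decrease from top to bottom; it is *row-bounded* (*row-weakly-bounded*) if the label of each box $(i,j)$ is $<i$ (respectively $\le i$). Its *content* $c(U)$ is the sequence whose $k$-th entry is the number of occurrences of $k$. A *semistandard set-valued tableau* on $\lambda$ assigns a nonempty finite set of positive integers to each box such that rows weakly increase from left to right and columns strictly increase from top to bottom, where $S\le S'$ means $\max S\le\min S'$ and $S<S'$ means $\max S<\min S'$. Its *content* counts the occurrences of each label, and its *excess* is the sequence whose $i$-th entry is the number of labels in row $i$ minus the number of boxes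 in row $i$. $\mathrm{SS}_{\mathbf c,\mathbf e}(\lambda)$ is the set of semistandard set-valued tableaux on $\lambda$ of content $\mathbf c$ and excess $\mathbf e$ (empty if some entry of $\mathbf e$ is negative). **Row insertion** of a label $x$ into row $i$: if row $i$ has a label $>x$, then $x$ replaces the label $y$ of the leftmost such box and $y$ is inserted into row $i+1$ in the same manner; otherwise $x$ is placed in a new box at the right end of row $i$ (directly below the leftmost box of row $i-1$ if row $i$ is empty), and the insertion ends. **Algorithm.** The input is a triple $(\lambda,T',T)$ as in (1)–(3) below. Let $r$ be the index of the last row of $\sigma$ (the number of rows of $\sigma$, if $\sigma$ starts in row $1$). For $k=r,r-1,\dots,1$ do the following. First, as long as row $k$ has a box with several labels, take the rightmost such box, remove its maximum label and row-insert that label into row $k+1$. Then, for each box $(i,j)$ with $T'(i,j)=k$ (there is at most one in each row), in order of increasing $i$, delete the box and row-insert its label into row $i+1$. Each new box created in step $k$ is labelled $k$ in an auxiliary filling $T''$. The output is $(\mu,T'',\widetilde T)$, where $\mu$ is the final shape and $\widetilde T$ its final filling. **Proposition.** For any connected skew shape $\sigma$ and any sequences $\mathbf c=(c_1,c_2,\dots)$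 and $\mathbf e=(e_1,e_2,\dots)$ of nonnegative integers, the algorithm gives a bijection from the set of triples $(\lambda,T',T)$ in which 1. $\lambda\supseteq\sigma$ is a skew shape with $B(\lambda/\sigma)=\emptyset$, 2. $T'$ is a reverse row-strict, row-weakly-bounded tableau on $A(\lambda/\sigma)$, 3. $T\in\mathrm{SS}_{\mathbf c,\mathbf e-c(T')}(\lambda)$, onto the set of triples $(\mu,T'',\widetilde T)$ in which 1. $\mu\supseteq\sigma$ is a skew shape with $A(\mu/\sigma)=\emptyset$, 2. $T''$ is a reverse row-strict, row-bounded tableau on $B(\mu/\sigma)$ with $c(T'')=\mathbf e$, 3. $\widetilde T\in\mathrm{SS}_{\mathbf c,\mathbf 0}(\mu)$. Therefore $$\sum_{(\lambda,T')}|\mathrm{SS}_{\mathbf c,\mathbf e-c(T')}(\lambda)|=\sum_{(\mu,T'')}|\mathrm{SS}_{\mathbf c,\mathbf 0}(\mu)|,$$ where the left sum is over the pairs $(\lambda,T')$ satisfying (1) and (2) of the first list, and the right sum is over the pairs $(\mu,T'')$ satisfying (1) and (2) of the second list (in particular $c(T'')=\mathbf e$); both sums and all the sets counted in them are finite. -/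

import Mathlib

namespace SkewInsertion

/-- A box `(i, j)`: row `i` (numbered from top to bottom) and column `j` (from left to right). -/
abbrev Box : Type := ℕ × ℕ

/-- A skew Young diagram: a finite set of boxes with positive coordinates that is closed under
taking intervals for the componentwise order. -/
structure IsSkewShape (s : Finset Box) : Prop where
  pos : ∀ b ∈ s, 0 < b.1 ∧ 0 < b.2
  ordConnected : (s : Set Box).OrdConnected

/-- The Hasse diagram of the poset of boxes is connected (the empty shape is allowed). -/
def IsConnectedShape (s : Finset Box) : Prop :=
  (SimpleGraph.hasse {b : Box // b ∈ s}).Preconnected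

/-- The containment `l ⊇ σ` of skew shapes used here: `l` is a skew shape containing `σ`, each
box of which lies in the same column as some box of `σ`. -/
structure Extends (σ l : Finset Box) : Prop where
  isSkewShape : IsSkewShape l
  subset : σ ⊆ l
  column : ∀ b ∈ l, ∃ a ∈ σ, a.2 = b.2

/-- `A(l/σ)`: the boxes of `l` outside `σ` that lie above `σ`. -/
def above (σ l : Finset Box) : Finset Box :=
  (l \ σ).filter fun b => ∃ a ∈ σ, a.2 = b.2 ∧ b.1 < a.1

/-- `B(l/σ)`: the boxes of `l` outside `σ` that lie below `σ`. -/
def below (σ l : Finset Box) : Finset Box :=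
  (l \ σ).filter fun b => ∃ a ∈ σ, a.2 = b.2 ∧ a.1 < b.1

/-! ### Tableaux

A tableau of shape `s` is stored as a function on all boxes with value `0` exactly outside `s`;
a set-valued tableau of shape `s` as a function with value `∅` exactly outside `s`. -/

/-- `U` is a tableau of shape `s` (a positive integer in each box of `s`). -/
def IsTableau (s : Finset Box) (U : Box → ℕ) : Prop :=
  ∀ b, 0 < U b ↔ b ∈ s

/-- Rows strictly decrease from left to right, columns weakly decrease from top to bottom. -/
structure IsReverseRowStrict (s : Finset Box) (U : Box → ℕ) : Prop where
  row : ∀ i j j', (i, j) ∈ s → (i, j') ∈ s → j < j' → U (i, j') < U (i, j)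
  col : ∀ i i' j, (i, j) ∈ s → (i', j) ∈ s → i < i' → U (i', j) ≤ U (i, j)

def IsRowBounded (s : Finset Box) (U : Box → ℕ) : Prop :=
  ∀ b ∈ s, U b < b.1

def IsRowWeaklyBounded (s : Finset Box) (U : Box → ℕ) : Prop :=
  ∀ b ∈ s, U b ≤ b.1

/-- The content of a tableau: `content s U k` is the number of boxes labelled `k`. -/
def content (s : Finset Box) (U : Box → ℕ) (k : ℕ) : ℕ :=
  (s.filter fun b => U b = k).card

/-- `T` is a set-valued tableau of shape `s` (a nonempty finite set of positive integers in each
box of `s`). -/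
structure IsSetValuedTableau (s : Finset Box) (T : Box → Finset ℕ) : Prop where
  nonempty_iff : ∀ b, (T b).Nonempty ↔ b ∈ s
  pos : ∀ b, ∀ x ∈ T b, 0 < x

/-- Rows weakly increase from left to right, columns strictly increase from top to bottom, where
`S ≤ S'` means `max S ≤ min S'` and `S < S'` means `max S < min S'`. -/
structure IsSemistandard (s : Finset Box) (T : Box → Finset ℕ) : Prop where
  row : ∀ i j j', (i, j) ∈ s → (i, j') ∈ s → j < j' →
    ∀ x ∈ T (i, j), ∀ y ∈ T (i, j'), x ≤ y
  col : ∀ i i' j, (i, j) ∈ s → (i', j) ∈ s → i < i' →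
    ∀ x ∈ T (i, j), ∀ y ∈ T (i', j), x < y

/-- The content of a set-valued tableau: the number of occurrences of the label `k`. -/
def svContent (s : Finset Box) (T : Box → Finset ℕ) (k : ℕ) : ℕ :=
  (s.filter fun b => k ∈ T b).card

/-- The excess of a set-valued tableau: the number of labels in row `i` minus the number of boxes
in row `i`. -/
def excess (s : Finset Box) (T : Box → Finset ℕ) (i : ℕ) : ℤ :=
  (∑ b ∈ s.filter (fun b => b.1 = i), ((T b).card : ℤ)) - ((s.filter fun b => b.1 = i).card : ℤ)

/-- `SS_{c,e}(s)`: the semistandard set-valued tableaux of shape `s` with content `c` and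
excess `e` (the latter may have negative entries, and then the set is empty). -/
def SS (c : ℕ → ℕ) (e : ℕ → ℤ) (s : Finset Box) : Set (Box → Finset ℕ) :=
  {T | IsSetValuedTableau s T ∧ IsSemistandard s T ∧
    (∀ k, svContent s T k = c k) ∧ ∀ i, excess s T i = e i}

/-! ### Row insertion -/

/-- The columns `j` with `(i, j) ∈ s`. -/
def rowCols (s : Finset Box) (i : ℕ) : Finset ℕ :=
  (s.filter fun b => b.1 = i).image Prod.snd

/-- The box added when an insertion ends in row `i`: the one just to the right of row `i`, and if
row `i` is empty, the one directly below the leftmost box of row `i - 1`. -/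
def newBox (s : Finset Box) (i : ℕ) : Box :=
  if (rowCols s i).Nonempty then (i, (rowCols s i).sup id + 1)
  else (i, (rowCols s (i - 1)).min.untopD 0)

/-- The columns of the boxes of row `i` with a label greater than `x`. -/
def bumpCols (s : Finset Box) (T : Box → Finset ℕ) (i x : ℕ) : Finset ℕ :=
  (rowCols s i).filter fun j => ∃ y ∈ T (i, j), x < y

theorem le_of_bumpCols_nonempty {s : Finset Box} {T : Box → Finset ℕ} {i x : ℕ}
    (h : (bumpCols s T i x).Nonempty) : i ≤ s.sup Prod.fst := by
  obtain ⟨j, hj⟩ := h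
  simp only [bumpCols, rowCols, Finset.mem_filter, Finset.mem_image] at hj
  obtain ⟨⟨b, ⟨hb, rfl⟩, -⟩, -⟩ := hj
  exact Finset.le_sup (f := Prod.fst) hb

/-- Row insertion of the label `x` into row `i` of the filling `T` of `s`. If row `i` has a label
greater than `x`, then `x` replaces the label of the leftmost such box, and the replaced label is
inserted into row `i + 1`; otherwise `x` is put in a new box and the procedure ends. It is applied
only when rows `i, i + 1, …` are singly labelled, and `Finset.sup` then reads off the label.
The result is the new filling together with the new box. -/
def rowInsert (s : Finset Box) (T : Box → Finset ℕ) (i x : ℕ) : (Box → Finset ℕ) × Box :=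
  if h : (bumpCols s T i x).Nonempty then
    rowInsert s (Function.update T (i, (bumpCols s T i x).min' h) {x}) (i + 1)
      ((T (i, (bumpCols s T i x).min' h)).sup id)
  else (Function.update T (newBox s i) {x}, newBox s i)
termination_by s.sup Prod.fst + 1 - i
decreasing_by
  have := le_of_bumpCols_nonempty h
  omega

/-- The state of the algorithm: the current shape, its set-valued filling, and the auxiliary
filling of the boxes created so far (`0` elsewhere). -/
structure State where
  shape : Finset Box
  filling : Box → Finset ℕ
  aux : Box → ℕ

/-- Row-insert `x` starting in row `i`, and label the new box by `k` in the auxiliary filling. -/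
def State.insertLabel (S : State) (k i x : ℕ) : State :=
  let R := rowInsert S.shape S.filling i x
  { shape := insert R.2 S.shape
    filling := R.1
    aux := Function.update S.aux R.2 k }

/-- The columns of the boxes of row `k` that have more than one label. -/
def multiCols (s : Finset Box) (T : Box → Finset ℕ) (k : ℕ) : Finset ℕ :=
  (rowCols s k).filter fun j => 1 < (T (k, j)).card

/-- Remove the maximum label of the rightmost box of row `k` that has several labels, and
row-insert it starting in row `k + 1`. Nothing happens if row `k` is singly labelled. -/
def State.sweepLabel (k : ℕ) (S : State) : State :=
  if h : (multiCols S.shape S.filling k).Nonempty then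
    let b : Box := (k, (multiCols S.shape S.filling k).max' h)
    let m : ℕ := (S.filling b).sup id
    State.insertLabel { S with filling := Function.update S.filling b ((S.filling b).erase m) }
      k (k + 1) m
  else S

/-- First part of step `k`: repeat until row `k` is singly labelled, that is, once for each label
of row `k` which is not the minimum of its box. -/
def State.sweepRow (k : ℕ) (S : State) : State :=
  (State.sweepLabel k)^[∑ j ∈ rowCols S.shape k, ((S.filling (k, j)).card - 1)] S

/-- If row `i` has a box `b` with `T' b = k` (there is at most one), delete it and row-insert its
label starting in row `i + 1`. -/
def State.sweepBox (T' : Box → ℕ) (k : ℕ) (S : State) (i : ℕ) : State :=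
  if h : ((rowCols S.shape i).filter fun j => T' (i, j) = k).Nonempty then
    let b : Box := (i, ((rowCols S.shape i).filter fun j => T' (i, j) = k).min' h)
    State.insertLabel
      { S with shape := S.shape.erase b, filling := Function.update S.filling b ∅ }
      k (i + 1) ((S.filling b).sup id)
  else S

/-- Second part of step `k`: sweep out the boxes `b` with `T' b = k`, by increasing row `i ≤ r`. -/
def State.sweepBoxes (T' : Box → ℕ) (r k : ℕ) (S : State) : State :=
  (List.range (r + 1)).foldl (State.sweepBox T' k) S

/-- Perform the steps `k, k - 1, …, 1`, in this order. -/
def State.run (T' : Box → ℕ) (r : ℕ) : ℕ → State → State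
  | 0, S => S
  | k + 1, S => State.run T' r k (State.sweepBoxes T' r (k + 1) (State.sweepRow (k + 1) S))

/-- The index of the last row of `σ` (the number of rows of `σ`, if `σ` starts in row `1`). -/
def lastRow (σ : Finset Box) : ℕ := σ.sup Prod.fst

/-- A triple consisting of a shape, a tableau, and a set-valued tableau. -/
abbrev Triple : Type := Finset Box × (Box → ℕ) × (Box → Finset ℕ)

/-- The skew set-valued row insertion algorithm: it takes `(l, T', T)` to `(μ, T'', T~)`. -/
def algorithm (σ : Finset Box) (p : Triple) : Triple :=
  let S := State.run p.2.1 (lastRow σ) (lastRow σ) ⟨p.1, p.2.2, fun _ => 0⟩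
  (S.shape, S.aux, S.filling)

/-! ### Inputs and outputs -/

/-- The pairs `(l, T')`: a skew shape `l ⊇ σ` with `B(l/σ) = ∅`, and a reverse row-strict,
row-weakly-bounded tableau `T'` on `A(l/σ)`. -/
def inputPairs (σ : Finset Box) : Set (Finset Box × (Box → ℕ)) :=
  {p | Extends σ p.1 ∧ below σ p.1 = ∅ ∧ IsTableau (above σ p.1) p.2 ∧
    IsReverseRowStrict (above σ p.1) p.2 ∧ IsRowWeaklyBounded (above σ p.1) p.2}

/-- The pairs `(μ, T'')`: a skew shape `μ ⊇ σ` with `A(μ/σ) = ∅`, and a reverse row-strict,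
row-bounded tableau `T''` on `B(μ/σ)` of content `e`. -/
def outputPairs (σ : Finset Box) (e : ℕ → ℕ) : Set (Finset Box × (Box → ℕ)) :=
  {p | Extends σ p.1 ∧ above σ p.1 = ∅ ∧ IsTableau (below σ p.1) p.2 ∧
    IsReverseRowStrict (below σ p.1) p.2 ∧ IsRowBounded (below σ p.1) p.2 ∧
    ∀ k, content (below σ p.1) p.2 k = e k}

/-- The vector `e - c(T')`, for a tableau `T'` on `A(l/σ)`. -/
def reducedExcess (σ : Finset Box) (e : ℕ → ℕ) (p : Finset Box × (Box → ℕ)) (i : ℕ) : ℤ :=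
  (e i : ℤ) - (content (above σ p.1) p.2 i : ℤ)

/-- The triples `(l, T', T)` with `(l, T')` as above and `T ∈ SS_{c, e - c(T')}(l)`. -/
def inputs (σ : Finset Box) (c e : ℕ → ℕ) : Set Triple :=
  {p | (p.1, p.2.1) ∈ inputPairs σ ∧ p.2.2 ∈ SS c (reducedExcess σ e (p.1, p.2.1)) p.1}

/-- The triples `(μ, T'', T~)` with `(μ, T'')` as above and `T~ ∈ SS_{c, 0}(μ)`. -/
def outputs (σ : Finset Box) (c e : ℕ → ℕ) : Set Triple :=
  {p | (p.1, p.2.1) ∈ outputPairs σ e ∧ p.2.2 ∈ SS c (fun _ => 0) p.1}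

end SkewInsertion

namespace SkewInsertion

/-! ### The regions above and below a skew shape -/

/-! The algorithm is inverted one step at a time. A state before step `k` (`Core`) consists of a
semistandard filling that is singly labelled below row `k`, the tableau `t` of the boxes still to be
swept out, with labels at most `k`, and the tableau `aux` of the boxes already created, with labels
greater than `k`. When `k` is the last row of `σ`, the row bound leaves no room for `aux` and these
states are the inputs; when `k = 0`, `t` vanishes and they are the outputs. It is therefore enough
that each step is a bijection between consecutive kinds of states (`bijOn_stepMap`).

Within a step each row receives a set `X` of labels, every one smaller than those before it, and
emits a set `Y`. Instead of the order of events, the proof records the history of every box, the set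
of all labels it ever holds (`RowFlow`). Labels that enter a box are smaller than its initial ones,
labels that leave are larger than its final ones, and histories increase weakly along the row; at
most one box is created, at the right end, and at most one vanishes, at the left end. These axioms
are unchanged when time, columns and labels are all reversed. The initial row and `X` determine the
history, up to the column of the new box; dually the final row and `Y` determine it, up to the
column of the vanished box. Those two columns are forced: the leftmost free place below `σ`,
respectively the rightmost free place above `σ`. In a singly labelled row the initial label of a box
is the maximum of its history and the final label is the minimum.

The labels leaving row `i` enter row `i + 1`. Going down the rows, the state before a step
determines the state after it (`Flow.final_unique`); going up from beyond the shapes, the converse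
holds (`Flow.initial_unique`), which is injectivity. `rowInsert_spec` and `Core.step` show that the
actual step produces such a flow, and `Core.exists_initial` builds a predecessor of any given final
state from the bottom up. No reverse algorithm has to be traced: the step applied to that
predecessor yields a second flow with the same start, hence with the same end. Strictness of columns
passes through a flow in both directions by `RowFlow.col_lt` and `RowFlow.col_lt'`.

Content is preserved, and so is `totalExcess`: each sweep in step `k` lowers the excess of row `k`
or the `k`-content of `t` by one, and the new box adds one to the `k`-content of `aux`. The identity
of sums counts both sets of triples by their pairs. -/

/-- The column `j` meets `σ`. -/
def InCols (σ : Finset Box) (j : ℕ) : Prop := ∃ a ∈ σ, a.2 = j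

/-- The columns of `σ` form an interval. -/
def ColsConvex (σ : Finset Box) : Prop :=
  ∀ j j' j'', InCols σ j → InCols σ j'' → j ≤ j' → j' ≤ j'' → InCols σ j'

/-- The box `b` lies outside `σ`, above a box of `σ` in its column. -/
def AboveRegion (σ : Finset Box) (b : Box) : Prop := b ∉ σ ∧ ∃ a ∈ σ, a.2 = b.2 ∧ b.1 < a.1

/-- The box `b` lies outside `σ`, below a box of `σ` in its column. -/
def BelowRegion (σ : Finset Box) (b : Box) : Prop := b ∉ σ ∧ ∃ a ∈ σ, a.2 = b.2 ∧ a.1 < b.1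

theorem mem_above {σ l : Finset Box} {b : Box} :
    b ∈ above σ l ↔ b ∈ l ∧ AboveRegion σ b := by
  simp only [above, AboveRegion, Finset.mem_filter, Finset.mem_sdiff]
  tauto

theorem mem_below {σ l : Finset Box} {b : Box} :
    b ∈ below σ l ↔ b ∈ l ∧ BelowRegion σ b := by
  simp only [below, BelowRegion, Finset.mem_filter, Finset.mem_sdiff]
  tauto

theorem IsSkewShape.mem_of_le_of_le {s : Finset Box} (h : IsSkewShape s) {a b c : Box}
    (ha : a ∈ s) (hc : c ∈ s) (hab : a ≤ b) (hbc : b ≤ c) : b ∈ s :=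
  h.ordConnected.out ha hc ⟨hab, hbc⟩

theorem AboveRegion.inCols {σ : Finset Box} {b : Box} (h : AboveRegion σ b) : InCols σ b.2 := by
  obtain ⟨-, a, ha, h1, -⟩ := h
  exact ⟨a, ha, h1⟩

theorem BelowRegion.inCols {σ : Finset Box} {b : Box} (h : BelowRegion σ b) : InCols σ b.2 := by
  obtain ⟨-, a, ha, h1, -⟩ := h
  exact ⟨a, ha, h1⟩

theorem InCols.trichotomy {σ : Finset Box} {b : Box} (h : InCols σ b.2) :
    AboveRegion σ b ∨ b ∈ σ ∨ BelowRegion σ b := by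
  obtain ⟨a, ha, hab⟩ := h
  by_cases hb : b ∈ σ
  · exact Or.inr (Or.inl hb)
  rcases lt_trichotomy a.1 b.1 with h | h | h
  · exact Or.inr (Or.inr ⟨hb, a, ha, hab, h⟩)
  · exact absurd (Prod.ext h hab ▸ ha) hb
  · exact Or.inl ⟨hb, a, ha, hab, h⟩

theorem AboveRegion.not_belowRegion {σ : Finset Box} (hσ : IsSkewShape σ) {b : Box}
    (h : AboveRegion σ b) : ¬ BelowRegion σ b := by
  rintro ⟨-, a', ha', h1', h2'⟩
  obtain ⟨hb, a, ha, h1, h2⟩ := h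
  exact hb (hσ.mem_of_le_of_le ha' ha ⟨h2'.le, h1'.le⟩ ⟨h2.le, h1.ge⟩)

/-- If `c` were in `σ` or below it, then `b` or `c` would be squeezed between two boxes of `σ`. -/
theorem AboveRegion.of_le {σ : Finset Box} (hσ : IsSkewShape σ) {b c : Box}
    (h : AboveRegion σ b) (hcb : c ≤ b) (hc : InCols σ c.2) : AboveRegion σ c := by
  obtain ⟨hb, a, ha, h1, h2⟩ := h
  have hba : b ≤ a := ⟨h2.le, h1.ge⟩
  rcases hc.trichotomy with hc | hc | hc
  · exact hc
  · exact absurd (hσ.mem_of_le_of_le hc ha hcb hba) hb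
  · obtain ⟨hc, a', ha', h1', h2'⟩ := hc
    exact absurd (hσ.mem_of_le_of_le ha' ha ⟨h2'.le, h1'.le⟩ (hcb.trans hba)) hc

theorem BelowRegion.of_le {σ : Finset Box} (hσ : IsSkewShape σ) {b c : Box}
    (h : BelowRegion σ b) (hbc : b ≤ c) (hc : InCols σ c.2) : BelowRegion σ c := by
  obtain ⟨hb, a, ha, h1, h2⟩ := h
  have hab : a ≤ b := ⟨h2.le, h1.le⟩
  rcases hc.trichotomy with hc | hc | hc
  · obtain ⟨hc, a', ha', h1', h2'⟩ := hc
    exact absurd (hσ.mem_of_le_of_le ha ha' (hab.trans hbc) ⟨h2'.le, h1'.ge⟩) hc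
  · exact absurd (hσ.mem_of_le_of_le ha hc hab hbc) hb
  · exact hc

theorem Extends.inCols {σ s : Finset Box} (h : Extends σ s) {b : Box} (hb : b ∈ s) :
    InCols σ b.2 := h.column b hb

theorem Extends.mem_of_above {σ s : Finset Box} (h : Extends σ s) {b c : Box} (hb : b ∈ s)
    (hbc : b ≤ c) (hc : AboveRegion σ c) : c ∈ s := by
  obtain ⟨-, a, ha, h1, h2⟩ := hc
  exact h.isSkewShape.mem_of_le_of_le hb (h.subset ha) hbc ⟨h2.le, h1.ge⟩

theorem Extends.mem_of_below {σ s : Finset Box} (h : Extends σ s) {b c : Box} (hc : c ∈ s)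
    (hbc : b ≤ c) (hb : BelowRegion σ b) : b ∈ s := by
  obtain ⟨-, a, ha, h1, h2⟩ := hb
  exact h.isSkewShape.mem_of_le_of_le (h.subset ha) hc ⟨h2.le, h1.le⟩ hbc

/-- Convexity of `s` need only be tested region by region: in an interval, a box above `σ` has its
lower end above `σ`, and a box below `σ` has its upper end below `σ`. Convexity of the columns rules
out boxes in columns that miss `σ`. -/
theorem extends_of_closed {σ s : Finset Box} (hσ : IsSkewShape σ) (hcol : ColsConvex σ)
    (hpos : ∀ b ∈ s, 0 < b.1 ∧ 0 < b.2) (hsub : σ ⊆ s) (hcols : ∀ b ∈ s, InCols σ b.2)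
    (habove : ∀ b c, b ∈ s → AboveRegion σ b → b ≤ c → AboveRegion σ c → c ∈ s)
    (hbelow : ∀ b c, c ∈ s → BelowRegion σ c → b ≤ c → BelowRegion σ b → b ∈ s) :
    Extends σ s := by
  refine ⟨⟨hpos, ⟨fun x hx z hz y hy => ?_⟩⟩, hsub, hcols⟩
  have hy2 : InCols σ y.2 := hcol _ _ _ (hcols x hx) (hcols z hz) hy.1.2 hy.2.2
  rcases hy2.trichotomy with h | h | h
  · exact habove x y hx (h.of_le hσ hy.1 (hcols x hx)) hy.1 h
  · exact hsub h
  · exact hbelow y z hz (h.of_le hσ hy.2 (hcols z hz)) hy.2 h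

theorem Extends.belowRegion_of_not_mem {σ s : Finset Box} (h : Extends σ s) {i j : ℕ}
    (hj : (i, j) ∈ s) (hn : (i + 1, j) ∉ s) : BelowRegion σ (i + 1, j) := by
  have hle : ((i, j) : Box) ≤ (i + 1, j) := ⟨Nat.le_succ i, le_rfl⟩
  have hcj : InCols σ ((i + 1, j) : Box).2 := h.inCols (b := (i, j)) hj
  rcases hcj.trichotomy with h' | h' | h'
  · exact absurd (h.mem_of_above hj hle h') hn
  · exact absurd (h.subset h') hn
  · exact h'

theorem mem_rowCols {s : Finset Box} {i j : ℕ} : j ∈ rowCols s i ↔ (i, j) ∈ s := by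
  simp [rowCols]

theorem Extends.insert_below {σ s : Finset Box} (hσ : IsSkewShape σ) (hcol : ColsConvex σ)
    (h : Extends σ s) {n : Box} (hn : BelowRegion σ n) (hpos : 0 < n.1)
    (hclosed : ∀ b, b ≤ n → b ≠ n → BelowRegion σ b → b ∈ s) : Extends σ (insert n s) := by
  refine extends_of_closed hσ hcol ?_ (h.subset.trans (Finset.subset_insert _ _)) ?_ ?_ ?_
  · intro b hb
    rcases Finset.mem_insert.1 hb with rfl | hb
    · obtain ⟨a, ha, hab⟩ := hn.inCols
      exact ⟨hpos, hab ▸ (hσ.pos a ha).2⟩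
    · exact h.isSkewShape.pos b hb
  · intro b hb
    rcases Finset.mem_insert.1 hb with rfl | hb
    · exact hn.inCols
    · exact h.inCols hb
  · intro b c hb hb' hbc hc
    rcases Finset.mem_insert.1 hb with rfl | hb
    · exact absurd hn (hb'.not_belowRegion hσ)
    · exact Finset.mem_insert_of_mem (h.mem_of_above hb hbc hc)
  · intro b c hc hc' hbc hb
    rcases Finset.mem_insert.1 hc with rfl | hc
    · by_cases hbn : b = c
      · exact hbn ▸ Finset.mem_insert_self _ _
      · exact Finset.mem_insert_of_mem (hclosed b hbc hbn hb)
    · exact Finset.mem_insert_of_mem (h.mem_of_below hc hbc hb)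

theorem le_cases {b : Box} {i j : ℕ} (h : b ≤ (i + 1, j)) (hne : b ≠ (i + 1, j)) :
    b ≤ (i, j) ∨ (b.1 = i + 1 ∧ b.2 < j) := by
  obtain ⟨p, q⟩ := b
  obtain ⟨h1, h2⟩ := h
  simp only [ne_eq, Prod.mk.injEq, not_and] at h1 h2 hne
  by_cases hp : p = i + 1
  · exact Or.inr ⟨hp, lt_of_le_of_ne h2 (hne hp)⟩
  · exact Or.inl ⟨by simp only; omega, h2⟩

theorem newBox_fst (s : Finset Box) (i : ℕ) : (newBox s i).1 = i := by
  unfold newBox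
  split <;> rfl

/-- An insertion that ends in row `i + 1` below a box `(i, j)` with nothing below it adds a box in
the region below `σ`, and the shape still extends `σ`. -/
theorem newBox_spec {σ s : Finset Box} (hσ : IsSkewShape σ) (hcol : ColsConvex σ)
    (hs : Extends σ s) {i j : ℕ} (hj : (i, j) ∈ s) (hn : (i + 1, j) ∉ s) :
    newBox s (i + 1) ∉ s ∧ BelowRegion σ (newBox s (i + 1)) ∧
      Extends σ (insert (newBox s (i + 1)) s) ∧
      ∀ j', (i + 1, j') ∈ s → j' < (newBox s (i + 1)).2 := by
  have hlt : ∀ j', (i + 1, j') ∈ s → j' < j := by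
    intro j' hj'
    by_contra hle
    exact hn (hs.isSkewShape.mem_of_le_of_le hj hj' ⟨Nat.le_succ i, le_rfl⟩
      ⟨le_rfl, not_lt.1 hle⟩)
  by_cases hne : (rowCols s (i + 1)).Nonempty
  · have hnb : newBox s (i + 1) = (i + 1, (rowCols s (i + 1)).sup id + 1) := by
      simp [newBox, hne]
    obtain ⟨q, hq, hqs⟩ := Finset.exists_mem_eq_sup _ hne (id : ℕ → ℕ)
    rw [hnb, hqs]
    simp only [id]
    have hmax : ∀ j', (i + 1, j') ∈ s → j' < q + 1 := by
      intro j' hj'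
      have := Finset.le_sup (f := (id : ℕ → ℕ)) (mem_rowCols.2 hj')
      rw [hqs] at this
      exact Nat.lt_succ_of_le this
    have hqs' : (i + 1, q) ∈ s := mem_rowCols.1 hq
    have hqj := hlt q hqs'
    have hq1 : (i + 1, q + 1) ∉ s := fun h => (lt_irrefl _ (hmax _ h))
    -- Column `q + 1` lies between the columns `q` and `j`, both of which meet `σ`.
    have hqc : InCols σ ((i + 1, q + 1) : Box).2 :=
      hcol q _ j (hs.inCols hqs') (hs.inCols hj) (Nat.le_succ q) hqj
    have hqq : ((i + 1, q) : Box) ≤ (i + 1, q + 1) := ⟨le_rfl, Nat.le_succ q⟩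
    have hbr : BelowRegion σ (i + 1, q + 1) := by
      rcases hqc.trichotomy with h' | h' | h'
      · exact absurd (hs.mem_of_above hqs' hqq h') hq1
      · exact absurd (hs.subset h') hq1
      · exact h'
    refine ⟨hq1, hbr, hs.insert_below hσ hcol hbr (Nat.succ_pos i) ?_, hmax⟩
    intro b hb hbn hb'
    rcases le_cases hb hbn with h' | ⟨h1, h2⟩
    · exact hs.mem_of_below hj (h'.trans ⟨le_rfl, hqj⟩) hb'
    · exact hs.mem_of_below hqs' ⟨h1.le, Nat.le_of_lt_succ h2⟩ hb'
  · have hempty : ∀ j', (i + 1, j') ∉ s := by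
      intro j' hj'
      exact hne ⟨j', mem_rowCols.2 hj'⟩
    have hne' : (rowCols s i).Nonempty := ⟨j, mem_rowCols.2 hj⟩
    obtain ⟨p, hp⟩ := Finset.min_of_nonempty hne'
    have hnb : newBox s (i + 1) = (i + 1, p) := by
      simp only [newBox, hne, if_false, Nat.add_sub_cancel, hp]
      rfl
    rw [hnb]
    have hps : (i, p) ∈ s := mem_rowCols.1 (Finset.mem_of_min hp)
    have hbr : BelowRegion σ (i + 1, p) := hs.belowRegion_of_not_mem hps (hempty p)
    refine ⟨hempty p, hbr, hs.insert_below hσ hcol hbr (Nat.succ_pos i) ?_,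
      fun j' hj' => absurd hj' (hempty j')⟩
    intro b hb hbn hb'
    rcases le_cases hb hbn with h' | ⟨h1, h2⟩
    · exact hs.mem_of_below hps h' hb'
    · obtain ⟨b1, b2⟩ := b
      simp only at h1 h2
      subst h1
      -- Such a box would force `(i, b2)` into the shape, to the left of the leftmost box of row
      -- `i`.
      exfalso
      have hmem : (i, b2) ∈ s := by
        have hc : InCols σ ((i, b2) : Box).2 := hb'.inCols
        rcases hc.trichotomy with h' | h' | h'
        · obtain ⟨-, a, ha, h3, h4⟩ := h'
          have hbσ := hb'.1
          simp only at h3 h4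
          rcases Nat.lt_or_ge (i + 1) a.1 with h5 | h5
          · exact absurd hb' (AboveRegion.not_belowRegion hσ ⟨hbσ, a, ha, h3, h5⟩)
          · have : a = (i + 1, b2) := Prod.ext (by simp only; omega) h3
            exact absurd (this ▸ ha) hbσ
        · exact hs.subset h'
        · exact hs.mem_of_below hps ⟨le_rfl, h2.le⟩ h'
      have := Finset.min_le_of_eq (mem_rowCols.2 hmem) hp
      omega

/-- No edge of the Hasse diagram can jump over a column that misses `σ`, so lying to the left of
that column is constant on connected components. -/
theorem IsConnectedShape.colsConvex {σ : Finset Box} (hσ : IsSkewShape σ)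
    (h : IsConnectedShape σ) : ColsConvex σ := by
  rintro j j' j'' ⟨a, ha, rfl⟩ ⟨b, hb, rfl⟩ h1 h2
  by_contra hn
  have hne : ∀ c ∈ σ, c.2 ≠ j' := fun c hc hcj => hn ⟨c, hc, hcj⟩
  have key : ∀ c d : {b : Box // b ∈ σ}, c ⋖ d → (c.1.2 < j' ↔ d.1.2 < j') := by
    intro c d hcd
    have hle : c.1 ≤ d.1 := hcd.le
    refine ⟨fun hc => ?_, fun hd => lt_of_le_of_lt hle.2 hd⟩
    by_contra hd
    have hd' : j' < d.1.2 := lt_of_le_of_ne (not_lt.1 hd) (hne _ d.2).symm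
    -- The right neighbour of `c` is strictly between `c` and `d`, since `d` is at least two columns
    -- further on; this contradicts the covering relation.
    have hm : ((c.1.1, c.1.2 + 1) : Box) ∈ σ :=
      hσ.mem_of_le_of_le c.2 d.2 ⟨le_rfl, Nat.le_succ _⟩ ⟨hle.1, by simp only; omega⟩
    refine hcd.2 (c := ⟨_, hm⟩) ?_ ?_
    · refine lt_of_le_of_ne (show c.1 ≤ _ from ⟨le_rfl, Nat.le_succ _⟩) ?_
      intro h
      have := congrArg (fun x => x.1.2) h
      simp at this
    · refine lt_of_le_of_ne (show _ ≤ d.1 from ⟨hle.1, by simp only; omega⟩) ?_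
      intro h
      have := congrArg (fun x => x.1.2) h
      simp only at this
      omega
  obtain ⟨w⟩ := h ⟨a, ha⟩ ⟨b, hb⟩
  have : ∀ c d : {b : Box // b ∈ σ}, (SimpleGraph.hasse _).Walk c d →
      (c.1.2 < j' ↔ d.1.2 < j') := by
    intro c d w
    induction w with
    | nil => exact Iff.rfl
    | cons hadj _ ih =>
      rw [← ih]
      rcases SimpleGraph.hasse_adj.1 hadj with h | h
      · exact key _ _ h
      · exact (key _ _ h).symm
  have h3 := (this _ _ w).1 (lt_of_le_of_ne h1 (hne a ha))
  simp only at h3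
  omega

end SkewInsertion

namespace SkewInsertion

/-! ### The flow of labels through a row -/

/-- A row with filling `f0` receives the labels in `X`, emits the labels in `Y`, and ends up with
the filling `f1`; the set `z j` collects the labels which are in column `j` at some time. -/
structure RowFlow {ι α : Type*} [LinearOrder ι] [LinearOrder α] (f0 f1 z : ι → Finset α)
    (X Y : Finset α) : Prop where
  sub0 : ∀ j x, x ∈ f0 j → x ∈ z j
  sub1 : ∀ j x, x ∈ f1 j → x ∈ z j
  mono : ∀ j j', j < j' → ∀ x ∈ z j, ∀ y ∈ z j', x ≤ y
  lt0 : ∀ j x y, x ∈ z j → x ∉ f0 j → y ∈ f0 j → x < y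
  lt1 : ∀ j x y, x ∈ z j → x ∉ f1 j → y ∈ f1 j → y < x
  mem_in : ∀ x, x ∈ X ↔ ∃ j, x ∈ z j ∧ x ∉ f0 j
  mem_out : ∀ x, x ∈ Y ↔ ∃ j, x ∈ z j ∧ x ∉ f1 j
  last : ∀ j j', ¬ (f0 j).Nonempty → (z j).Nonempty → (z j').Nonempty → j' ≤ j
  first : ∀ j j', ¬ (f1 j).Nonempty → (z j).Nonempty → (z j').Nonempty → j ≤ j'
  cover : ∀ j, (z j).Nonempty → (f0 j).Nonempty ∨ (f1 j).Nonempty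

namespace RowFlow

variable {ι α : Type*} [LinearOrder ι] [LinearOrder α] {f0 f1 z : ι → Finset α} {X Y : Finset α}

/-- Reversing time exchanges the initial and the final filling, and with the columns and labels
reversed as well the axioms swap in pairs. Every statement about forward flows thus has a backward
twin. -/
theorem dual (h : RowFlow f0 f1 z X Y) :
    RowFlow (ι := ιᵒᵈ) (α := αᵒᵈ) f1 f0 z Y X where
  sub0 := h.sub1
  sub1 := h.sub0
  mono := fun j j' hj x hx y hy => h.mono j' j hj y hy x hx
  lt0 := fun j x y hx hx' hy => h.lt1 j x y hx hx' hy
  lt1 := fun j x y hx hx' hy => h.lt0 j x y hx hx' hy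
  mem_in := h.mem_out
  mem_out := h.mem_in
  last := fun j j' h1 h2 h3 => h.first j j' h1 h2 h3
  first := fun j j' h1 h2 h3 => h.last j j' h1 h2 h3
  cover := fun j hj => (h.cover j hj).symm

/-- The history of a box is determined by the initial row and the incoming labels: the case of a
box of the initial row. -/
theorem mem_iff (h : RowFlow f0 f1 z X Y) {j : ι} (hj : (f0 j).Nonempty) (x : α) :
    x ∈ z j ↔ x ∈ f0 j ∨ (x ∈ X ∧ (∀ y ∈ f0 j, x < y) ∧ ∀ j' < j, ∀ y ∈ f0 j', y ≤ x) := by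
  constructor
  · intro hx
    by_cases hx0 : x ∈ f0 j
    · exact Or.inl hx0
    · exact Or.inr ⟨(h.mem_in x).2 ⟨j, hx, hx0⟩, fun y hy => h.lt0 j x y hx hx0 hy,
        fun j' hj' y hy => h.mono j' j hj' y (h.sub0 j' y hy) x hx⟩
  · rintro (hx | ⟨hx, h1, h2⟩)
    · exact h.sub0 j x hx
    obtain ⟨p, hp, hp0⟩ := (h.mem_in x).1 hx
    obtain ⟨w, hw⟩ := hj
    rcases lt_trichotomy p j with hpj | rfl | hpj
    · by_cases hne : (f0 p).Nonempty
      · obtain ⟨v, hv⟩ := hne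
        exact absurd (h.lt0 p x v hp hp0 hv) (not_lt.2 (h2 p hpj v hv))
      · exact absurd (h.last p j hne ⟨x, hp⟩ ⟨w, h.sub0 j w hw⟩) (not_le.2 hpj)
    · exact hp
    · exact absurd (h1 w hw) (not_lt.2 (h.mono j p hpj w (h.sub0 j w hw) x hp))

/-- The history of a box is determined by the initial row and the incoming labels: the case of a
new box. -/
theorem mem_iff_of_new (h : RowFlow f0 f1 z X Y) {j : ι} (hj : ¬ (f0 j).Nonempty)
    (hz : (z j).Nonempty) (x : α) :
    x ∈ z j ↔ x ∈ X ∧ ∀ j', ∀ y ∈ f0 j', y ≤ x := by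
  have hlast : ∀ j', (f0 j').Nonempty → j' < j := by
    rintro j' ⟨y, hy⟩
    refine lt_of_le_of_ne (h.last j j' hj hz ⟨y, h.sub0 j' y hy⟩) ?_
    rintro rfl
    exact hj ⟨y, hy⟩
  constructor
  · intro hx
    refine ⟨(h.mem_in x).2 ⟨j, hx, fun h' => hj ⟨x, h'⟩⟩, fun j' y hy => ?_⟩
    exact h.mono j' j (hlast j' ⟨y, hy⟩) y (h.sub0 j' y hy) x hx
  · rintro ⟨hx, h1⟩
    obtain ⟨p, hp, hp0⟩ := (h.mem_in x).1 hx
    by_cases hne : (f0 p).Nonempty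
    · obtain ⟨v, hv⟩ := hne
      exact absurd (h.lt0 p x v hp hp0 hv) (not_lt.2 (h1 p v hv))
    · have : p = j := le_antisymm (h.last j p hj hz ⟨x, hp⟩) (h.last p j hne ⟨x, hp⟩ hz)
      exact this ▸ hp

/-- A label can enter an old box only if it is smaller than the labels initially there. -/
theorem exists_new (h : RowFlow f0 f1 z X Y) {x : α} (hx : x ∈ X)
    (h1 : ∀ j', ∀ y ∈ f0 j', y ≤ x) : ∃ j, ¬ (f0 j).Nonempty ∧ x ∈ z j := by
  obtain ⟨p, hp, hp0⟩ := (h.mem_in x).1 hx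
  refine ⟨p, ?_, hp⟩
  rintro ⟨v, hv⟩
  exact absurd (h.lt0 p x v hp hp0 hv) (not_lt.2 (h1 p v hv))

theorem history_subset {f1' z' : ι → Finset α} {Y' : Finset α} (h : RowFlow f0 f1 z X Y)
    (h' : RowFlow f0 f1' z' X Y')
    (hnew : ∀ j j', ¬ (f0 j).Nonempty → (z j).Nonempty → ¬ (f0 j').Nonempty → (z' j').Nonempty →
      j = j') (j : ι) (x : α) (hx : x ∈ z j) : x ∈ z' j := by
  by_cases hj : (f0 j).Nonempty
  · rw [h'.mem_iff hj]
    exact (h.mem_iff hj x).1 hx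
  · obtain ⟨hxX, h1⟩ := (h.mem_iff_of_new hj ⟨x, hx⟩ x).1 hx
    obtain ⟨p, hp, hp'⟩ := h'.exists_new hxX h1
    rw [hnew j p hj ⟨x, hx⟩ hp ⟨x, hp'⟩]
    exact hp'

/-- The initial row and the incoming labels determine the history of the row, provided they
determine the column of the new box. -/
theorem history_unique {f1' z' : ι → Finset α} {Y' : Finset α} (h : RowFlow f0 f1 z X Y)
    (h' : RowFlow f0 f1' z' X Y')
    (hnew : ∀ j j', ¬ (f0 j).Nonempty → (z j).Nonempty → ¬ (f0 j').Nonempty → (z' j').Nonempty →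
      j = j') : z = z' := by
  funext j
  ext x
  exact ⟨h.history_subset h' hnew j x,
    h'.history_subset h (fun a b h1 h2 h3 h4 => (hnew b a h3 h4 h1 h2).symm) j x⟩

theorem history_unique' {f0' z' : ι → Finset α} {X' : Finset α} (h : RowFlow f0 f1 z X Y)
    (h' : RowFlow f0' f1 z' X' Y)
    (hnew : ∀ j j', ¬ (f1 j).Nonempty → (z j).Nonempty → ¬ (f1 j').Nonempty → (z' j').Nonempty →
      j = j') : z = z' :=
  history_unique (ι := ιᵒᵈ) (α := αᵒᵈ) h.dual h'.dual hnew

/-- The columns of the new filling increase strictly if those of the old filling do. -/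
theorem col_lt {g0 g1 w : ι → Finset α} {W : Finset α} (h : RowFlow f0 f1 z X Y)
    (h' : RowFlow g0 g1 w Y W) (hcol : ∀ j, ∀ x ∈ f0 j, ∀ y ∈ g0 j, x < y)
    (ha : ∀ j, (f1 j).Nonempty → (g0 j).Nonempty → (f0 j).Nonempty)
    (hb : ∀ j j', j' < j → (f0 j').Nonempty → (f1 j).Nonempty → (g1 j).Nonempty →
      (g0 j').Nonempty) (j : ι) : ∀ x ∈ f1 j, ∀ y ∈ g1 j, x < y := by
  intro u hu v hv
  have huz := h.sub1 j u hu
  have hvw := h'.sub1 j v hv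
  by_cases hv0 : v ∈ g0 j
  · obtain ⟨y, hy⟩ := ha j ⟨u, hu⟩ ⟨v, hv0⟩
    by_cases hu0 : u ∈ f0 j
    · exact hcol j u hu0 v hv0
    · exact (h.lt0 j u y huz hu0 hy).trans (hcol j y hy v hv0)
  -- The label `v` arrived in the lower row during the flow, so it left the upper row, from some
  -- column `p`.
  obtain ⟨p, hp, hp1⟩ := (h.mem_out v).1 ((h'.mem_in v).2 ⟨j, hvw, hv0⟩)
  rcases lt_trichotomy p j with hpj | rfl | hpj
  -- Leaving from the left of `j` is impossible: column `p` initially holds `x` over `y`, and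
  -- monotonicity of the lower row gives `x < y ≤ v ≤ x`.
  · have hf0 : (f0 p).Nonempty := by
      by_contra hne
      exact absurd (h.last p j hne ⟨v, hp⟩ ⟨u, huz⟩) (not_le.2 hpj)
    obtain ⟨y, hy⟩ := hb j p hpj hf0 ⟨u, hu⟩ ⟨v, hv⟩
    obtain ⟨x, hx⟩ := hf0
    have h1 : x < y := hcol p x hx y hy
    have h2 : y ≤ v := h'.mono p j hpj y (h'.sub0 p y hy) v hvw
    have h3 : v ≤ x := by
      by_cases hv0 : v ∈ f0 p
      · by_contra hlt
        exact absurd (hcol p v hv0 y hy) (not_lt.2 h2)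
      · exact (h.lt0 p v x hp hv0 hx).le
    exact absurd (h1.trans_le (h2.trans h3)) (lt_irrefl _)
  · exact h.lt1 p v u hp hp1 hu
  -- From the right of `j`: the label left behind in column `p` is at least `u` and less than `v`.
  · have hf1 : (f1 p).Nonempty := by
      by_contra hne
      exact absurd (h.first p j hne ⟨v, hp⟩ ⟨u, huz⟩) (not_le.2 hpj)
    obtain ⟨y, hy⟩ := hf1
    exact (h.mono j p hpj u huz y (h.sub1 p y hy)).trans_lt (h.lt1 p v y hp hp1 hy)

/-- The columns of the old filling increase strictly if those of the new filling do. -/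
theorem col_lt' {g0 g1 w : ι → Finset α} {W : Finset α} (h : RowFlow f0 f1 z X Y)
    (h' : RowFlow g0 g1 w Y W) (hcol : ∀ j, ∀ x ∈ f1 j, ∀ y ∈ g1 j, x < y)
    (ha : ∀ j, (g0 j).Nonempty → (f1 j).Nonempty → (g1 j).Nonempty)
    (hb : ∀ j j', j < j' → (g1 j').Nonempty → (g0 j).Nonempty → (f0 j).Nonempty →
      (f1 j').Nonempty) (j : ι) : ∀ x ∈ f0 j, ∀ y ∈ g0 j, x < y := fun x hx y hy =>
  col_lt (ι := ιᵒᵈ) (α := αᵒᵈ) h'.dual h.dual (fun j y hy x hx => hcol j x hx y hy) ha hb j y hy x hx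

/-- A label `x` bumps the label `y` from the column `q`. -/
theorem bump [DecidableEq ι] (h : RowFlow f0 f1 z X Y) (hcard : ∀ j, (f0 j).card ≤ 1)
    (hcard1 : ∀ j, (f1 j).card ≤ 1) (hdel : ∀ j, (z j).Nonempty → (f1 j).Nonempty) {x y : α} {q : ι}
    (hx : ∀ v ∈ X, x < v) (hy : y ∈ f1 q) (hxy : x < y)
    (hq : ∀ j < q, ∀ v ∈ f1 j, v ≤ x) :
    RowFlow f0 (Function.update f1 q {x}) (Function.update z q (insert x (z q)))
      (insert x X) (insert y Y) ∧ ∀ v ∈ Y, y < v := by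
  have hone0 : ∀ j, ∀ v ∈ f0 j, ∀ w ∈ f0 j, v = w := fun j v hv w hw =>
    Finset.card_le_one.1 (hcard j) v hv w hw
  have hone1 : ∀ j, ∀ v ∈ f1 j, ∀ w ∈ f1 j, v = w := fun j v hv w hw =>
    Finset.card_le_one.1 (hcard1 j) v hv w hw
  -- Columns left of `q` have not been touched: every earlier arrival exceeds `x`, while these
  -- columns now hold labels at most `x`.
  have hleft : ∀ j < q, ∀ v ∈ z j, v ∈ f1 j ∧ v ≤ x := by
    intro j hj v hv
    obtain ⟨w, hw⟩ := hdel j ⟨v, hv⟩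
    have hwx := hq j hj w hw
    have hwz := h.sub1 j w hw
    have hw0 : w ∈ f0 j := by
      by_contra hw0
      exact absurd (hx w ((h.mem_in w).2 ⟨j, hwz, hw0⟩)) (not_lt.2 hwx)
    have hv0 : v ∈ f0 j := by
      by_contra hv0
      exact absurd ((hx v ((h.mem_in v).2 ⟨j, hv, hv0⟩)).trans (h.lt0 j v w hv hv0 hw0))
        (not_lt.2 hwx)
    rw [hone0 j v hv0 w hw0]
    exact ⟨hw, hwx⟩
  have hyz := h.sub1 q y hy
  -- The current label `y` is the least that the box has ever held.
  have hge : ∀ v ∈ z q, y ≤ v := by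
    intro v hv
    by_cases hv1 : v ∈ f1 q
    · exact (hone1 q y hy v hv1).le
    · exact (h.lt1 q v y hv hv1 hy).le
  have hxz : x ∉ z q := fun hxz => absurd (hge x hxz) (not_le.2 hxy)
  have hzne : ∀ j, (Function.update z q (insert x (z q)) j).Nonempty ↔ (z j).Nonempty := by
    intro j
    by_cases hj : j = q
    · subst hj
      simp only [Function.update_self, Finset.insert_nonempty, true_iff]
      exact ⟨y, hyz⟩
    · rw [Function.update_of_ne hj]
  have hfne : ∀ j, (Function.update f1 q {x} j).Nonempty ↔ (f1 j).Nonempty := by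
    intro j
    by_cases hj : j = q
    · subst hj
      simp only [Function.update_self, Finset.singleton_nonempty, true_iff]
      exact ⟨y, hy⟩
    · rw [Function.update_of_ne hj]
  have hzmem : ∀ j v, v ∈ Function.update z q (insert x (z q)) j ↔ v ∈ z j ∨ (j = q ∧ v = x) := by
    intro j v
    by_cases hj : j = q
    · subst hj
      simp [or_comm]
    · simp [hj]
  have hfmem : ∀ j v, v ∈ Function.update f1 q {x} j ↔ (j ≠ q ∧ v ∈ f1 j) ∨ (j = q ∧ v = x) := by
    intro j v
    by_cases hj : j = q
    · subst hj
      simp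
    · simp [hj]
  refine ⟨⟨?_, ?_, ?_, ?_, ?_, ?_, ?_, ?_, ?_, ?_⟩, ?_⟩
  · intro j v hv
    exact (hzmem j v).2 (Or.inl (h.sub0 j v hv))
  · intro j v h₁
    rcases (hfmem j v).1 h₁ with ⟨-, hv⟩ | hv
    · exact (hzmem j v).2 (Or.inl (h.sub1 j v hv))
    · exact (hzmem j v).2 (Or.inr hv)
  · intro j j' hjj' v h₁ w h₂
    rcases (hzmem j v).1 h₁ with hv | ⟨rfl, rfl⟩ <;> rcases (hzmem j' w).1 h₂ with hw | ⟨rfl, rfl⟩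
    · exact h.mono j j' hjj' v hv w hw
    · exact (hleft j hjj' v hv).2
    · exact hxy.le.trans (h.mono j j' hjj' y hyz w hw)
    · exact le_rfl
  · intro j v w h₁ hv0 hw
    rcases (hzmem j v).1 h₁ with hv | ⟨rfl, rfl⟩
    · exact h.lt0 j v w hv hv0 hw
    · exact hxy.trans_le (hge w (h.sub0 j w hw))
  · intro j v w h₁ hv1 h₂
    rcases (hfmem j w).1 h₂ with ⟨hj, hw⟩ | ⟨rfl, rfl⟩
    · rcases (hzmem j v).1 h₁ with hv | ⟨rfl, rfl⟩
      · exact h.lt1 j v w hv (fun h' => hv1 ((hfmem j v).2 (Or.inl ⟨hj, h'⟩))) hw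
      · exact absurd rfl hj
    · rcases (hzmem j v).1 h₁ with hv | ⟨-, rfl⟩
      · exact hxy.trans_le (hge v hv)
      · exact absurd ((hfmem j v).2 (Or.inr ⟨rfl, rfl⟩)) hv1
  · intro v
    rw [Finset.mem_insert, h.mem_in]
    constructor
    · rintro (rfl | ⟨j, hj, hj0⟩)
      · exact ⟨q, (hzmem q v).2 (Or.inr ⟨rfl, rfl⟩), fun h' => hxz (h.sub0 q v h')⟩
      · exact ⟨j, (hzmem j v).2 (Or.inl hj), hj0⟩
    · rintro ⟨j, h₁, hj0⟩
      rcases (hzmem j v).1 h₁ with hj | ⟨-, rfl⟩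
      · exact Or.inr ⟨j, hj, hj0⟩
      · exact Or.inl rfl
  · intro v
    rw [Finset.mem_insert, h.mem_out]
    constructor
    · rintro (rfl | ⟨j, hj, hj1⟩)
      · refine ⟨q, (hzmem q v).2 (Or.inl hyz), fun h' => ?_⟩
        rcases (hfmem q v).1 h' with ⟨h', -⟩ | ⟨-, rfl⟩
        · exact h' rfl
        · exact lt_irrefl _ hxy
      · refine ⟨j, (hzmem j v).2 (Or.inl hj), fun h' => ?_⟩
        rcases (hfmem j v).1 h' with ⟨-, h'⟩ | ⟨rfl, rfl⟩
        · exact hj1 h'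
        · exact hxz hj
    · rintro ⟨j, h₁, hj1⟩
      rcases (hzmem j v).1 h₁ with hj | ⟨rfl, rfl⟩
      · by_cases hjq : j = q
        · subst hjq
          by_cases hvy : v = y
          · exact Or.inl hvy
          · exact Or.inr ⟨j, hj, fun h' => hvy (hone1 j v h' y hy)⟩
        · exact Or.inr ⟨j, hj, fun h' => hj1 ((hfmem j v).2 (Or.inl ⟨hjq, h'⟩))⟩
      · exact absurd ((hfmem j v).2 (Or.inr ⟨rfl, rfl⟩)) hj1
  · intro j j' h1 h2 h3
    exact h.last j j' h1 ((hzne j).1 h2) ((hzne j').1 h3)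
  · intro j j' h1 h2 h3
    exact h.first j j' (fun h' => h1 ((hfne j).2 h')) ((hzne j).1 h2) ((hzne j').1 h3)
  · intro j hj
    rw [hfne]
    exact h.cover j ((hzne j).1 hj)
  · intro v hv
    obtain ⟨j, hj, hj1⟩ := (h.mem_out v).1 hv
    rcases lt_trichotomy j q with hjq | rfl | hjq
    · exact absurd (hleft j hjq v hj).1 hj1
    · exact h.lt1 j v y hj hj1 hy
    · obtain ⟨w, hw⟩ := hdel j ⟨v, hj⟩
      exact (h.mono q j hjq y hyz w (h.sub1 j w hw)).trans_lt (h.lt1 j v w hj hj1 hw)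

/-- A label `x` is placed in a new box, in the column `q`. -/
theorem place [DecidableEq ι] (h : RowFlow f0 f1 z X Y) (hcard : ∀ j, (f0 j).card ≤ 1)
    (hdel : ∀ j, (z j).Nonempty → (f1 j).Nonempty) {x : α} {q : ι} (hx : ∀ v ∈ X, x < v)
    (hq : ∀ j, (z j).Nonempty → j < q) (hle : ∀ j, ∀ v ∈ f1 j, v ≤ x) :
    RowFlow f0 (Function.update f1 q {x}) (Function.update z q {x}) (insert x X) Y := by
  have hzq : ¬ (z q).Nonempty := fun h' => lt_irrefl _ (hq q h')
  have hzq' : ∀ v, v ∉ z q := fun v hv => hzq ⟨v, hv⟩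
  -- All current labels are at most `x` and all earlier arrivals exceed `x`, so no box of the row
  -- has changed yet.
  have hall : ∀ j v, v ∈ z j → v ≤ x ∧ v ∈ f0 j := by
    intro j v hv
    obtain ⟨w, hw⟩ := hdel j ⟨v, hv⟩
    have hwx := hle j w hw
    have hw0 : w ∈ f0 j := by
      by_contra hw0
      exact absurd (hx w ((h.mem_in w).2 ⟨j, h.sub1 j w hw, hw0⟩)) (not_lt.2 hwx)
    have hv0 : v ∈ f0 j := by
      by_contra hv0
      exact absurd ((hx v ((h.mem_in v).2 ⟨j, hv, hv0⟩)).trans (h.lt0 j v w hv hv0 hw0))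
        (not_lt.2 hwx)
    exact ⟨(Finset.card_le_one.1 (hcard j) v hv0 w hw0).trans_le hwx, hv0⟩
  have hzmem : ∀ j v, v ∈ Function.update z q {x} j ↔ v ∈ z j ∨ (j = q ∧ v = x) := by
    intro j v
    by_cases hj : j = q
    · subst hj
      simp [hzq' v]
    · simp [hj]
  have hfmem : ∀ j v, v ∈ Function.update f1 q {x} j ↔ v ∈ f1 j ∨ (j = q ∧ v = x) := by
    intro j v
    by_cases hj : j = q
    · subst hj
      have : v ∉ f1 j := fun h' => hzq' v (h.sub1 j v h')
      simp [this]
    · simp [hj]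
  have hzne : ∀ j, (Function.update z q {x} j).Nonempty → (z j).Nonempty ∨ j = q := by
    rintro j ⟨v, h₁⟩
    rcases (hzmem j v).1 h₁ with hv | ⟨rfl, -⟩
    · exact Or.inl ⟨v, hv⟩
    · exact Or.inr rfl
  have hfq : (Function.update f1 q {x} q).Nonempty := ⟨x, (hfmem q x).2 (Or.inr ⟨rfl, rfl⟩)⟩
  have hfne : ∀ j, (f1 j).Nonempty → (Function.update f1 q {x} j).Nonempty := by
    rintro j ⟨v, hv⟩
    exact ⟨v, (hfmem j v).2 (Or.inl hv)⟩
  have hf0 : ∀ j, (z j).Nonempty → (f0 j).Nonempty := by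
    rintro j ⟨v, hv⟩
    exact ⟨v, (hall j v hv).2⟩
  refine ⟨?_, ?_, ?_, ?_, ?_, ?_, ?_, ?_, ?_, ?_⟩
  · intro j v hv
    exact (hzmem j v).2 (Or.inl (h.sub0 j v hv))
  · intro j v h₁
    rcases (hfmem j v).1 h₁ with hv | hv
    · exact (hzmem j v).2 (Or.inl (h.sub1 j v hv))
    · exact (hzmem j v).2 (Or.inr hv)
  · intro j j' hjj' v h₁ w h₂
    rcases (hzmem j v).1 h₁ with hv | ⟨rfl, rfl⟩ <;> rcases (hzmem j' w).1 h₂ with hw | ⟨rfl, rfl⟩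
    · exact h.mono j j' hjj' v hv w hw
    · exact (hall j v hv).1
    · exact absurd (hq j' ⟨w, hw⟩) hjj'.not_gt
    · exact le_rfl
  · intro j v w h₁ hv0 hw
    rcases (hzmem j v).1 h₁ with hv | ⟨rfl, rfl⟩
    · exact h.lt0 j v w hv hv0 hw
    · exact absurd (h.sub0 j w hw) (hzq' w)
  · intro j v w h₁ hv1 h₂
    rcases (hzmem j v).1 h₁ with hv | hv
    · rcases (hfmem j w).1 h₂ with hw | ⟨rfl, rfl⟩
      · exact h.lt1 j v w hv (fun h' => hv1 ((hfmem j v).2 (Or.inl h'))) hw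
      · exact absurd hv (hzq' v)
    · exact absurd ((hfmem j v).2 (Or.inr hv)) hv1
  · intro v
    rw [Finset.mem_insert, h.mem_in]
    constructor
    · rintro (rfl | ⟨j, hj, hj0⟩)
      · exact ⟨q, (hzmem q v).2 (Or.inr ⟨rfl, rfl⟩), fun h' => hzq' v (h.sub0 q v h')⟩
      · exact ⟨j, (hzmem j v).2 (Or.inl hj), hj0⟩
    · rintro ⟨j, h₁, hj0⟩
      rcases (hzmem j v).1 h₁ with hj | ⟨-, rfl⟩
      · exact Or.inr ⟨j, hj, hj0⟩
      · exact Or.inl rfl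
  · intro v
    rw [h.mem_out]
    constructor
    · rintro ⟨j, hj, hj1⟩
      refine ⟨j, (hzmem j v).2 (Or.inl hj), fun h' => ?_⟩
      rcases (hfmem j v).1 h' with h' | ⟨rfl, rfl⟩
      · exact hj1 h'
      · exact hzq' v hj
    · rintro ⟨j, h₁, hj1⟩
      rcases (hzmem j v).1 h₁ with hj | hj
      · exact ⟨j, hj, fun h' => hj1 ((hfmem j v).2 (Or.inl h'))⟩
      · exact absurd ((hfmem j v).2 (Or.inr hj)) hj1
  · intro j j' h1 h2 h3
    rcases hzne j h2 with h2 | rfl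
    · exact absurd (hf0 j h2) h1
    · rcases hzne j' h3 with h3 | rfl
      · exact (hq j' h3).le
      · exact le_rfl
  · intro j j' h1 h2 h3
    rcases hzne j h2 with h2 | rfl
    · exact absurd (hfne j (hdel j h2)) h1
    · exact absurd hfq h1
  · intro j hj
    rcases hzne j hj with hj | rfl
    · exact Or.inl (hf0 j hj)
    · exact Or.inr hfq

/-- The label `x` is removed from the column `q`. -/
theorem remove [DecidableEq ι] (h : RowFlow f0 f1 z X Y) {q : ι} {x : α} (hx : x ∈ f1 q)
    (hx0 : (f0 q).Nonempty) (hmax : ∀ y ∈ f1 q, y ≤ x)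
    (hfirst : (f1 q).card = 1 → ∀ j, (z j).Nonempty → q ≤ j) :
    RowFlow f0 (Function.update f1 q ((f1 q).erase x)) z X (insert x Y) := by
  have hfmem : ∀ j v, v ∈ Function.update f1 q ((f1 q).erase x) j ↔
      v ∈ f1 j ∧ ¬ (j = q ∧ v = x) := by
    intro j v
    by_cases hj : j = q
    · subst hj
      simp [and_comm]
    · simp [hj]
  refine ⟨h.sub0, ?_, h.mono, h.lt0, ?_, h.mem_in, ?_, h.last, ?_, ?_⟩
  · intro j v hv
    exact h.sub1 j v ((hfmem j v).1 hv).1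
  · intro j v w hv hv1 h₂
    obtain ⟨hw, hw'⟩ := (hfmem j w).1 h₂
    by_cases hv2 : v ∈ f1 j
    · have : j = q ∧ v = x := by
        by_contra h'
        exact hv1 ((hfmem j v).2 ⟨hv2, h'⟩)
      obtain ⟨rfl, rfl⟩ := this
      exact lt_of_le_of_ne (hmax w hw) (fun h' => hw' ⟨rfl, h'⟩)
    · exact h.lt1 j v w hv hv2 hw
  · intro v
    rw [Finset.mem_insert, h.mem_out]
    constructor
    · rintro (rfl | ⟨j, hj, hj1⟩)
      · exact ⟨q, h.sub1 q v hx, fun h' => ((hfmem q v).1 h').2 ⟨rfl, rfl⟩⟩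
      · exact ⟨j, hj, fun h' => hj1 ((hfmem j v).1 h').1⟩
    · rintro ⟨j, hj, hj1⟩
      by_cases h' : j = q ∧ v = x
      · exact Or.inl h'.2
      · exact Or.inr ⟨j, hj, fun h'' => hj1 ((hfmem j v).2 ⟨h'', h'⟩)⟩
  · intro j j' h1 h2 h3
    by_cases hj : (f1 j).Nonempty
    · obtain ⟨v, hv⟩ := hj
      -- A box that becomes empty here held only `x`; then `hfirst` says that it is the leftmost
      -- one.
      have hall : ∀ w ∈ f1 j, j = q ∧ w = x := by
        intro w hw
        by_contra h'
        exact h1 ⟨w, (hfmem j w).2 ⟨hw, h'⟩⟩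
      obtain ⟨rfl, rfl⟩ := hall v hv
      refine hfirst ?_ j' h3
      exact Finset.card_eq_one.2 ⟨v, Finset.eq_singleton_iff_unique_mem.2
        ⟨hx, fun w hw => (hall w hw).2⟩⟩
    · exact h.first j j' hj h2 h3
  · intro j hj
    by_cases hjq : j = q
    · subst hjq
      exact Or.inl hx0
    · rw [Function.update_of_ne hjq]
      exact h.cover j hj

end RowFlow

end SkewInsertion

/-! ### The ends of a row with given history -/

namespace SkewInsertion

namespace RowFlow

variable {ι α : Type*} [LinearOrder ι] [LinearOrder α] {f0 f1 z : ι → Finset α} {X Y : Finset α}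

/-- A single final label is the least element of the history, since whatever left the box is larger.
-/
theorem final_unique {f0' f1' : ι → Finset α} {X' Y' : Finset α} (h : RowFlow f0 f1 z X Y)
    (h' : RowFlow f0' f1' z X' Y') {j : ι} (hc : (f1 j).card ≤ 1) (hc' : (f1' j).card ≤ 1)
    (hne : (f1 j).Nonempty ↔ (f1' j).Nonempty) : f1 j = f1' j := by
  by_cases hj : (f1 j).Nonempty
  · obtain ⟨v, hv⟩ := hj
    obtain ⟨w, hw⟩ := hne.1 ⟨v, hv⟩
    have hvw : v = w := by
      by_cases hw1 : w ∈ f1 j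
      · exact Finset.card_le_one.1 hc v hv w hw1
      by_cases hv1 : v ∈ f1' j
      · exact Finset.card_le_one.1 hc' v hv1 w hw
      exact absurd ((h.lt1 j w v (h'.sub1 j w hw) hw1 hv).trans
        (h'.lt1 j v w (h.sub1 j v hv) hv1 hw)) (lt_irrefl _)
    subst hvw
    ext x
    exact ⟨fun hx => (Finset.card_le_one.1 hc x hx v hv) ▸ hw,
      fun hx => (Finset.card_le_one.1 hc' x hx v hw) ▸ hv⟩
  · rw [Finset.not_nonempty_iff_eq_empty.1 hj,
      Finset.not_nonempty_iff_eq_empty.1 (fun h => hj (hne.2 h))]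

theorem initial_unique {f0' f1' : ι → Finset α} {X' Y' : Finset α} (h : RowFlow f0 f1 z X Y)
    (h' : RowFlow f0' f1' z X' Y') {j : ι} (hc : (f0 j).card ≤ 1) (hc' : (f0' j).card ≤ 1)
    (hne : (f0 j).Nonempty ↔ (f0' j).Nonempty) : f0 j = f0' j :=
  final_unique (ι := ιᵒᵈ) (α := αᵒᵈ) h.dual h'.dual hc hc' hne

theorem eq_of_out_empty (h : RowFlow f0 f1 z X Y) (hY : Y = ∅) (j : ι) : f1 j = z j := by
  ext x
  refine ⟨h.sub1 j x, fun hx => ?_⟩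
  by_contra hx1
  have := (h.mem_out x).2 ⟨j, hx, hx1⟩
  simp [hY] at this

theorem eq_of_in_empty (h : RowFlow f0 f1 z X Y) (hX : X = ∅) (j : ι) : f0 j = z j :=
  eq_of_out_empty (ι := ιᵒᵈ) (α := αᵒᵈ) h.dual hX j

end RowFlow

/-! ### The states between the steps of the algorithm -/

/-- The states before step `k`, together with the tableau `t` of the boxes that are still to be
swept out. -/
structure Core (σ : Finset Box) (k : ℕ) (S : State) (t : Box → ℕ) : Prop where
  ext : Extends σ S.shape
  t_tab : IsTableau (above σ S.shape) t
  t_strict : IsReverseRowStrict (above σ S.shape) t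
  t_bdd : IsRowWeaklyBounded (above σ S.shape) t
  t_le : ∀ b, t b ≤ k
  aux_tab : IsTableau (below σ S.shape) S.aux
  aux_strict : IsReverseRowStrict (below σ S.shape) S.aux
  aux_bdd : IsRowBounded (below σ S.shape) S.aux
  aux_gt : ∀ b, 0 < S.aux b → k < S.aux b
  sv : IsSetValuedTableau S.shape S.filling
  ss : IsSemistandard S.shape S.filling
  single : ∀ b : Box, k < b.1 → (S.filling b).card ≤ 1

/-- The state `S₁` arises from `S₀` by the sweep of the label `k`; the labels in `In i` enter the
row `i`, those in `Out i` leave it, and `Z b` collects the labels which are in the box `b` at some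
time. -/
structure Flow (k : ℕ) (S₀ S₁ : State) (t₀ t₁ : Box → ℕ) (Z : Box → Finset ℕ)
    (In Out : ℕ → Finset ℕ) : Prop where
  row : ∀ i, RowFlow (fun j => S₀.filling (i, j)) (fun j => S₁.filling (i, j))
    (fun j => Z (i, j)) (In i) (Out i)
  link : ∀ i, In (i + 1) = Out i
  in_empty : ∀ i ≤ k, In i = ∅
  t_eq : ∀ b, t₁ b = if t₀ b = k then 0 else t₀ b
  aux_eq : ∀ b, S₀.aux b = if S₁.aux b = k then 0 else S₁.aux b

namespace Core

variable {σ : Finset Box} {k : ℕ} {S : State} {t : Box → ℕ}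

theorem t_pos_iff (h : Core σ k S t) {b : Box} : 0 < t b ↔ b ∈ S.shape ∧ AboveRegion σ b := by
  rw [h.t_tab b, mem_above]

theorem aux_pos_iff (h : Core σ k S t) {b : Box} :
    0 < S.aux b ↔ b ∈ S.shape ∧ BelowRegion σ b := by
  rw [h.aux_tab b, mem_below]

theorem filling_nonempty_iff (h : Core σ k S t) {b : Box} :
    (S.filling b).Nonempty ↔ b ∈ S.shape := h.sv.nonempty_iff b

theorem mem_cases (h : Core σ k S t) {b : Box} (hb : b ∈ S.shape) :
    0 < t b ∨ b ∈ σ ∨ 0 < S.aux b := by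
  rcases (h.ext.inCols hb).trichotomy with h' | h' | h'
  · exact Or.inl (h.t_pos_iff.2 ⟨hb, h'⟩)
  · exact Or.inr (Or.inl h')
  · exact Or.inr (Or.inr (h.aux_pos_iff.2 ⟨hb, h'⟩))

/-- The auxiliary tableau decreases weakly in both directions. -/
theorem aux_anti (hσ : IsSkewShape σ) (h : Core σ k S t) {b c : Box} (hb : BelowRegion σ b)
    (hc : c ∈ S.shape) (hbc : b ≤ c) : S.aux c ≤ S.aux b := by
  obtain ⟨i, j⟩ := b
  obtain ⟨i', j'⟩ := c
  obtain ⟨h1, h2⟩ := hbc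
  simp only at h1 h2
  have hd : BelowRegion σ (i, j') := hb.of_le hσ ⟨le_rfl, h2⟩ (h.ext.inCols (b := (i', j')) hc)
  have hc' : BelowRegion σ (i', j') := hd.of_le hσ ⟨h1, le_rfl⟩ (h.ext.inCols hc)
  have hds := h.ext.mem_of_below (b := (i, j')) hc ⟨h1, le_rfl⟩ hd
  have hbs := h.ext.mem_of_below hc ⟨h1, h2⟩ hb
  have h3 : S.aux (i', j') ≤ S.aux (i, j') := by
    rcases h1.eq_or_lt with rfl | h1
    · exact le_rfl
    · exact h.aux_strict.col _ _ _ (mem_below.2 ⟨hds, hd⟩) (mem_below.2 ⟨hc, hc'⟩) h1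
  have h4 : S.aux (i, j') ≤ S.aux (i, j) := by
    rcases h2.eq_or_lt with rfl | h2
    · exact le_rfl
    · exact (h.aux_strict.row _ _ _ (mem_below.2 ⟨hbs, hb⟩) (mem_below.2 ⟨hds, hd⟩) h2).le
  exact h3.trans h4

/-- The tableau of the boxes to be swept out decreases weakly in both directions. -/
theorem t_anti (hσ : IsSkewShape σ) (h : Core σ k S t) {b c : Box} (hb : b ∈ S.shape)
    (hc : AboveRegion σ c) (hbc : b ≤ c) : t c ≤ t b := by
  obtain ⟨i, j⟩ := b
  obtain ⟨i', j'⟩ := c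
  obtain ⟨h1, h2⟩ := hbc
  simp only at h1 h2
  have hb' : AboveRegion σ (i, j) := hc.of_le hσ ⟨h1, h2⟩ (h.ext.inCols hb)
  have hd : AboveRegion σ (i, j') := hc.of_le hσ ⟨h1, le_rfl⟩ hc.inCols
  have hcs := h.ext.mem_of_above hb ⟨h1, h2⟩ hc
  have hds := h.ext.mem_of_above (c := (i, j')) hb ⟨le_rfl, h2⟩ hd
  have h3 : t (i', j') ≤ t (i, j') := by
    rcases h1.eq_or_lt with rfl | h1
    · exact le_rfl
    · exact h.t_strict.col _ _ _ (mem_above.2 ⟨hds, hd⟩) (mem_above.2 ⟨hcs, hc⟩) h1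
  have h4 : t (i, j') ≤ t (i, j) := by
    rcases h2.eq_or_lt with rfl | h2
    · exact le_rfl
    · exact (h.t_strict.row _ _ _ (mem_above.2 ⟨hb, hb'⟩) (mem_above.2 ⟨hds, hd⟩) h2).le
  exact h3.trans h4

end Core

namespace Flow

variable {σ : Finset Box} {k : ℕ} {S₀ S₁ : State} {t₀ t₁ : Box → ℕ} {Z : Box → Finset ℕ}
  {In Out : ℕ → Finset ℕ}

theorem t_pos_of_final (h : Flow (k + 1) S₀ S₁ t₀ t₁ Z In Out) {b : Box} (hb : 0 < t₁ b) :
    t₀ b = t₁ b ∧ t₀ b ≠ k + 1 := by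
  have := h.t_eq b
  split_ifs at this with h' <;> omega

theorem aux_pos_of_initial (h : Flow (k + 1) S₀ S₁ t₀ t₁ Z In Out) {b : Box}
    (hb : 0 < S₀.aux b) : S₁.aux b = S₀.aux b ∧ S₁.aux b ≠ k + 1 := by
  have := h.aux_eq b
  split_ifs at this with h' <;> omega

/-- By `cover`, an occupied box is present at the start or at the end. One present at the start
survives unless it carries the swept label: boxes of `σ` and boxes created earlier always stay. -/
theorem mem_final_iff (h₀ : Core σ (k + 1) S₀ t₀) (h₁ : Core σ k S₁ t₁)
    (h : Flow (k + 1) S₀ S₁ t₀ t₁ Z In Out) (b : Box) :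
    b ∈ S₁.shape ↔ (Z b).Nonempty ∧ t₀ b ≠ k + 1 := by
  obtain ⟨i, j⟩ := b
  constructor
  · intro hb
    obtain ⟨x, hx⟩ := h₁.filling_nonempty_iff.2 hb
    refine ⟨⟨x, (h.row i).sub1 j x hx⟩, fun ht => ?_⟩
    have h1 := (h₀.t_pos_iff (b := (i, j))).1 (by omega)
    have h2 := (h₁.t_pos_iff (b := (i, j))).2 ⟨hb, h1.2⟩
    exact (h.t_pos_of_final h2).2 ht
  · rintro ⟨hz, ht⟩
    rcases (h.row i).cover j hz with h' | h'
    · rcases h₀.mem_cases (h₀.filling_nonempty_iff.1 h') with h1 | h1 | h1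
      · have := h.t_eq (i, j)
        rw [if_neg ht] at this
        exact (h₁.t_pos_iff.1 (this ▸ h1)).1
      · exact h₁.ext.subset h1
      · exact (h₁.aux_pos_iff.1 ((h.aux_pos_of_initial h1).1 ▸ h1)).1
    · exact h₁.filling_nonempty_iff.1 h'

theorem mem_initial_iff (h₀ : Core σ (k + 1) S₀ t₀) (h₁ : Core σ k S₁ t₁)
    (h : Flow (k + 1) S₀ S₁ t₀ t₁ Z In Out) (b : Box) :
    b ∈ S₀.shape ↔ (Z b).Nonempty ∧ S₁.aux b ≠ k + 1 := by
  obtain ⟨i, j⟩ := b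
  constructor
  · intro hb
    obtain ⟨x, hx⟩ := h₀.filling_nonempty_iff.2 hb
    refine ⟨⟨x, (h.row i).sub0 j x hx⟩, fun ht => ?_⟩
    have h1 := (h₁.aux_pos_iff (b := (i, j))).1 (by omega)
    have h2 := (h₀.aux_pos_iff (b := (i, j))).2 ⟨hb, h1.2⟩
    exact (h.aux_pos_of_initial h2).2 ht
  · rintro ⟨hz, ht⟩
    rcases (h.row i).cover j hz with h' | h'
    · exact h₀.filling_nonempty_iff.1 h'
    · rcases h₁.mem_cases (h₁.filling_nonempty_iff.1 h') with h1 | h1 | h1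
      · exact (h₀.t_pos_iff.1 ((h.t_pos_of_final h1).1 ▸ h1)).1
      · exact h₀.ext.subset h1
      · have := h.aux_eq (i, j)
        rw [if_neg ht] at this
        exact (h₀.aux_pos_iff.1 (this ▸ h1)).1

theorem belowRegion_of_new (h₀ : Core σ (k + 1) S₀ t₀) (h₁ : Core σ k S₁ t₁)
    (h : Flow (k + 1) S₀ S₁ t₀ t₁ Z In Out) {b : Box} (hb₀ : b ∉ S₀.shape) (hb₁ : b ∈ S₁.shape) :
    BelowRegion σ b := by
  rcases (h₁.ext.inCols hb₁).trichotomy with h' | h' | h'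
  · have h1 := h₁.t_pos_iff.2 ⟨hb₁, h'⟩
    exact absurd (h₀.t_pos_iff.1 ((h.t_pos_of_final h1).1 ▸ h1)).1 hb₀
  · exact absurd (h₀.ext.subset h') hb₀
  · exact h'

theorem aboveRegion_of_old (h₀ : Core σ (k + 1) S₀ t₀) (h₁ : Core σ k S₁ t₁)
    (h : Flow (k + 1) S₀ S₁ t₀ t₁ Z In Out) {b : Box} (hb₀ : b ∈ S₀.shape) (hb₁ : b ∉ S₁.shape) :
    AboveRegion σ b := by
  rcases (h₀.ext.inCols hb₀).trichotomy with h' | h' | h'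
  · exact h'
  · exact absurd (h₁.ext.subset h') hb₁
  · have h1 := h₀.aux_pos_iff.2 ⟨hb₀, h'⟩
    exact absurd (h₁.aux_pos_iff.1 ((h.aux_pos_of_initial h1).1 ▸ h1)).1 hb₁

/-- Creation fills the leftmost free place of the region below `σ`, since that part of the final
shape has no gaps and the row gains only one box. The column of the new box therefore depends on
`S₀` alone, which is what `RowFlow.history_unique` asks for. -/
theorem new_spec (h₀ : Core σ (k + 1) S₀ t₀) (h₁ : Core σ k S₁ t₁)
    (h : Flow (k + 1) S₀ S₁ t₀ t₁ Z In Out) {i j : ℕ} (hj : ¬ (S₀.filling (i, j)).Nonempty)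
    (hz : (Z (i, j)).Nonempty) : (i, j) ∉ S₀.shape ∧ BelowRegion σ (i, j) ∧
      ∀ j', (i, j') ∉ S₀.shape → BelowRegion σ (i, j') → j ≤ j' := by
  have hj1 : (S₁.filling (i, j)).Nonempty := ((h.row i).cover j hz).resolve_left hj
  have hj0 := fun h' => hj (h₀.filling_nonempty_iff.2 h')
  have hs1 := h₁.filling_nonempty_iff.1 hj1
  refine ⟨hj0, h.belowRegion_of_new h₀ h₁ hj0 hs1, fun j' hj' hb' => ?_⟩
  by_contra hlt
  have hs' := h₁.ext.mem_of_below (b := (i, j')) hs1 ⟨le_rfl, (not_le.1 hlt).le⟩ hb'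
  obtain ⟨x, hx⟩ := h₁.filling_nonempty_iff.2 hs'
  exact hlt ((h.row i).last j' j (fun h' => hj' (h₀.filling_nonempty_iff.1 h'))
    ⟨x, (h.row i).sub1 j' x hx⟩ hz)

/-- The mirror image of `new_spec`: the column of the vanished box depends on `S₁` alone. -/
theorem old_spec (h₀ : Core σ (k + 1) S₀ t₀) (h₁ : Core σ k S₁ t₁)
    (h : Flow (k + 1) S₀ S₁ t₀ t₁ Z In Out) {i j : ℕ} (hj : ¬ (S₁.filling (i, j)).Nonempty)
    (hz : (Z (i, j)).Nonempty) : (i, j) ∉ S₁.shape ∧ AboveRegion σ (i, j) ∧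
      ∀ j', (i, j') ∉ S₁.shape → AboveRegion σ (i, j') → j' ≤ j := by
  have hj0 : (S₀.filling (i, j)).Nonempty := ((h.row i).cover j hz).resolve_right hj
  have hj1 := fun h' => hj (h₁.filling_nonempty_iff.2 h')
  have hs0 := h₀.filling_nonempty_iff.1 hj0
  refine ⟨hj1, h.aboveRegion_of_old h₀ h₁ hs0 hj1, fun j' hj' hb' => ?_⟩
  by_contra hlt
  have hs' := h₀.ext.mem_of_above (c := (i, j')) hs0 ⟨le_rfl, (not_le.1 hlt).le⟩ hb'
  obtain ⟨x, hx⟩ := h₀.filling_nonempty_iff.2 hs'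
  exact hlt ((h.row i).first j' j (fun h' => hj' (h₁.filling_nonempty_iff.1 h'))
    ⟨x, (h.row i).sub0 j' x hx⟩ hz)

theorem history_empty (h₀ : Core σ (k + 1) S₀ t₀) (h₁ : Core σ k S₁ t₁)
    (h : Flow (k + 1) S₀ S₁ t₀ t₁ Z In Out) {i : ℕ} (hi : S₀.shape.sup Prod.fst < i)
    (hi' : S₁.shape.sup Prod.fst < i) (j : ℕ) : Z (i, j) = ∅ := by
  by_contra hne
  rcases (h.row i).cover j (Finset.nonempty_iff_ne_empty.2 hne) with h' | h'
  · have := Finset.le_sup (f := Prod.fst) (h₀.filling_nonempty_iff.1 h')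
    simp only at this
    omega
  · have := Finset.le_sup (f := Prod.fst) (h₁.filling_nonempty_iff.1 h')
    simp only at this
    omega

/-- The state before a step determines the state after it. -/
theorem final_unique {S₁' : State} {t₁' : Box → ℕ} {Z' : Box → Finset ℕ}
    {In' Out' : ℕ → Finset ℕ} (h₀ : Core σ (k + 1) S₀ t₀) (h₁ : Core σ k S₁ t₁)
    (h₁' : Core σ k S₁' t₁') (h : Flow (k + 1) S₀ S₁ t₀ t₁ Z In Out)
    (h' : Flow (k + 1) S₀ S₁' t₀ t₁' Z' In' Out') : S₁ = S₁' ∧ t₁ = t₁' := by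
  have hZrow : ∀ i, In i = In' i → ∀ j, Z (i, j) = Z' (i, j) := by
    intro i hi j
    have h2 := h'.row i
    rw [← hi] at h2
    refine congrFun ((h.row i).history_unique h2 ?_) j
    intro p q hp hzp hq hzq
    have hp' := h.new_spec h₀ h₁ hp hzp
    have hq' := h'.new_spec h₀ h₁' hq hzq
    exact le_antisymm (hp'.2.2 q hq'.1 hq'.2.1) (hq'.2.2 p hp'.1 hp'.2.1)
  have hfill : ∀ i, In i = In' i → ∀ j, S₁.filling (i, j) = S₁'.filling (i, j) := by
    intro i hi j
    have hZ := hZrow i hi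
    have h2 := h'.row i
    rw [← funext hZ] at h2
    -- Below row `k` the final labels are the minima of the histories; a row `i ≤ k` emits nothing,
    -- because row `i + 1` receives nothing, so it ends with its whole history.
    by_cases hik : k < i
    · refine (h.row i).final_unique h2 (h₁.single _ hik) (h₁'.single _ hik) ?_
      rw [h₁.filling_nonempty_iff, h₁'.filling_nonempty_iff, h.mem_final_iff h₀ h₁,
        h'.mem_final_iff h₀ h₁', hZ j]
    · rw [(h.row i).eq_of_out_empty (by rw [← h.link, h.in_empty _ (by omega)]) j,
        h2.eq_of_out_empty (by rw [← h'.link, h'.in_empty _ (by omega)]) j]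
  -- The rows are compared from the top down, as the output of one row is the input of the next.
  have hIn : ∀ i, In i = In' i := by
    intro i
    induction i with
    | zero => rw [h.in_empty 0 (Nat.zero_le _), h'.in_empty 0 (Nat.zero_le _)]
    | succ i ih =>
      rw [h.link, h'.link]
      ext x
      rw [(h.row i).mem_out, (h'.row i).mem_out]
      simp only [hZrow i ih, hfill i ih]
  have hshape : S₁.shape = S₁'.shape := by
    ext ⟨i, j⟩
    rw [← h₁.filling_nonempty_iff, ← h₁'.filling_nonempty_iff, hfill i (hIn i) j]
  have haux : S₁.aux = S₁'.aux := by
    funext b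
    have h1 := h.aux_eq b
    have h2 := h'.aux_eq b
    have h3 : 0 < S₁.aux b ↔ 0 < S₁'.aux b := by
      rw [h₁.aux_pos_iff, h₁'.aux_pos_iff, hshape]
    split_ifs at h1 h2 <;> omega
  have hfun : S₁.filling = S₁'.filling := funext fun ⟨i, j⟩ => hfill i (hIn i) j
  refine ⟨?_, funext fun b => by rw [h.t_eq, h'.t_eq]⟩
  cases S₁
  cases S₁'
  simp only at hshape haux hfun
  subst hshape haux hfun
  rfl

/-- The state after a step determines the state before it. -/
theorem initial_unique {S₀' : State} {t₀' : Box → ℕ} {Z' : Box → Finset ℕ}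
    {In' Out' : ℕ → Finset ℕ} (h₀ : Core σ (k + 1) S₀ t₀) (h₀' : Core σ (k + 1) S₀' t₀')
    (h₁ : Core σ k S₁ t₁) (h : Flow (k + 1) S₀ S₁ t₀ t₁ Z In Out)
    (h' : Flow (k + 1) S₀' S₁ t₀' t₁ Z' In' Out') : S₀ = S₀' ∧ t₀ = t₀' := by
  have hZrow : ∀ i, Out i = Out' i → ∀ j, Z (i, j) = Z' (i, j) := by
    intro i hi j
    have h2 := h'.row i
    rw [← hi] at h2
    refine congrFun ((h.row i).history_unique' h2 ?_) j
    intro p q hp hzp hq hzq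
    have hp' := h.old_spec h₀ h₁ hp hzp
    have hq' := h'.old_spec h₀' h₁ hq hzq
    exact le_antisymm (hq'.2.2 p hp'.1 hp'.2.1) (hp'.2.2 q hq'.1 hq'.2.1)
  have hfill : ∀ i, Out i = Out' i → ∀ j, S₀.filling (i, j) = S₀'.filling (i, j) := by
    intro i hi j
    have hZ := hZrow i hi
    have h2 := h'.row i
    rw [← funext hZ] at h2
    by_cases hik : k + 1 < i
    · refine (h.row i).initial_unique h2 (h₀.single _ hik) (h₀'.single _ hik) ?_
      rw [h₀.filling_nonempty_iff, h₀'.filling_nonempty_iff, h.mem_initial_iff h₀ h₁,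
        h'.mem_initial_iff h₀' h₁, hZ j]
    · rw [(h.row i).eq_of_in_empty (h.in_empty _ (by omega)) j,
        h2.eq_of_in_empty (h'.in_empty _ (by omega)) j]
  obtain ⟨M, hM⟩ : ∃ M, S₀.shape.sup Prod.fst < M ∧ S₀'.shape.sup Prod.fst < M ∧
      S₁.shape.sup Prod.fst < M :=
    ⟨S₀.shape.sup Prod.fst + S₀'.shape.sup Prod.fst + S₁.shape.sup Prod.fst + 1,
      by omega, by omega, by omega⟩
  -- Here the comparison runs upwards, starting from a row `M` beyond all three shapes, where
  -- nothing moves.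
  have hOut : ∀ n i, M ≤ i + n → Out i = Out' i := by
    intro n
    induction n with
    | zero =>
      intro i hi
      ext x
      rw [(h.row i).mem_out, (h'.row i).mem_out]
      simp [h.history_empty h₀ h₁ (i := i) (by omega) (by omega),
        h'.history_empty h₀' h₁ (i := i) (by omega) (by omega)]
    | succ n ih =>
      intro i hi
      have hi1 := ih (i + 1) (by omega)
      rw [← h.link, ← h'.link]
      ext x
      rw [(h.row (i + 1)).mem_in, (h'.row (i + 1)).mem_in]
      simp only [hZrow _ hi1, hfill _ hi1]
  replace hOut : ∀ i, Out i = Out' i := fun i => hOut M i (by omega)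
  have hshape : S₀.shape = S₀'.shape := by
    ext ⟨i, j⟩
    rw [← h₀.filling_nonempty_iff, ← h₀'.filling_nonempty_iff, hfill i (hOut i) j]
  have ht : t₀ = t₀' := by
    funext b
    have h1 := h.t_eq b
    have h2 := h'.t_eq b
    have h3 : 0 < t₀ b ↔ 0 < t₀' b := by
      rw [h₀.t_pos_iff, h₀'.t_pos_iff, hshape]
    split_ifs at h1 h2 <;> omega
  have hfun : S₀.filling = S₀'.filling := funext fun ⟨i, j⟩ => hfill i (hOut i) j
  have haux : S₀.aux = S₀'.aux := funext fun b => by rw [h.aux_eq, h'.aux_eq]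
  refine ⟨?_, ht⟩
  cases S₀
  cases S₀'
  simp only at hshape haux hfun
  subst hshape haux hfun
  rfl

end Flow

end SkewInsertion

namespace SkewInsertion

/-! ### Row insertion -/

theorem svContent_insert {s : Finset Box} {b : Box} (hb : b ∉ s) (T : Box → Finset ℕ) (v : ℕ) :
    svContent (insert b s) T v = svContent s T v + if v ∈ T b then 1 else 0 := by
  unfold svContent
  rw [Finset.filter_insert]
  split_ifs with h
  · rw [Finset.card_insert_of_notMem (fun h' => hb (Finset.mem_filter.1 h').1)]
  · rfl

theorem svContent_update_of_not_mem {s : Finset Box} {b : Box} (hb : b ∉ s) (T : Box → Finset ℕ)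
    (A : Finset ℕ) (v : ℕ) : svContent s (Function.update T b A) v = svContent s T v := by
  unfold svContent
  congr 1
  refine Finset.filter_congr fun c hc => ?_
  rw [Function.update_of_ne (by rintro rfl; exact hb hc)]

theorem svContent_erase {s : Finset Box} {b : Box} (hb : b ∈ s) (T : Box → Finset ℕ)
    (A : Finset ℕ) (v : ℕ) : svContent (s.erase b) (Function.update T b A) v +
      (if v ∈ T b then 1 else 0) = svContent s T v := by
  have h := svContent_insert (Finset.notMem_erase b s) T v
  rw [Finset.insert_erase hb] at h
  rw [h, svContent_update_of_not_mem (Finset.notMem_erase b s)]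

theorem svContent_update {s : Finset Box} {b : Box} (hb : b ∈ s) (T : Box → Finset ℕ)
    (A : Finset ℕ) (v : ℕ) : svContent s (Function.update T b A) v + (if v ∈ T b then 1 else 0) =
      svContent s T v + if v ∈ A then 1 else 0 := by
  have h1 := svContent_erase hb T A v
  have h2 := svContent_insert (Finset.notMem_erase b s) (Function.update T b A) v
  rw [Finset.insert_erase hb, Function.update_self] at h2
  omega

theorem update_row_self {T : Box → Finset ℕ} (i q : ℕ) (A : Finset ℕ) :
    (fun j => Function.update T (i, q) A (i, j)) = Function.update (fun j => T (i, j)) q A := by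
  funext j
  by_cases h : j = q
  · subst h
    simp
  · rw [Function.update_of_ne h, Function.update_of_ne (by simpa using h)]

theorem update_row_of_ne {T : Box → Finset ℕ} {i m : ℕ} (h : m ≠ i) (q j : ℕ) (A : Finset ℕ) :
    Function.update T (i, q) A (m, j) = T (m, j) :=
  Function.update_of_ne (by simp [h]) _ _

/-- The flow of labels at the time when the label `x` is about to be inserted into row `i + 1`. -/
structure HandFlow (T₀ T Z : Box → Finset ℕ) (In Out : ℕ → Finset ℕ) (i x : ℕ) : Prop where
  row : ∀ m, RowFlow (fun j => T₀ (m, j)) (fun j => T (m, j)) (fun j => Z (m, j)) (In m) (Out m)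
  link : ∀ m, m ≠ i → In (m + 1) = Out m
  out_eq : Out i = insert x (In (i + 1))
  lt : ∀ v ∈ In (i + 1), x < v

theorem sup_eq_of_mem {A : Finset ℕ} {y : ℕ} (hA : A.card ≤ 1) (hy : y ∈ A) : A.sup id = y := by
  have : A = {y} := Finset.eq_singleton_iff_unique_mem.2
    ⟨hy, fun w hw => Finset.card_le_one.1 hA w hw y hy⟩
  rw [this, Finset.sup_singleton]
  rfl

/-- The outcome `R` of the insertion of `x` into row `i + 1`. -/
structure InsertSpec (σ s : Finset Box) (T₀ T : Box → Finset ℕ) (In : ℕ → Finset ℕ) (i x : ℕ)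
    (R : (Box → Finset ℕ) × Box) : Prop where
  flow : ∃ (Z' : Box → Finset ℕ) (In' Out' : ℕ → Finset ℕ), (∀ m, RowFlow (fun j => T₀ (m, j)) (fun j => R.1 (m, j))
    (fun j => Z' (m, j)) (In' m) (Out' m)) ∧ (∀ m, In' (m + 1) = Out' m) ∧ ∀ m ≤ i, In' m = In m
  not_mem : R.2 ∉ s
  below : BelowRegion σ R.2
  row_lt : i < R.2.1
  ext : Extends σ (insert R.2 s)
  sv : IsSetValuedTableau (insert R.2 s) R.1
  eq : ∀ m ≤ i, ∀ j, R.1 (m, j) = T (m, j)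
  single : ∀ m, i < m → ∀ j, (R.1 (m, j)).card ≤ 1
  content : ∀ v, svContent (insert R.2 s) R.1 v = svContent s T v + if v = x then 1 else 0

/-- The column `j` controls the bumping route: as `x` is smaller than any label at `(i + 1, j)`,
either row `i + 1` contains a larger label to bump, or that place is vacant under `(i, j)` and
`newBox_spec` applies. The induction is on a bound `d` for the number of rows left. -/
theorem rowInsert_spec {σ s : Finset Box} (hσ : IsSkewShape σ) (hcol : ColsConvex σ)
    (hs : Extends σ s) {T₀ : Box → Finset ℕ} (d : ℕ) :
    ∀ {T Z : Box → Finset ℕ} {In Out : ℕ → Finset ℕ} {i x j : ℕ},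
    s.sup Prod.fst ≤ i + d →
    IsSetValuedTableau s T → (∀ m, i < m → ∀ j, (T₀ (m, j)).card ≤ 1) →
    (∀ m, i < m → ∀ j, (T (m, j)).card ≤ 1) →
    (∀ m, i < m → ∀ j, ∀ v ∈ T (m, j), ∀ w ∈ T (m + 1, j), v < w) →
    (∀ m, i < m → ∀ j, (Z (m, j)).Nonempty → (m, j) ∈ s) →
    HandFlow T₀ T Z In Out i x → 0 < x → ((i, j) ∈ s ∨ (i + 1, j) ∈ s) →
    (∀ y ∈ T (i + 1, j), x < y) →
    InsertSpec σ s T₀ T In i x (rowInsert s T (i + 1) x) := by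
  -- The terminal case is isolated because it arises both in the base case and in the induction
  -- step.
  have place : ∀ {T Z : Box → Finset ℕ} {In Out : ℕ → Finset ℕ} {i x j : ℕ},
      ¬ (bumpCols s T (i + 1) x).Nonempty →
      IsSetValuedTableau s T → (∀ m, i < m → ∀ j, (T₀ (m, j)).card ≤ 1) →
      (∀ m, i < m → ∀ j, (T (m, j)).card ≤ 1) →
      (∀ m, i < m → ∀ j, (Z (m, j)).Nonempty → (m, j) ∈ s) →
      HandFlow T₀ T Z In Out i x → 0 < x → ((i, j) ∈ s ∨ (i + 1, j) ∈ s) →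
      (∀ y ∈ T (i + 1, j), x < y) →
      InsertSpec σ s T₀ T In i x (rowInsert s T (i + 1) x) := by
    intro T Z In Out i x j hb hsv hc0 hc hdel hh hx hor hlt
    have hle : ∀ p, ∀ v ∈ T (i + 1, p), v ≤ x := by
      intro p v hv
      by_contra hvx
      refine hb ⟨p, Finset.mem_filter.2 ⟨mem_rowCols.2 ((hsv.nonempty_iff _).1 ⟨v, hv⟩), v, hv, ?_⟩⟩
      exact not_le.1 hvx
    have hn : (i + 1, j) ∉ s := by
      intro hj
      obtain ⟨y, hy⟩ := (hsv.nonempty_iff _).2 hj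
      exact absurd (hlt y hy) (not_lt.2 (hle j y hy))
    obtain ⟨h1, h2, h3, h4⟩ := newBox_spec hσ hcol hs (hor.resolve_right hn) hn
    have hR : rowInsert s T (i + 1) x =
        (Function.update T (newBox s (i + 1)) {x}, newBox s (i + 1)) := by
      rw [rowInsert, dif_neg hb]
    have hfst := newBox_fst s (i + 1)
    rw [hR]
    generalize newBox s (i + 1) = n at h1 h2 h3 h4 hfst
    obtain ⟨p, q⟩ := n
    simp only at hfst h4
    subst hfst
    refine ⟨⟨Function.update Z (i + 1, q) {x}, Function.update In (i + 1) (insert x (In (i + 1))),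
      Out, ?_, ?_, ?_⟩, h1, h2, Nat.lt_succ_self i, h3, ⟨?_, ?_⟩, ?_, ?_, ?_⟩
    · intro m
      by_cases hm : m = i + 1
      · subst hm
        simp only [update_row_self, Function.update_self]
        refine (hh.row (i + 1)).place (hc0 _ (Nat.lt_succ_self i)) ?_ hh.lt ?_ hle
        · exact fun p hp => (hsv.nonempty_iff _).2 (hdel _ (Nat.lt_succ_self i) p hp)
        · exact fun p hp => h4 p (hdel _ (Nat.lt_succ_self i) p hp)
      · simp only [update_row_of_ne hm, Function.update_of_ne hm]
        exact hh.row m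
    · intro m
      by_cases hm : m = i
      · subst hm
        rw [Function.update_self, hh.out_eq]
      · rw [Function.update_of_ne (by omega), hh.link m hm]
    · intro m hm
      rw [Function.update_of_ne (by omega)]
    · intro b
      by_cases hbn : b = (i + 1, q)
      · subst hbn
        simp
      · simp only [Function.update_of_ne hbn]
        rw [hsv.nonempty_iff]
        simp [hbn]
    · intro b v hv
      by_cases hbn : b = (i + 1, q)
      · subst hbn
        simp only [Function.update_self, Finset.mem_singleton] at hv
        exact hv ▸ hx
      · simp only [Function.update_of_ne hbn] at hv
        exact hsv.pos b v hv
    · intro m hm p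
      exact update_row_of_ne (by omega) _ _ _
    · intro m hm p
      by_cases hbn : ((m, p) : Box) = (i + 1, q)
      · rw [hbn]
        simp
      · simp only [Function.update_of_ne hbn]
        exact hc m hm p
    · intro v
      rw [svContent_insert h1, svContent_update_of_not_mem h1]
      simp
  induction d with
  | zero =>
    intro T Z In Out i x j hd hsv hc0 hc hcs hdel hh hx hor hlt
    refine place ?_ hsv hc0 hc hdel hh hx hor hlt
    intro hb
    have := le_of_bumpCols_nonempty hb
    omega
  | succ d ih =>
    intro T Z In Out i x j hd hsv hc0 hc hcs hdel hh hx hor hlt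
    by_cases hb : (bumpCols s T (i + 1) x).Nonempty
    swap
    · exact place hb hsv hc0 hc hdel hh hx hor hlt
    rw [rowInsert, dif_pos hb]
    have hqmem := Finset.min'_mem _ hb
    have hqmin : ∀ p ∈ bumpCols s T (i + 1) x, (bumpCols s T (i + 1) x).min' hb ≤ p :=
      fun p hp => Finset.min'_le _ p hp
    generalize (bumpCols s T (i + 1) x).min' hb = q at hqmem hqmin
    obtain ⟨hqs, y, hy, hxy⟩ := Finset.mem_filter.1 hqmem
    rw [mem_rowCols] at hqs
    rw [sup_eq_of_mem (hc _ (Nat.lt_succ_self i) q) hy]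
    have hleft : ∀ p < q, ∀ v ∈ T (i + 1, p), v ≤ x := by
      intro p hp v hv
      by_contra hvx
      exact absurd (hqmin p (Finset.mem_filter.2
        ⟨mem_rowCols.2 ((hsv.nonempty_iff _).1 ⟨v, hv⟩), v, hv, not_le.1 hvx⟩)) (not_le.2 hp)
    -- Besides the new flow, `bump` yields that `y` is smaller than every label emitted before, the
    -- ordering needed in the next row.
    obtain ⟨hflow, hout⟩ := (hh.row (i + 1)).bump (hc0 _ (Nat.lt_succ_self i))
      (hc _ (Nat.lt_succ_self i))
      (fun p hp => (hsv.nonempty_iff _).2 (hdel _ (Nat.lt_succ_self i) p hp)) hh.lt hy hxy hleft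
    have hsv' : IsSetValuedTableau s (Function.update T (i + 1, q) {x}) := by
      refine ⟨fun b => ?_, fun b v hv => ?_⟩
      · by_cases hbn : b = (i + 1, q)
        · subst hbn
          simp [hqs]
        · rw [Function.update_of_ne hbn, hsv.nonempty_iff]
      · by_cases hbn : b = (i + 1, q)
        · subst hbn
          simp only [Function.update_self, Finset.mem_singleton] at hv
          exact hv ▸ hx
        · simp only [Function.update_of_ne hbn] at hv
          exact hsv.pos b v hv
    have hT : ∀ m, i + 1 < m → ∀ p, Function.update T (i + 1, q) {x} (m, p) = T (m, p) :=
      fun m hm p => update_row_of_ne (by omega) _ _ _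
    have hZ : ∀ m, i + 1 < m → ∀ p, Function.update Z (i + 1, q) (insert x (Z (i + 1, q))) (m, p) =
        Z (m, p) := fun m hm p => update_row_of_ne (by omega) _ _ _
    have hand : HandFlow T₀ (Function.update T (i + 1, q) {x})
        (Function.update Z (i + 1, q) (insert x (Z (i + 1, q))))
        (Function.update In (i + 1) (insert x (In (i + 1))))
        (Function.update Out (i + 1) (insert y (Out (i + 1)))) (i + 1) y := by
      refine ⟨fun m => ?_, fun m hm => ?_, ?_, ?_⟩
      · by_cases hm : m = i + 1
        · subst hm
          simp only [update_row_self, Function.update_self]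
          exact hflow
        · simp only [update_row_of_ne hm, Function.update_of_ne hm]
          exact hh.row m
      · rw [Function.update_of_ne hm]
        by_cases hm' : m = i
        · subst hm'
          rw [Function.update_self, hh.out_eq]
        · rw [Function.update_of_ne (by omega), hh.link m hm']
      · rw [Function.update_self, Function.update_of_ne (by omega), hh.link _ (by omega)]
      · rw [Function.update_of_ne (by omega), hh.link _ (by omega)]
        exact hout
    -- The bumped column is the witness for the next row: `y` is smaller than the label beneath it,
    -- as the rows further down are still untouched.
    have key := ih (j := q) (by omega) hsv' (fun m hm => hc0 m (by omega))
      (fun m hm p => by rw [hT m hm]; exact hc m (by omega) p)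
      (fun m hm p => by rw [hT m hm, hT (m + 1) (by omega)]; exact hcs m (by omega) p)
      (fun m hm p => by rw [hZ m hm]; exact hdel m (by omega) p) hand (hsv.pos _ y hy)
      (Or.inl hqs) (by
        rw [hT _ (by omega)]
        exact hcs _ (Nat.lt_succ_self i) q y hy)
    generalize rowInsert s (Function.update T (i + 1, q) {x}) (i + 1 + 1) y = R at key
    obtain ⟨Z', In', Out', h1, h2, h3⟩ := key.flow
    refine ⟨⟨Z', In', Out', h1, h2, fun m hm => ?_⟩, key.not_mem, key.below, ?_, key.ext, key.sv,
      fun m hm p => ?_, fun m hm p => ?_, fun v => ?_⟩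
    · rw [h3 m (by omega), Function.update_of_ne (by omega)]
    · have := key.row_lt
      omega
    · rw [key.eq m (by omega), update_row_of_ne (by omega)]
    · by_cases hm' : m = i + 1
      · subst hm'
        rw [key.eq _ le_rfl]
        by_cases hp : p = q
        · subst hp
          simp
        · rw [Function.update_of_ne (by simpa using hp)]
          exact hc _ hm p
      · exact key.single m (by omega) p
    · rw [key.content]
      have h5 := svContent_update hqs T {x} v
      have h6 : v ∈ T (i + 1, q) ↔ v = y :=
        ⟨fun h => Finset.card_le_one.1 (hc _ (Nat.lt_succ_self i) q) v h y hy, fun h => h ▸ hy⟩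
      simp only [h6, Finset.mem_singleton] at h5
      exact h5

end SkewInsertion

namespace SkewInsertion

/-! ### The states within a step of the algorithm -/

/-- The excess of a filling together with the contents of the two auxiliary tableaux. -/
def totalExcess (σ s : Finset Box) (T : Box → Finset ℕ) (u t : Box → ℕ) (m : ℕ) : ℤ :=
  excess s T m + content (above σ s) t m + content (below σ s) u m

theorem excess_eq_zero {s : Finset Box} {T : Box → Finset ℕ} {m : ℕ}
    (h : ∀ b ∈ s, b.1 = m → (T b).card = 1) : excess s T m = 0 := by
  unfold excess
  rw [Finset.sum_congr rfl (g := fun _ => (1 : ℤ))]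
  · simp
  · intro b hb
    rw [h b (Finset.mem_filter.1 hb).1 (Finset.mem_filter.1 hb).2]
    rfl

theorem content_congr {s : Finset Box} {u v : Box → ℕ} (h : ∀ b ∈ s, u b = v b) (m : ℕ) :
    content s u m = content s v m := by
  unfold content
  congr 1
  exact Finset.filter_congr fun b hb => by rw [h b hb]

theorem content_insert {s : Finset Box} {b : Box} (hb : b ∉ s) (u : Box → ℕ) (m : ℕ) :
    content (insert b s) u m = content s u m + if u b = m then 1 else 0 := by
  unfold content
  rw [Finset.filter_insert]
  split_ifs with h
  · rw [Finset.card_insert_of_notMem (fun h' => hb (Finset.mem_filter.1 h').1)]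
  · rfl

theorem above_insert {σ s : Finset Box} (hσ : IsSkewShape σ) {n : Box} (hn : BelowRegion σ n) :
    above σ (insert n s) = above σ s := by
  ext b
  simp only [mem_above, Finset.mem_insert]
  constructor
  · rintro ⟨rfl | hb, hb'⟩
    · exact absurd hn (hb'.not_belowRegion hσ)
    · exact ⟨hb, hb'⟩
  · rintro ⟨hb, hb'⟩
    exact ⟨Or.inr hb, hb'⟩

theorem below_insert {σ s : Finset Box} {n : Box} (hn : BelowRegion σ n) :
    below σ (insert n s) = insert n (below σ s) := by
  ext b
  simp only [mem_below, Finset.mem_insert]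
  constructor
  · rintro ⟨rfl | hb, hb'⟩
    · exact Or.inl rfl
    · exact Or.inr ⟨hb, hb'⟩
  · rintro (rfl | ⟨hb, hb'⟩)
    · exact ⟨Or.inl rfl, hn⟩
    · exact ⟨Or.inr hb, hb'⟩

/-- The shape `s` and the auxiliary tableau `u` within step `k`, when the boxes of the rows above
row `n` have been swept out. -/
structure MidShape (σ : Finset Box) (k : ℕ) (S₀ : State) (t : Box → ℕ) (n : ℕ) (s : Finset Box)
    (u : Box → ℕ) : Prop where
  ext : Extends σ s
  above_iff : ∀ b, AboveRegion σ b → (b ∈ s ↔ b ∈ S₀.shape ∧ ¬ (t b = k ∧ b.1 < n))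
  mono : ∀ b ∈ S₀.shape, ¬ AboveRegion σ b → b ∈ s
  aux_old : ∀ b ∈ S₀.shape, u b = S₀.aux b
  aux_new : ∀ b ∈ s, b ∉ S₀.shape → u b = k
  aux_out : ∀ b ∉ s, b ∉ S₀.shape → u b = 0
  new_gt : ∀ b ∈ s, b ∉ S₀.shape → k < b.1

/-- The states within step `k`. -/
structure Mid (σ : Finset Box) (k : ℕ) (S₀ : State) (t : Box → ℕ) (n : ℕ) (S : State) :
    Prop where
  shape : MidShape σ k S₀ t n S.shape S.aux
  sv : IsSetValuedTableau S.shape S.filling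
  ss : IsSemistandard S.shape S.filling
  single : ∀ b : Box, k < b.1 → (S.filling b).card ≤ 1
  flow : ∃ (Z : Box → Finset ℕ) (In Out : ℕ → Finset ℕ), (∀ m, RowFlow
    (fun j => S₀.filling (m, j)) (fun j => S.filling (m, j)) (fun j => Z (m, j)) (In m) (Out m)) ∧
    (∀ m, In (m + 1) = Out m) ∧ ∀ m ≤ k, In m = ∅
  content : ∀ v, svContent S.shape S.filling v = svContent S₀.shape S₀.filling v
  total : ∀ m, totalExcess σ S.shape S.filling S.aux t m =
    totalExcess σ S₀.shape S₀.filling S₀.aux t m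

/-- Columns of a skew shape have no gaps, so strictness between adjacent rows propagates through
nonempty boxes. -/
theorem IsSemistandard.of_succ {s : Finset Box} {T : Box → Finset ℕ} (hs : IsSkewShape s)
    (hsv : IsSetValuedTableau s T)
    (hrow : ∀ i j j', j < j' → ∀ x ∈ T (i, j), ∀ y ∈ T (i, j'), x ≤ y)
    (hcol : ∀ i j, ∀ x ∈ T (i, j), ∀ y ∈ T (i + 1, j), x < y) : IsSemistandard s T := by
  refine ⟨fun i j j' _ _ hj => hrow i j j' hj, fun i i' j hi hi' hlt => ?_⟩
  obtain ⟨d, rfl⟩ := Nat.exists_eq_add_of_lt hlt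
  clear hlt
  induction d with
  | zero => exact hcol i j
  | succ d ih =>
    intro x hx y hy
    have hm : (i + d + 1, j) ∈ s := hs.mem_of_le_of_le hi hi' ⟨by simp only; omega, le_rfl⟩
      ⟨by simp only; omega, le_rfl⟩
    obtain ⟨w, hw⟩ := (hsv.nonempty_iff _).2 hm
    exact (ih hm x hx w hw).trans (hcol _ j w hw y hy)

namespace MidShape

variable {σ : Finset Box} {k : ℕ} {S₀ : State} {t : Box → ℕ} {n : ℕ} {s : Finset Box} {u : Box → ℕ}

theorem belowRegion_of_new (h₀ : Core σ k S₀ t) (h : MidShape σ k S₀ t n s u) {b : Box}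
    (hb : b ∈ s) (hb₀ : b ∉ S₀.shape) : BelowRegion σ b := by
  rcases (h.ext.inCols hb).trichotomy with h' | h' | h'
  · exact absurd ((h.above_iff b h').1 hb).1 hb₀
  · exact absurd (h₀.ext.subset h') hb₀
  · exact h'

end MidShape

/-- A filling obtained from a semistandard one by a flow of labels is semistandard. -/
theorem semistandard_of_flow {σ : Finset Box} {k n : ℕ} {S₀ : State}
    {t u : Box → ℕ} {s : Finset Box} {T Z : Box → Finset ℕ} {In Out : ℕ → Finset ℕ}
    (h₀ : Core σ k S₀ t) (h : MidShape σ k S₀ t n s u) (hsv : IsSetValuedTableau s T)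
    (hrow : ∀ m, RowFlow (fun j => S₀.filling (m, j)) (fun j => T (m, j))
      (fun j => Z (m, j)) (In m) (Out m)) (hlink : ∀ m, In (m + 1) = Out m) :
    IsSemistandard s T := by
  refine IsSemistandard.of_succ h.ext.isSkewShape hsv ?_ fun m => ?_
  · intro i j j' hj x hx y hy
    exact (hrow i).mono j j' hj x ((hrow i).sub1 j x hx) y ((hrow i).sub1 j' y hy)
  have hs := fun b => hsv.nonempty_iff b
  have hs₀ := fun b => h₀.sv.nonempty_iff b
  have h2 := hrow (m + 1)
  rw [hlink m] at h2
  refine (hrow m).col_lt h2 ?_ ?_ ?_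
  · intro j x hx y hy
    exact h₀.ss.col m (m + 1) j ((hs₀ _).1 ⟨x, hx⟩) ((hs₀ _).1 ⟨y, hy⟩) (Nat.lt_succ_self m) x hx y hy
  -- A box created in the upper row cannot sit on an old box of the lower row, for the old shape
  -- would already have contained it.
  · intro j hj hj'
    rw [hs] at hj
    rw [hs₀] at hj' ⊢
    by_contra hn
    have hb := h.belowRegion_of_new h₀ hj hn
    exact hn (h₀.ext.mem_of_below hj' ⟨Nat.le_succ m, le_rfl⟩ hb)
  -- If `(m + 1, j')` were not an old box, it would have been created during the flow, as `(m + 1,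
  -- j)` is occupied further right; but a created box is the last in its row.
  · intro j j' hjj' hj' hj hj1
    have hj1' := hj1
    rw [hs] at hj hj1
    rw [hs₀] at hj' ⊢
    have hc : InCols σ ((m + 1, j') : Box).2 := h₀.ext.inCols (b := (m, j')) hj'
    rcases hc.trichotomy with h' | h' | h'
    · exact h₀.ext.mem_of_above hj' ⟨Nat.le_succ m, le_rfl⟩ h'
    · exact h₀.ext.subset h'
    · have hm := h.ext.mem_of_below (b := (m + 1, j')) hj1 ⟨le_rfl, hjj'.le⟩ h'
      by_contra hn
      obtain ⟨x, hx⟩ := (hs _).2 hm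
      obtain ⟨y, hy⟩ := hj1'
      have := (hrow (m + 1)).last j' j (fun h' => hn ((hs₀ _).1 h'))
        ⟨x, (hrow (m + 1)).sub1 j' x hx⟩ ⟨y, (hrow (m + 1)).sub1 j y hy⟩
      omega

theorem IsSetValuedTableau.card_eq_one {s : Finset Box} {T : Box → Finset ℕ}
    (hsv : IsSetValuedTableau s T) {b : Box} (hb : b ∈ s)
    (hc : (T b).card ≤ 1) :
    (T b).card = 1 :=
  le_antisymm hc (Finset.card_pos.2 ((hsv.nonempty_iff b).2 hb))

/-- An insertion within step `k`. -/
theorem Mid.of_insert {σ : Finset Box} (hσ : IsSkewShape σ) (hcol : ColsConvex σ) {k n i x j : ℕ}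
    {S₀ : State} {t u : Box → ℕ} {s : Finset Box} {T Z : Box → Finset ℕ} {In Out : ℕ → Finset ℕ}
    (h₀ : Core σ k S₀ t) (h : MidShape σ k S₀ t n s u) (hn : n ≤ i + 1) (hk : k ≤ i)
    (hsv : IsSetValuedTableau s T) (hsingle : ∀ b : Box, k < b.1 → (T b).card ≤ 1)
    (hcs : ∀ m, i < m → ∀ j, ∀ v ∈ T (m, j), ∀ w ∈ T (m + 1, j), v < w)
    (hand : HandFlow S₀.filling T Z In Out i x) (hIn : ∀ m ≤ k, In m = ∅) (hx : 0 < x)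
    (hor : (i, j) ∈ s ∨ (i + 1, j) ∈ s) (hlt : ∀ y ∈ T (i + 1, j), x < y)
    (hcontent : ∀ v, svContent s T v + (if v = x then 1 else 0) =
      svContent S₀.shape S₀.filling v)
    (htotal : ∀ m, totalExcess σ s T u t m + (if k = m then 1 else 0) =
      totalExcess σ S₀.shape S₀.filling S₀.aux t m) :
    Mid σ k S₀ t n (State.insertLabel ⟨s, T, u⟩ k (i + 1) x) ∧
      (∀ m, excess (State.insertLabel ⟨s, T, u⟩ k (i + 1) x).shape
        (State.insertLabel ⟨s, T, u⟩ k (i + 1) x).filling m = excess s T m) ∧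
      ∀ m ≤ i, ∀ p, (State.insertLabel ⟨s, T, u⟩ k (i + 1) x).filling (m, p) = T (m, p) := by
  -- As `n ≤ i + 1`, no box below row `i` has been swept out yet.
  have hdel : ∀ m, i < m → ∀ j, (Z (m, j)).Nonempty → (m, j) ∈ s := by
    intro m hm j hz
    rcases (hand.row m).cover j hz with h' | h'
    · rw [h₀.sv.nonempty_iff] at h'
      by_cases ha : AboveRegion σ (m, j)
      · exact (h.above_iff _ ha).2 ⟨h', fun h'' => by have := h''.2; simp only at this; omega⟩
      · exact h.mono _ h' ha
    · exact (hsv.nonempty_iff _).1 h'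
  have key := rowInsert_spec hσ hcol h.ext (s.sup Prod.fst) (T₀ := S₀.filling) (j := j)
    (by omega) hsv (fun m hm j => h₀.single _ (by simp only; omega))
    (fun m hm j => hsingle _ (by simp only; omega)) hcs hdel hand hx hor hlt
  unfold State.insertLabel
  simp only
  generalize rowInsert s T (i + 1) x = R at key
  obtain ⟨T', b⟩ := R
  have hb := key.not_mem
  have hbelow := key.below
  have hext := key.ext
  have hrl := key.row_lt
  have hsv' := key.sv
  simp only at hb hbelow hext hrl hsv' ⊢
  have hb₀ : b ∉ S₀.shape := by
    intro hb'
    exact hb (h.mono b hb' (fun ha => ha.not_belowRegion hσ hbelow))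
  have hsingle' : ∀ c : Box, k < c.1 → (T' c).card ≤ 1 := by
    rintro ⟨m, p⟩ hc
    by_cases hm : m ≤ i
    · rw [show T' (m, p) = T (m, p) from key.eq m hm p]
      exact hsingle _ hc
    · exact key.single m (by omega) p
  have hMid : MidShape σ k S₀ t n (insert b s) (Function.update u b k) := by
    refine ⟨hext, fun c hc => ?_, fun c hc hc' => Finset.mem_insert_of_mem (h.mono c hc hc'),
      fun c hc => ?_, fun c hc hc' => ?_, fun c hc hc' => ?_, fun c hc hc' => ?_⟩
    · rw [← h.above_iff c hc, Finset.mem_insert, or_iff_right]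
      rintro rfl
      exact hc.not_belowRegion hσ hbelow
    · rw [Function.update_of_ne (by rintro rfl; exact hb₀ hc), h.aux_old c hc]
    · by_cases hcb : c = b
      · subst hcb
        rw [Function.update_self]
      · rw [Function.update_of_ne hcb]
        exact h.aux_new c ((Finset.mem_insert.1 hc).resolve_left hcb) hc'
    · rw [Finset.mem_insert, not_or] at hc
      rw [Function.update_of_ne hc.1]
      exact h.aux_out c hc.2 hc'
    · rcases Finset.mem_insert.1 hc with rfl | hc
      · omega
      · exact h.new_gt c hc hc'
  -- Rows up to `i` are unchanged, and the rows below have excess zero before and after.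
  have he : ∀ m, excess (insert b s) T' m = excess s T m := by
    intro m
    by_cases hm : m ≤ i
    · have hf : (insert b s).filter (fun c => c.1 = m) = s.filter (fun c => c.1 = m) := by
        rw [Finset.filter_insert, if_neg (by omega)]
      unfold excess
      rw [hf]
      congr 1
      refine Finset.sum_congr rfl fun c hc => ?_
      obtain ⟨c1, c2⟩ := c
      have hc1 : c1 = m := (Finset.mem_filter.1 hc).2
      rw [show T' (c1, c2) = T (c1, c2) from key.eq c1 (by omega) c2]
    · rw [excess_eq_zero (fun c hc hcm => hsv'.card_eq_one hc
        (hsingle' c (by omega))), excess_eq_zero (fun c hc hcm => hsv.card_eq_one hc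
        (hsingle c (by omega)))]
  obtain ⟨Z', In', Out', h1, h2, h3⟩ := key.flow
  refine ⟨⟨hMid, hsv', semistandard_of_flow h₀ hMid hsv' h1 h2, hsingle', ⟨Z', In', Out', h1, h2,
    fun m hm => by rw [h3 m (by omega), hIn m hm]⟩, fun v => ?_, fun m => ?_⟩, he, key.eq⟩
  · have := key.content v
    simp only at this
    rw [← hcontent v]
    exact this
  · rw [← htotal m]
    have he := he m
    have hbb : b ∉ below σ s := fun h' => hb (mem_below.1 h').1
    simp only [totalExcess]
    rw [he, above_insert hσ hbelow, below_insert hbelow, content_insert hbb, Function.update_self,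
      content_congr (u := Function.update u b k) (v := u)
        (fun c hc => Function.update_of_ne (by rintro rfl; exact hbb hc) _ _)]
    push_cast
    ring

end SkewInsertion

/-! ### Changes of the excess and the two sweeps of a step -/

namespace SkewInsertion

theorem excess_insert {s : Finset Box} {b : Box} (hb : b ∉ s) (T : Box → Finset ℕ) (m : ℕ) :
    excess (insert b s) T m = excess s T m + if b.1 = m then ((T b).card : ℤ) - 1 else 0 := by
  unfold excess
  rw [Finset.filter_insert]
  split_ifs with h
  · have hb' : b ∉ s.filter fun c => c.1 = m := fun h' => hb (Finset.mem_filter.1 h').1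
    rw [Finset.sum_insert hb', Finset.card_insert_of_notMem hb']
    push_cast
    ring
  · ring

theorem excess_update_of_not_mem {s : Finset Box} {b : Box} (hb : b ∉ s) (T : Box → Finset ℕ)
    (A : Finset ℕ) (m : ℕ) : excess s (Function.update T b A) m = excess s T m := by
  unfold excess
  congr 1
  refine Finset.sum_congr rfl fun c hc => ?_
  rw [Function.update_of_ne (by rintro rfl; exact hb (Finset.mem_filter.1 hc).1)]

theorem excess_erase {s : Finset Box} {b : Box} (hb : b ∈ s) (T : Box → Finset ℕ)
    (A : Finset ℕ) (m : ℕ) : excess (s.erase b) (Function.update T b A) m =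
      excess s T m - if b.1 = m then ((T b).card : ℤ) - 1 else 0 := by
  have h := excess_insert (Finset.notMem_erase b s) T m
  rw [Finset.insert_erase hb] at h
  rw [h, excess_update_of_not_mem (Finset.notMem_erase b s)]
  ring

theorem excess_update {s : Finset Box} {b : Box} (hb : b ∈ s) (T : Box → Finset ℕ)
    (A : Finset ℕ) (m : ℕ) : excess s (Function.update T b A) m =
      excess s T m + if b.1 = m then (A.card : ℤ) - (T b).card else 0 := by
  have h1 := excess_erase hb T A m
  have h2 := excess_insert (Finset.notMem_erase b s) (Function.update T b A) m
  rw [Finset.insert_erase hb, Function.update_self, h1] at h2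
  rw [h2]
  split_ifs <;> ring

/-- This identifies the iteration count of `State.sweepRow` with an excess. Boxes of the shape are
nonempty, so the natural subtraction does not truncate. -/
theorem sum_rowCols_eq_excess {s : Finset Box} {T : Box → Finset ℕ}
    (hsv : IsSetValuedTableau s T) (k : ℕ) :
    ((∑ j ∈ rowCols s k, ((T (k, j)).card - 1) : ℕ) : ℤ) = excess s T k := by
  unfold excess rowCols
  rw [Finset.sum_image]
  · rw [Finset.card_eq_sum_ones, Nat.cast_sum, Nat.cast_sum, ← Finset.sum_sub_distrib]
    refine Finset.sum_congr rfl fun b hb => ?_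
    obtain ⟨hbs, rfl⟩ := Finset.mem_filter.1 hb
    have := Finset.card_pos.2 ((hsv.nonempty_iff b).2 hbs)
    simp only [Prod.mk.eta]
    push_cast [Nat.cast_sub this]
    rfl
  · intro b hb c hc hbc
    have h1 := (Finset.mem_filter.1 hb).2
    have h2 := (Finset.mem_filter.1 hc).2
    exact Prod.ext (h1.trans h2.symm) hbc

theorem RowFlow.refl {s : Finset Box} {T : Box → Finset ℕ} (hsv : IsSetValuedTableau s T)
    (hss : IsSemistandard s T) (m : ℕ) :
    RowFlow (fun j => T (m, j)) (fun j => T (m, j)) (fun j => T (m, j)) ∅ ∅ where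
  sub0 := fun _ _ h => h
  sub1 := fun _ _ h => h
  mono := fun j j' hj x hx y hy => hss.row m j j' ((hsv.nonempty_iff _).1 ⟨x, hx⟩)
    ((hsv.nonempty_iff _).1 ⟨y, hy⟩) hj x hx y hy
  lt0 := fun _ _ _ h h' => absurd h h'
  lt1 := fun _ _ _ h h' => absurd h h'
  mem_in := by simp
  mem_out := by simp
  last := fun _ _ h h' => absurd h' h
  first := fun _ _ h h' => absurd h' h
  cover := fun _ h => Or.inl h

namespace Mid

variable {σ : Finset Box} {k n : ℕ} {S₀ S : State} {t : Box → ℕ}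

theorem start (h₀ : Core σ k S₀ t) : Mid σ k S₀ t 0 S₀ where
  shape :=
    { ext := h₀.ext
      above_iff := fun b _ => by simp
      mono := fun b hb _ => hb
      aux_old := fun b _ => rfl
      aux_new := fun b hb hb' => absurd hb hb'
      aux_out := fun b hb _ => by
        have := mt h₀.aux_pos_iff.1 (fun h => hb h.1)
        omega
      new_gt := fun b hb hb' => absurd hb hb' }
  sv := h₀.sv
  ss := h₀.ss
  single := h₀.single
  flow := ⟨S₀.filling, fun _ => ∅, fun _ => ∅, RowFlow.refl h₀.sv h₀.ss, fun _ => rfl,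
    fun _ _ => rfl⟩
  content := fun _ => rfl
  total := fun _ => rfl

theorem mem_of_mem_filling (h : Mid σ k S₀ t n S) {b : Box} {x : ℕ} (hx : x ∈ S.filling b) :
    b ∈ S.shape := (h.sv.nonempty_iff b).1 ⟨x, hx⟩

theorem col_lt (h : Mid σ k S₀ t n S) {m j x y : ℕ} (hx : x ∈ S.filling (m, j))
    (hy : y ∈ S.filling (m + 1, j)) : x < y :=
  h.ss.col m (m + 1) j (h.mem_of_mem_filling hx) (h.mem_of_mem_filling hy) (Nat.lt_succ_self m)
    x hx y hy

/-- The row is cleared from right to left: by `hph`, once a box has changed, everything to its right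
is singly labelled. Labels already removed thus came from the current box or from its right, and
they exceed the label removed now. -/
theorem sweepLabel (hσ : IsSkewShape σ) (hcol : ColsConvex σ) (h₀ : Core σ k S₀ t)
    (h : Mid σ k S₀ t 0 S)
    (hph : ∀ j j', j < j' → S.filling (k, j) ≠ S₀.filling (k, j) →
      (S.filling (k, j')).card ≤ 1)
    (hne : (multiCols S.shape S.filling k).Nonempty) :
    Mid σ k S₀ t 0 (State.sweepLabel k S) ∧
    (∀ j j', j < j' → (State.sweepLabel k S).filling (k, j) ≠ S₀.filling (k, j) →
      ((State.sweepLabel k S).filling (k, j')).card ≤ 1) ∧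
    excess (State.sweepLabel k S).shape (State.sweepLabel k S).filling k =
      excess S.shape S.filling k - 1 := by
  have hjmem := Finset.max'_mem _ hne
  have hjmax : ∀ p ∈ multiCols S.shape S.filling k,
      p ≤ (multiCols S.shape S.filling k).max' hne := fun p hp => Finset.le_max' _ p hp
  unfold State.sweepLabel
  rw [dif_pos hne]
  simp only
  generalize (multiCols S.shape S.filling k).max' hne = j at hjmem hjmax
  obtain ⟨hjs, hjc⟩ := Finset.mem_filter.1 hjmem
  rw [mem_rowCols] at hjs
  have hAne : (S.filling (k, j)).Nonempty := (h.sv.nonempty_iff _).2 hjs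
  obtain ⟨x, hxA, hxs⟩ := Finset.exists_mem_eq_sup _ hAne (id : ℕ → ℕ)
  have hxmax : ∀ y ∈ S.filling (k, j), y ≤ x := by
    intro y hy
    have := Finset.le_sup (f := (id : ℕ → ℕ)) hy
    rw [hxs] at this
    exact this
  rw [hxs]
  simp only [id]
  obtain ⟨Z, In, Out, hrow, hlink, hIn⟩ := h.flow
  -- Nothing enters row `k`, so its histories are its initial boxes.
  have hZ : ∀ p, S₀.filling (k, p) = Z (k, p) := fun p =>
    (hrow k).eq_of_in_empty (hIn k le_rfl) p
  have hj₀ : (k, j) ∈ S₀.shape := by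
    by_contra h'
    exact lt_irrefl _ (h.shape.new_gt _ hjs h')
  have hother : ∀ m, m ≠ k → ∀ p, Function.update S.filling (k, j) ((S.filling (k, j)).erase x)
      (m, p) = S.filling (m, p) := fun m hm p => update_row_of_ne hm _ _ _
  have hother' : ∀ p, p ≠ j → Function.update S.filling (k, j) ((S.filling (k, j)).erase x)
      (k, p) = S.filling (k, p) := fun p hp => Function.update_of_ne (by simpa using hp) _ _
  have hsub : ∀ b, ∀ v ∈ Function.update S.filling (k, j) ((S.filling (k, j)).erase x) b,
      v ∈ S.filling b := by
    intro b v hv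
    by_cases hb : b = (k, j)
    · subst hb
      rw [Function.update_self] at hv
      exact Finset.mem_of_mem_erase hv
    · rwa [Function.update_of_ne hb] at hv
  have hand : HandFlow S₀.filling
      (Function.update S.filling (k, j) ((S.filling (k, j)).erase x)) Z In
      (Function.update Out k (insert x (Out k))) k x := by
    refine ⟨fun m => ?_, fun m hm => ?_, ?_, fun v hv => ?_⟩
    · by_cases hm : m = k
      · subst hm
        simp only [update_row_self, Function.update_self]
        exact (hrow m).remove hxA ((h₀.sv.nonempty_iff _).2 hj₀) hxmax
          -- The box holds several labels, so the case in which it becomes empty does not occur.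
          (fun h' => by omega)
      · simp only [hother m hm, Function.update_of_ne hm]
        exact hrow m
    · rw [Function.update_of_ne hm, hlink]
    · rw [Function.update_self, hlink]
    · rw [hlink, (hrow k).mem_out] at hv
      obtain ⟨p, hp, hp1⟩ := hv
      rcases lt_trichotomy p j with hpj | rfl | hpj
      · have := hph p j hpj (fun heq => hp1 (by
          rw [heq, hZ]
          exact hp))
        omega
      · exact (hrow k).lt1 p v x hp hp1 hxA
      · have hne' : (S.filling (k, p)).Nonempty := by
          by_contra hne'
          have := (hrow k).first p j hne' ⟨v, hp⟩ ⟨x, (hrow k).sub1 j x hxA⟩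
          omega
        obtain ⟨w, hw⟩ := hne'
        exact ((hrow k).mono j p hpj x ((hrow k).sub1 j x hxA) w
          ((hrow k).sub1 p w hw)).trans_lt ((hrow k).lt1 p v w hp hp1 hw)
  have hsv : IsSetValuedTableau S.shape
      (Function.update S.filling (k, j) ((S.filling (k, j)).erase x)) := by
    refine ⟨fun b => ?_, fun b v hv => h.sv.pos b v (hsub b v hv)⟩
    by_cases hb : b = (k, j)
    · subst hb
      rw [Function.update_self, ← Finset.card_pos, Finset.card_erase_of_mem hxA]
      simp only [hjs, iff_true]
      omega
    · rw [Function.update_of_ne hb, h.sv.nonempty_iff]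
  have hcard : ((S.filling (k, j)).erase x).card + 1 = (S.filling (k, j)).card :=
    Finset.card_erase_add_one hxA
  have hcardz : (((S.filling (k, j)).erase x).card : ℤ) - (S.filling (k, j)).card = -1 := by
    rw [← hcard]
    push_cast
    ring
  obtain ⟨hMid, hexc, hfill⟩ := of_insert hσ hcol h₀ h.shape (Nat.zero_le _) le_rfl hsv
    (fun b hb => (Finset.card_le_card (fun v hv => hsub b v hv)).trans (h.single b hb))
    (fun m hm p v hv w hw => h.col_lt (hsub _ v hv) (hsub _ w hw)) hand hIn
    (h.sv.pos _ x hxA) (Or.inl hjs) (fun y hy => h.col_lt hxA (hsub _ y hy))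
    (fun v => by
      rw [← h.content]
      have := svContent_update hjs S.filling ((S.filling (k, j)).erase x) v
      by_cases hv : v = x
      · subst hv
        simpa [hxA] using this
      · simpa [hv] using this)
    (fun m => by
      rw [← h.total, totalExcess, totalExcess, excess_update hjs, hcardz]
      split_ifs <;> ring)
  refine ⟨hMid, fun p q hpq hp => ?_, ?_⟩
  · rw [hfill k le_rfl] at hp ⊢
    have hqj : q ≠ j := by
      rintro rfl
      rw [hother' p hpq.ne] at hp
      have := hph p q hpq hp
      omega
    rw [hother' q hqj]
    by_cases hpj : p = j
    · subst hpj
      by_contra hc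
      have hqs : (k, q) ∈ S.shape := by
        rw [← h.sv.nonempty_iff, ← Finset.card_pos]
        omega
      have := hjmax q (Finset.mem_filter.2 ⟨mem_rowCols.2 hqs, by omega⟩)
      omega
    · rw [hother' p hpj] at hp
      exact hph p q hpq hp
  · rw [hexc, excess_update hjs, hcardz, if_pos rfl]
    ring

/-- The sum giving the number of iterations is the excess of row `k`, which each sweep lowers by
one; at zero every box is singly labelled. -/
theorem sweepRow (hσ : IsSkewShape σ) (hcol : ColsConvex σ) (h₀ : Core σ k S₀ t) :
    Mid σ k S₀ t 0 (State.sweepRow k S₀) ∧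
      ∀ j, ((State.sweepRow k S₀).filling (k, j)).card ≤ 1 := by
  have key : ∀ (N : ℕ) (S : State), Mid σ k S₀ t 0 S →
      (∀ j j', j < j' → S.filling (k, j) ≠ S₀.filling (k, j) →
        (S.filling (k, j')).card ≤ 1) →
      N = ∑ j ∈ rowCols S.shape k, ((S.filling (k, j)).card - 1) →
      Mid σ k S₀ t 0 ((State.sweepLabel k)^[N] S) ∧
        ∀ j, (((State.sweepLabel k)^[N] S).filling (k, j)).card ≤ 1 := by
    intro N
    induction N with
    | zero =>
      intro S h _ hN
      refine ⟨h, fun j => ?_⟩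
      by_cases hj : (k, j) ∈ S.shape
      · have := Finset.sum_eq_zero_iff.1 hN.symm j (mem_rowCols.2 hj)
        simp only [Function.iterate_zero, id]
        omega
      · have : S.filling (k, j) = ∅ := by
          rw [← Finset.not_nonempty_iff_eq_empty, h.sv.nonempty_iff]
          exact hj
        simp [this]
    | succ N ih =>
      intro S h hph hN
      have hne : (multiCols S.shape S.filling k).Nonempty := by
        by_contra hne
        have : ∑ j ∈ rowCols S.shape k, ((S.filling (k, j)).card - 1) = 0 := by
          refine Finset.sum_eq_zero fun j hj => ?_
          by_contra hj'
          exact hne ⟨j, Finset.mem_filter.2 ⟨hj, by omega⟩⟩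
        omega
      obtain ⟨h1, h2, h3⟩ := h.sweepLabel hσ hcol h₀ hph hne
      rw [Function.iterate_succ_apply]
      refine ih _ h1 h2 ?_
      rw [← sum_rowCols_eq_excess h1.sv, ← sum_rowCols_eq_excess h.sv] at h3
      omega
  exact key _ S₀ (start h₀) (fun j j' _ hj => absurd rfl hj) rfl

/-- As `k` is the largest label left in `t`, strict rows make the swept box leftmost among all boxes
that row `i` has had. Its removal keeps the shape skew, and its label is smaller than all labels
that have left the row. -/
theorem sweepBox (hσ : IsSkewShape σ) (hcol : ColsConvex σ) (hk : 0 < k) (h₀ : Core σ k S₀ t)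
    {i : ℕ} (h : Mid σ k S₀ t i S) (hone : ∀ j, (S.filling (k, j)).card ≤ 1) :
    Mid σ k S₀ t (i + 1) (State.sweepBox t k S i) ∧
      ∀ j, ((State.sweepBox t k S i).filling (k, j)).card ≤ 1 := by
  unfold State.sweepBox
  by_cases hne : ((rowCols S.shape i).filter fun j => t (i, j) = k).Nonempty
  swap
  · rw [dif_neg hne]
    refine ⟨⟨⟨h.shape.ext, fun b hb => ?_, h.shape.mono, h.shape.aux_old, h.shape.aux_new,
      h.shape.aux_out, h.shape.new_gt⟩, h.sv, h.ss, h.single, h.flow, h.content, h.total⟩, hone⟩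
    constructor
    · intro hbs
      obtain ⟨h1, h2⟩ := (h.shape.above_iff b hb).1 hbs
      refine ⟨h1, fun ⟨h3, h4⟩ => ?_⟩
      rcases Nat.lt_succ_iff_lt_or_eq.1 h4 with h5 | h5
      · exact h2 ⟨h3, h5⟩
      · obtain ⟨b1, b2⟩ := b
        simp only at h5
        subst h5
        exact hne ⟨b2, Finset.mem_filter.2 ⟨mem_rowCols.2 hbs, h3⟩⟩
    · rintro ⟨h1, h2⟩
      exact (h.shape.above_iff b hb).2 ⟨h1, fun h3 => h2 ⟨h3.1, h3.2.trans (Nat.lt_succ_self i)⟩⟩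
  rw [dif_pos hne]
  have hjmem := Finset.min'_mem _ hne
  simp only
  generalize ((rowCols S.shape i).filter fun j => t (i, j) = k).min' hne = j at hjmem
  obtain ⟨hjs, hjt⟩ := Finset.mem_filter.1 hjmem
  rw [mem_rowCols] at hjs
  obtain ⟨hj₀, hja⟩ := (h₀.t_pos_iff (b := (i, j))).1 (by omega)
  -- The weak row bound places the box in row `k` or lower, where all boxes are singly labelled by
  -- now.
  have hki : k ≤ i := hjt ▸ h₀.t_bdd _ (mem_above.2 ⟨hj₀, hja⟩)
  have hAcard : (S.filling (i, j)).card = 1 := by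
    refine h.sv.card_eq_one hjs ?_
    rcases hki.eq_or_lt with rfl | hki
    · exact hone j
    · exact h.single _ hki
  obtain ⟨x, hA⟩ := Finset.card_eq_one.1 hAcard
  have hxA : x ∈ S.filling (i, j) := by simp [hA]
  rw [show (S.filling (i, j)).sup id = x by rw [hA, Finset.sup_singleton]; rfl]
  have hunique : ∀ c : Box, c ∈ S₀.shape → AboveRegion σ c → t c = k → c.1 = i → c = (i, j) := by
    rintro ⟨c1, c2⟩ hc hc' ht hi
    simp only at hi
    subst hi
    rcases lt_trichotomy c2 j with hlt | rfl | hlt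
    · have := h₀.t_strict.row c1 c2 j (mem_above.2 ⟨hc, hc'⟩) (mem_above.2 ⟨hj₀, hja⟩) hlt
      omega
    · rfl
    · have := h₀.t_strict.row c1 j c2 (mem_above.2 ⟨hj₀, hja⟩) (mem_above.2 ⟨hc, hc'⟩) hlt
      omega
  obtain ⟨Z, In, Out, hrow, hlink, hIn⟩ := h.flow
  -- A box further left would lie above `σ` and carry a label of `t` greater than `k`.
  have hfirst : ∀ p, (Z (i, p)).Nonempty → j ≤ p := by
    intro p hz
    by_contra hlt
    have hpa : AboveRegion σ ((i, p) : Box) → False := by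
      intro hpa
      have hp₀ : (i, p) ∈ S₀.shape := by
        rcases (hrow i).cover p hz with h' | h'
        · exact (h₀.sv.nonempty_iff _).1 h'
        · exact ((h.shape.above_iff _ hpa).1 ((h.sv.nonempty_iff _).1 h')).1
      have := h₀.t_strict.row i p j (mem_above.2 ⟨hp₀, hpa⟩) (mem_above.2 ⟨hj₀, hja⟩)
        (not_le.1 hlt)
      have := h₀.t_le (i, p)
      omega
    refine hpa (hja.of_le hσ ⟨le_rfl, (not_le.1 hlt).le⟩ ?_)
    rcases (hrow i).cover p hz with h' | h'
    · exact h₀.ext.inCols (b := (i, p)) ((h₀.sv.nonempty_iff _).1 h')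
    · exact h.shape.ext.inCols (b := (i, p)) ((h.sv.nonempty_iff _).1 h')
  have hshape : MidShape σ k S₀ t (i + 1) (S.shape.erase (i, j)) S.aux := by
    refine ⟨?_, fun c hc => ?_, fun c hc hc' => ?_, h.shape.aux_old, fun c hc hc' => ?_,
      fun c hc hc' => ?_, fun c hc hc' => ?_⟩
    · refine extends_of_closed hσ hcol ?_ ?_ ?_ ?_ ?_
      · exact fun b hb => h.shape.ext.isSkewShape.pos b (Finset.mem_of_mem_erase hb)
      · exact fun b hb => Finset.mem_erase.2
          ⟨by rintro rfl; exact hja.1 hb, h.shape.ext.subset hb⟩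
      · exact fun b hb => h.shape.ext.inCols (Finset.mem_of_mem_erase hb)
      · intro b c hb hb' hbc hc
        obtain ⟨hbj, hb⟩ := Finset.mem_erase.1 hb
        refine Finset.mem_erase.2 ⟨?_, h.shape.ext.mem_of_above hb hbc hc⟩
        rintro rfl
        obtain ⟨hb₀, hbt⟩ := (h.shape.above_iff b hb').1 hb
        -- A box weakly north-west of the deleted one has label at least `k`, hence exactly `k`; in
        -- an earlier row it has been swept out already, and in row `i` it is the deleted box.
        have h1 := h₀.t_anti hσ hb₀ hc hbc
        have h2 := h₀.t_le b
        have h3 : b.1 ≤ i := hbc.1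
        refine hbj (hunique b hb₀ hb' (by omega) ?_)
        by_contra hbi
        exact hbt ⟨by omega, by omega⟩
      · intro b c hc hc' hbc hb
        refine Finset.mem_erase.2
          ⟨?_, h.shape.ext.mem_of_below (Finset.mem_of_mem_erase hc) hbc hb⟩
        rintro rfl
        exact hja.not_belowRegion hσ hb
    · rw [Finset.mem_erase, h.shape.above_iff c hc]
      constructor
      · rintro ⟨h1, h2, h3⟩
        refine ⟨h2, fun ⟨h4, h5⟩ => ?_⟩
        rcases Nat.lt_succ_iff_lt_or_eq.1 h5 with h6 | h6
        · exact h3 ⟨h4, h6⟩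
        · exact h1 (hunique c h2 hc h4 h6)
      · rintro ⟨h1, h2⟩
        refine ⟨?_, h1, fun h3 => h2 ⟨h3.1, h3.2.trans (Nat.lt_succ_self i)⟩⟩
        rintro rfl
        exact h2 ⟨hjt, Nat.lt_succ_self i⟩
    · exact Finset.mem_erase.2 ⟨by rintro rfl; exact hc' hja, h.shape.mono c hc hc'⟩
    · exact h.shape.aux_new c (Finset.mem_of_mem_erase hc) hc'
    · exact h.shape.aux_out c (fun hcs => hc (Finset.mem_erase.2
        ⟨by rintro rfl; exact hc' hj₀, hcs⟩)) hc'
    · exact h.shape.new_gt c (Finset.mem_of_mem_erase hc) hc'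
  have hsub : ∀ b, ∀ v ∈ Function.update S.filling (i, j) ∅ b, v ∈ S.filling b := by
    intro b v hv
    by_cases hb : b = (i, j)
    · subst hb
      simp at hv
    · rwa [Function.update_of_ne hb] at hv
  have hand : HandFlow S₀.filling (Function.update S.filling (i, j) ∅) Z In
      (Function.update Out i (insert x (Out i))) i x := by
    refine ⟨fun m => ?_, fun m hm => ?_, ?_, fun v hv => ?_⟩
    · by_cases hm : m = i
      · subst hm
        simp only [update_row_self, Function.update_self]
        have := (hrow m).remove hxA ((h₀.sv.nonempty_iff _).2 hj₀)
          (fun y hy => by rw [hA, Finset.mem_singleton] at hy; exact hy.le)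
          (fun _ => hfirst)
        rwa [show (S.filling (m, j)).erase x = ∅ by simp [hA]] at this
      · simp only [update_row_of_ne hm, Function.update_of_ne hm]
        exact hrow m
    · rw [Function.update_of_ne hm, hlink]
    · rw [Function.update_self, hlink]
    · rw [hlink, (hrow i).mem_out] at hv
      obtain ⟨p, hp, hp1⟩ := hv
      rcases (hfirst p ⟨v, hp⟩).eq_or_lt with rfl | hpj
      · exact (hrow i).lt1 j v x hp hp1 hxA
      · have hne' : (S.filling (i, p)).Nonempty := by
          by_contra hne'
          have := (hrow i).first p j hne' ⟨v, hp⟩ ⟨x, (hrow i).sub1 j x hxA⟩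
          omega
        obtain ⟨w, hw⟩ := hne'
        exact ((hrow i).mono j p hpj x ((hrow i).sub1 j x hxA) w
          ((hrow i).sub1 p w hw)).trans_lt ((hrow i).lt1 p v w hp hp1 hw)
  have hsv : IsSetValuedTableau (S.shape.erase (i, j)) (Function.update S.filling (i, j) ∅) := by
    refine ⟨fun b => ?_, fun b v hv => h.sv.pos b v (hsub b v hv)⟩
    by_cases hb : b = (i, j)
    · subst hb
      simp
    · rw [Function.update_of_ne hb, h.sv.nonempty_iff, Finset.mem_erase]
      simp [hb]
  -- The deleted box has a box of the shape directly beneath it, which serves as the witness column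
  -- for the insertion.
  have hsucc : (i + 1, j) ∈ S.shape.erase (i, j) := by
    refine Finset.mem_erase.2 ⟨by simp, ?_⟩
    obtain ⟨-, a, ha, h1, h2⟩ := hja
    exact h.shape.ext.isSkewShape.mem_of_le_of_le hjs (h.shape.ext.subset ha)
      ⟨Nat.le_succ i, le_rfl⟩ ⟨h2, h1.ge⟩
  have habove : above σ S.shape = insert (i, j) (above σ (S.shape.erase (i, j))) := by
    ext b
    simp only [Finset.mem_insert, mem_above, Finset.mem_erase]
    by_cases hb : b = (i, j)
    · subst hb
      simp [hjs, hja]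
    · simp [hb]
  have hbelow : below σ (S.shape.erase (i, j)) = below σ S.shape := by
    ext b
    simp only [mem_below, Finset.mem_erase]
    constructor
    · rintro ⟨⟨-, h1⟩, h2⟩
      exact ⟨h1, h2⟩
    · rintro ⟨h1, h2⟩
      exact ⟨⟨by rintro rfl; exact hja.not_belowRegion hσ h2, h1⟩, h2⟩
  obtain ⟨hMid, -, hfill⟩ := of_insert hσ hcol h₀ hshape le_rfl hki hsv
    (fun b hb => (Finset.card_le_card (fun v hv => hsub b v hv)).trans (h.single b hb))
    (fun m hm p v hv w hw => h.col_lt (hsub _ v hv) (hsub _ w hw)) hand hIn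
    (h.sv.pos _ x hxA) (Or.inr hsucc) (fun y hy => h.col_lt hxA (hsub _ y hy))
    (fun v => by
      rw [← h.content, ← svContent_erase hjs S.filling ∅ v, hA]
      simp)
    (fun m => by
      rw [← h.total, totalExcess, totalExcess, excess_erase hjs, hAcard, hbelow, habove,
        content_insert (fun h' => by simp [mem_above] at h'), hjt]
      push_cast
      simp only [ite_self, sub_zero]
      ring)
  refine ⟨hMid, fun p => ?_⟩
  rw [hfill k hki]
  exact (Finset.card_le_card (fun v hv => hsub _ v hv)).trans (hone p)

theorem sweepBoxes (hσ : IsSkewShape σ) (hcol : ColsConvex σ) (hk : 0 < k) (h₀ : Core σ k S₀ t)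
    (r : ℕ) (h : Mid σ k S₀ t 0 S) (hone : ∀ j, (S.filling (k, j)).card ≤ 1) :
    Mid σ k S₀ t (r + 1) (State.sweepBoxes t r k S) ∧
      ∀ j, ((State.sweepBoxes t r k S).filling (k, j)).card ≤ 1 := by
  unfold State.sweepBoxes
  generalize r + 1 = n
  induction n with
  | zero => exact ⟨h, hone⟩
  | succ n ih =>
    rw [List.range_succ, List.foldl_append]
    exact ih.1.sweepBox hσ hcol hk h₀ ih.2

end Mid

/-! ### The state at the end of a step -/

/-- The tableau of the boxes that remain to be swept out after step `k`. -/
def dropLabel (k : ℕ) (t : Box → ℕ) (b : Box) : ℕ := if t b = k then 0 else t b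

/-- Boxes created in this step receive a label smaller than all earlier ones, at most one per row
and at its right end, so rows of `aux` stay strict and columns weakly decreasing. They lie below row
`k + 1`, which gives the strict row bound. -/
theorem Mid.finish {σ : Finset Box} (hσ : IsSkewShape σ) {k : ℕ} {S₀ S : State} {t : Box → ℕ}
    (h₀ : Core σ (k + 1) S₀ t) (h : Mid σ (k + 1) S₀ t (lastRow σ + 1) S)
    (hone : ∀ j, (S.filling (k + 1, j)).card ≤ 1) :
    Core σ k S (dropLabel (k + 1) t) ∧
      ∃ Z In Out, Flow (k + 1) S₀ S t (dropLabel (k + 1) t) Z In Out := by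
  obtain ⟨Z, In, Out, hrow, hlink, hIn⟩ := h.flow
  have habove : ∀ b, AboveRegion σ b → (b ∈ S.shape ↔ b ∈ S₀.shape ∧ t b ≠ k + 1) := by
    intro b hb
    rw [h.shape.above_iff b hb]
    obtain ⟨-, a, ha, -, hlt⟩ := hb
    -- Every box above `σ` is in a row before `lastRow σ`, so the sweep has reached all of them.
    have : a.1 ≤ lastRow σ := Finset.le_sup (f := Prod.fst) ha
    have : b.1 < lastRow σ + 1 := by omega
    simp [this]
  have hdrop : ∀ b ∈ above σ S.shape, b ∈ above σ S₀.shape ∧ dropLabel (k + 1) t b = t b ∧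
      t b ≠ k + 1 := by
    intro b hb
    obtain ⟨h1, h2⟩ := mem_above.1 hb
    obtain ⟨h3, h4⟩ := (habove b h2).1 h1
    exact ⟨mem_above.2 ⟨h3, h2⟩, by rw [dropLabel, if_neg h4], h4⟩
  have hnew : ∀ b ∈ S.shape, b ∉ S₀.shape → BelowRegion σ b ∧ S.aux b = k + 1 := fun b hb hb' =>
    ⟨h.shape.belowRegion_of_new h₀ hb hb', h.shape.aux_new b hb hb'⟩
  have hold : ∀ b ∈ S₀.shape, BelowRegion σ b → S.aux b = S₀.aux b ∧ k + 1 < S₀.aux b :=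
    fun b hb hb' => ⟨h.shape.aux_old b hb, h₀.aux_gt b (h₀.aux_pos_iff.2 ⟨hb, hb'⟩)⟩
  have hlast : ∀ i j j', (i, j) ∈ S.shape → (i, j) ∉ S₀.shape → (i, j') ∈ S.shape → j' ≤ j := by
    intro i j j' hj hj₀ hj'
    obtain ⟨x, hx⟩ := (h.sv.nonempty_iff _).2 hj
    obtain ⟨y, hy⟩ := (h.sv.nonempty_iff _).2 hj'
    exact (hrow i).last j j' (fun h' => hj₀ ((h₀.sv.nonempty_iff _).1 h'))
      ⟨x, (hrow i).sub1 j x hx⟩ ⟨y, (hrow i).sub1 j' y hy⟩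
  refine ⟨⟨h.shape.ext, fun b => ?_, ⟨fun i j j' hj hj' hlt => ?_, fun i i' j hi hi' hlt => ?_⟩,
    fun b hb => ?_, fun b => ?_, fun b => ?_, ⟨fun i j j' hj hj' hlt => ?_,
    fun i i' j hi hi' hlt => ?_⟩, fun b hb => ?_, fun b hb => ?_, h.sv, h.ss, fun b hb => ?_⟩,
    Z, In, Out, hrow, hlink, hIn, fun b => rfl, fun b => ?_⟩
  · rw [mem_above]
    unfold dropLabel
    constructor
    · intro hb
      have h1 : t b ≠ k + 1 := fun h' => by rw [if_pos h'] at hb; omega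
      rw [if_neg h1] at hb
      obtain ⟨h2, h3⟩ := h₀.t_pos_iff.1 hb
      exact ⟨(habove b h3).2 ⟨h2, h1⟩, h3⟩
    · rintro ⟨h1, h2⟩
      obtain ⟨h3, h4⟩ := (habove b h2).1 h1
      rw [if_neg h4]
      exact h₀.t_pos_iff.2 ⟨h3, h2⟩
  · rw [(hdrop _ hj).2.1, (hdrop _ hj').2.1]
    exact h₀.t_strict.row i j j' (hdrop _ hj).1 (hdrop _ hj').1 hlt
  · rw [(hdrop _ hi).2.1, (hdrop _ hi').2.1]
    exact h₀.t_strict.col i i' j (hdrop _ hi).1 (hdrop _ hi').1 hlt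
  · rw [(hdrop _ hb).2.1]
    exact h₀.t_bdd b (hdrop _ hb).1
  · have := h₀.t_le b
    unfold dropLabel
    split_ifs <;> omega
  · rw [mem_below]
    by_cases hb : b ∈ S₀.shape
    · rw [h.shape.aux_old b hb, h₀.aux_pos_iff]
      exact ⟨fun h' => ⟨h.shape.mono b hb (fun ha => ha.not_belowRegion hσ h'.2), h'.2⟩,
        fun h' => ⟨hb, h'.2⟩⟩
    · by_cases hb' : b ∈ S.shape
      · obtain ⟨h1, h2⟩ := hnew b hb' hb
        simp [h1, h2, hb']
      · rw [h.shape.aux_out b hb' hb]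
        simp [hb']
  · obtain ⟨h1, h2⟩ := mem_below.1 hj
    obtain ⟨h3, h4⟩ := mem_below.1 hj'
    by_cases h5 : (i, j) ∈ S₀.shape
    · by_cases h6 : (i, j') ∈ S₀.shape
      · rw [(hold _ h5 h2).1, (hold _ h6 h4).1]
        exact h₀.aux_strict.row i j j' (mem_below.2 ⟨h5, h2⟩) (mem_below.2 ⟨h6, h4⟩) hlt
      · rw [(hold _ h5 h2).1, (hnew _ h3 h6).2]
        exact (hold _ h5 h2).2
    · have := hlast i j j' h1 h5 h3
      omega
  · obtain ⟨h1, h2⟩ := mem_below.1 hi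
    obtain ⟨h3, h4⟩ := mem_below.1 hi'
    by_cases h6 : (i', j) ∈ S₀.shape
    · have h5 : (i, j) ∈ S₀.shape := h₀.ext.mem_of_below h6 ⟨hlt.le, le_rfl⟩ h2
      rw [(hold _ h5 h2).1, (hold _ h6 h4).1]
      exact h₀.aux_strict.col i i' j (mem_below.2 ⟨h5, h2⟩) (mem_below.2 ⟨h6, h4⟩) hlt
    · rw [(hnew _ h3 h6).2]
      by_cases h5 : (i, j) ∈ S₀.shape
      · rw [(hold _ h5 h2).1]
        exact (hold _ h5 h2).2.le
      · exact (hnew _ h1 h5).2.ge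
  · obtain ⟨h1, h2⟩ := mem_below.1 hb
    by_cases h5 : b ∈ S₀.shape
    · rw [(hold _ h5 h2).1]
      exact h₀.aux_bdd b (mem_below.2 ⟨h5, h2⟩)
    · rw [(hnew _ h1 h5).2]
      exact h.shape.new_gt b h1 h5
  · by_cases h5 : b ∈ S₀.shape
    · rw [h.shape.aux_old b h5] at hb ⊢
      have := h₀.aux_gt b hb
      omega
    · by_cases h6 : b ∈ S.shape
      · have := (hnew b h6 h5).2
        omega
      · rw [h.shape.aux_out b h6 h5] at hb
        omega
  · rcases Nat.lt_or_ge (k + 1) b.1 with h1 | h1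
    · exact h.single b h1
    · obtain ⟨b1, b2⟩ := b
      have : b1 = k + 1 := by simp only at h1 hb; omega
      subst this
      exact hone b2
  · by_cases h5 : b ∈ S₀.shape
    · rw [h.shape.aux_old b h5]
      split_ifs with h6
      · have := h₀.aux_gt b (by omega)
        omega
      · rfl
    · have h0 : S₀.aux b = 0 := by
        have := mt h₀.aux_pos_iff.1 (fun h' => h5 h'.1)
        omega
      rw [h0]
      by_cases h6 : b ∈ S.shape
      · rw [if_pos (hnew b h6 h5).2]
      · rw [h.shape.aux_out b h6 h5]
        simp

/-- Step `k` of the algorithm. -/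
def State.step (r k : ℕ) (t : Box → ℕ) (S : State) : State :=
  State.sweepBoxes t r k (State.sweepRow k S)

theorem Core.step {σ : Finset Box} (hσ : IsSkewShape σ) (hcol : ColsConvex σ) {k : ℕ}
    {S : State} {t : Box → ℕ} (h : Core σ (k + 1) S t) :
    Core σ k (State.step (lastRow σ) (k + 1) t S) (dropLabel (k + 1) t) ∧
      (∃ Z In Out, Flow (k + 1) S (State.step (lastRow σ) (k + 1) t S) t (dropLabel (k + 1) t)
        Z In Out) ∧
      (∀ v, svContent (State.step (lastRow σ) (k + 1) t S).shape
        (State.step (lastRow σ) (k + 1) t S).filling v = svContent S.shape S.filling v) ∧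
      ∀ m, totalExcess σ (State.step (lastRow σ) (k + 1) t S).shape
        (State.step (lastRow σ) (k + 1) t S).filling
        (State.step (lastRow σ) (k + 1) t S).aux (dropLabel (k + 1) t) m =
        totalExcess σ S.shape S.filling S.aux t m := by
  obtain ⟨h1, h2⟩ := Mid.sweepRow hσ hcol h
  obtain ⟨h3, h4⟩ := h1.sweepBoxes hσ hcol (Nat.succ_pos k) h (lastRow σ) h2
  obtain ⟨h5, h6⟩ := h3.finish hσ h h4
  refine ⟨h5, h6, h3.content, fun m => ?_⟩
  rw [← h3.total m]
  unfold totalExcess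
  -- Only the content of `t` is affected by `dropLabel`, and the boxes still present above `σ` do
  -- not carry the dropped label.
  congr 3
  refine content_congr (fun b hb => ?_) m
  have : 0 < dropLabel (k + 1) t b := (h5.t_tab b).2 hb
  unfold dropLabel at this ⊢
  split_ifs at this ⊢ with h'
  · omega
  · rfl

end SkewInsertion

namespace SkewInsertion

/-! ### Reversing a step of the algorithm -/

/-- The greatest element of a finite set of labels, as a set. -/
def maxPart (A : Finset ℕ) : Finset ℕ := A.filter fun v => ∀ w ∈ A, w ≤ v

theorem mem_maxPart {A : Finset ℕ} {v : ℕ} : v ∈ maxPart A ↔ v ∈ A ∧ ∀ w ∈ A, w ≤ v :=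
  Finset.mem_filter

theorem maxPart_nonempty {A : Finset ℕ} (h : A.Nonempty) : (maxPart A).Nonempty := by
  obtain ⟨v, hv, hmax⟩ := A.exists_max_image id h
  exact ⟨v, mem_maxPart.2 ⟨hv, hmax⟩⟩

theorem card_maxPart_le_one (A : Finset ℕ) : (maxPart A).card ≤ 1 :=
  Finset.card_le_one.2 fun _ hv _ hw => le_antisymm
    ((mem_maxPart.1 hw).2 _ (mem_maxPart.1 hv).1) ((mem_maxPart.1 hv).2 _ (mem_maxPart.1 hw).1)

open scoped Classical in
/-- The history of a row with final filling `f` which has emitted the labels in `Y`: each of these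
comes from the rightmost box with a smaller label, or else from the column `p`. -/
noncomputable def rowHistory (f : ℕ → Finset ℕ) (p : ℕ) (Y : Finset ℕ) (j : ℕ) : Finset ℕ :=
  f j ∪ (Y.filter (fun y => (∃ v ∈ f j, v < y) ∧ ∀ j' > j, ∀ v ∈ f j', y ≤ v) ∪
    Y.filter (fun y => j = p ∧ ∀ j', ∀ v ∈ f j', y ≤ v))

theorem mem_rowHistory {f : ℕ → Finset ℕ} {p : ℕ} {Y : Finset ℕ} {j x : ℕ} :
    x ∈ rowHistory f p Y j ↔ x ∈ f j ∨
      (x ∈ Y ∧ (∃ v ∈ f j, v < x) ∧ ∀ j' > j, ∀ v ∈ f j', x ≤ v) ∨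
      (x ∈ Y ∧ j = p ∧ ∀ j', ∀ v ∈ f j', x ≤ v) := by
  simp [rowHistory]

theorem rowHistory_nonempty {f : ℕ → Finset ℕ} {p : ℕ} {Y : Finset ℕ} {j : ℕ}
    (h : (rowHistory f p Y j).Nonempty) : (f j).Nonempty ∨
      (j = p ∧ ∃ y ∈ Y, ∀ j', ∀ v ∈ f j', y ≤ v) := by
  obtain ⟨x, hx⟩ := h
  rcases mem_rowHistory.1 hx with h | ⟨-, ⟨v, hv, -⟩, -⟩ | ⟨h1, h2, h3⟩
  · exact Or.inl ⟨x, h⟩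
  · exact Or.inl ⟨v, hv⟩
  · exact Or.inr ⟨h2, x, h1, h3⟩

/-- The alternatives for `f0` are a row that keeps every label, a singly labelled box that starts
with its maximum, and a box created at the right end. The finite set `C` serves to choose rightmost
columns; `hp` puts a restored box to the left of the row. -/
theorem rowFlow_of_final {f f0 : ℕ → Finset ℕ} {p : ℕ} {X Y : Finset ℕ} {C : Finset ℕ}
    (hf : ∀ j j', j < j' → ∀ x ∈ f j, ∀ y ∈ f j', x ≤ y)
    (hcard : Y.Nonempty → ∀ j, (f j).card ≤ 1) (hC : ∀ j, (f j).Nonempty → j ∈ C)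
    (hp : (∃ y ∈ Y, ∀ j', ∀ v ∈ f j', y ≤ v) → ∀ j, (f j).Nonempty → p < j)
    (hf0 : ∀ j, f0 j = rowHistory f p Y j ∨ f0 j = maxPart (rowHistory f p Y j) ∨
      (f0 j = ∅ ∧ (f j).Nonempty ∧ ∀ j', (f j').Nonempty → j' ≤ j))
    (hX : ∀ x, x ∈ X ↔ ∃ j, x ∈ rowHistory f p Y j ∧ x ∉ f0 j) :
    RowFlow f0 f (rowHistory f p Y) X Y where
  sub0 := by
    intro j x hx
    rcases hf0 j with h | h | ⟨h, -⟩ <;> rw [h] at hx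
    · exact hx
    · exact (mem_maxPart.1 hx).1
    · simp at hx
  sub1 := fun j x hx => mem_rowHistory.2 (Or.inl hx)
  mono := by
    intro j j' hj x hx y hy
    rcases mem_rowHistory.1 hx with h1 | ⟨h1, h2, h3⟩ | ⟨h1, rfl, h2⟩
    · rcases mem_rowHistory.1 hy with h4 | ⟨h4, ⟨v, hv, hvy⟩, h6⟩ | ⟨h4, rfl, h5⟩
      · exact hf j j' hj x h1 y h4
      · exact (hf j j' hj x h1 v hv).trans hvy.le
      · exact absurd (hp ⟨y, h4, h5⟩ j ⟨x, h1⟩) hj.not_gt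
    · rcases mem_rowHistory.1 hy with h4 | ⟨h4, ⟨v, hv, hvy⟩, h6⟩ | ⟨h4, rfl, h5⟩
      · exact h3 j' hj y h4
      · exact (h3 j' hj v hv).trans hvy.le
      · obtain ⟨v, hv, -⟩ := h2
        exact absurd (hp ⟨y, h4, h5⟩ j ⟨v, hv⟩) hj.not_gt
    · rcases mem_rowHistory.1 hy with h4 | ⟨h4, ⟨v, hv, hvy⟩, h6⟩ | ⟨h4, rfl, h5⟩
      · exact h2 j' y h4
      · exact (h2 j' v hv).trans hvy.le
      · exact absurd hj (lt_irrefl _)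
  lt0 := by
    intro j x y hx hx0 hy
    rcases hf0 j with h | h | ⟨h, -⟩ <;> rw [h] at hx0 hy
    · exact absurd hx hx0
    · refine lt_of_le_of_ne ((mem_maxPart.1 hy).2 x hx) ?_
      rintro rfl
      exact hx0 hy
    · simp at hy
  lt1 := by
    intro j x y hx hx1 hy
    rcases mem_rowHistory.1 hx with h1 | ⟨h1, ⟨v, hv, hvx⟩, h3⟩ | ⟨h1, rfl, h2⟩
    · exact absurd h1 hx1
    · rwa [Finset.card_le_one.1 (hcard ⟨x, h1⟩ j) y hy v hv]
    · exact absurd (hp ⟨x, h1, h2⟩ j ⟨y, hy⟩) (lt_irrefl _)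
  mem_in := hX
  mem_out := by
    intro y
    constructor
    · intro hy
      by_cases hex : ∃ j, ∃ v ∈ f j, v < y
      · obtain ⟨j, ⟨v, hv, hvy⟩, hmax⟩ : ∃ j, (∃ v ∈ f j, v < y) ∧
            ∀ j', (∃ v ∈ f j', v < y) → j' ≤ j := by
          classical
          have hne : (C.filter fun j => ∃ v ∈ f j, v < y).Nonempty := by
            obtain ⟨j, v, hv, hvy⟩ := hex
            exact ⟨j, Finset.mem_filter.2 ⟨hC j ⟨v, hv⟩, v, hv, hvy⟩⟩
          obtain ⟨j, hj, hmax⟩ := Finset.exists_max_image _ id hne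
          refine ⟨j, (Finset.mem_filter.1 hj).2, fun j' hj' => hmax j' ?_⟩
          obtain ⟨v, hv, hvy⟩ := hj'
          exact Finset.mem_filter.2 ⟨hC j' ⟨v, hv⟩, v, hv, hvy⟩
        refine ⟨j, mem_rowHistory.2 (Or.inr (Or.inl ⟨hy, ⟨v, hv, hvy⟩, fun j' hj' w hw => ?_⟩)),
          fun hyf => ?_⟩
        · by_contra hwy
          exact absurd (hmax j' ⟨w, hw, not_le.1 hwy⟩) (not_le.2 hj')
        · exact hvy.ne (Finset.card_le_one.1 (hcard ⟨y, hy⟩ j) v hv y hyf)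
      · have hall : ∀ j', ∀ v ∈ f j', y ≤ v := by
          intro j' v hv
          by_contra hvy
          exact hex ⟨j', v, hv, not_le.1 hvy⟩
        exact ⟨p, mem_rowHistory.2 (Or.inr (Or.inr ⟨hy, rfl, hall⟩)),
          fun hyf => lt_irrefl _ (hp ⟨y, hy, hall⟩ p ⟨y, hyf⟩)⟩
    · rintro ⟨j, hj, hj1⟩
      rcases mem_rowHistory.1 hj with h1 | ⟨h1, -⟩ | ⟨h1, -⟩
      · exact absurd h1 hj1
      · exact h1
      · exact h1
  last := by
    intro j j' h1 h2 h3
    rcases hf0 j with h | h | ⟨-, h4, h5⟩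
    · exact absurd (h ▸ h2) h1
    · exact absurd (h ▸ maxPart_nonempty h2) h1
    · rcases rowHistory_nonempty h3 with h6 | ⟨rfl, h6⟩
      · exact h5 j' h6
      · exact (hp h6 j h4).le
  first := by
    intro j j' h1 h2 h3
    rcases rowHistory_nonempty h2 with h4 | ⟨rfl, h4⟩
    · exact absurd h4 h1
    · rcases rowHistory_nonempty h3 with h6 | ⟨rfl, h6⟩
      · exact (hp h4 j' h6).le
      · exact le_rfl
  cover := by
    intro j hj
    rcases hf0 j with h | h | ⟨-, h4, -⟩
    · exact Or.inl (h ▸ hj)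
    · exact Or.inl (h ▸ maxPart_nonempty hj)
    · exact Or.inr h4

open scoped Classical in
/-- The rightmost column of row `i` with a box of the region above `σ` that is not in `s`. -/
noncomputable def reverseCol (σ s : Finset Box) (i : ℕ) : ℕ :=
  ((σ.image Prod.snd).filter fun j => AboveRegion σ (i, j) ∧ (i, j) ∉ s).sup id

theorem reverseCol_spec {σ s : Finset Box} {i j : ℕ} (hj : AboveRegion σ (i, j))
    (hjs : (i, j) ∉ s) : AboveRegion σ (i, reverseCol σ s i) ∧ (i, reverseCol σ s i) ∉ s ∧
      ∀ j', AboveRegion σ (i, j') → (i, j') ∉ s → j' ≤ reverseCol σ s i := by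
  classical
  have hmem : ∀ j', AboveRegion σ (i, j') → (i, j') ∉ s → j' ∈ (σ.image Prod.snd).filter
      fun j => AboveRegion σ (i, j) ∧ (i, j) ∉ s := by
    intro j' h1 h2
    obtain ⟨a, ha, haj⟩ := h1.inCols
    exact Finset.mem_filter.2 ⟨Finset.mem_image.2 ⟨a, ha, haj⟩, h1, h2⟩
  have hsup : reverseCol σ s i = ((σ.image Prod.snd).filter
      fun j => AboveRegion σ (i, j) ∧ (i, j) ∉ s).sup id := by
    unfold reverseCol
    congr!
  obtain ⟨q, hq, hqs⟩ := Finset.exists_mem_eq_sup _ ⟨j, hmem j hj hjs⟩ (id : ℕ → ℕ)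
  rw [hsup]
  refine ⟨?_, ?_, fun j' h1 h2 => Finset.le_sup (f := (id : ℕ → ℕ)) (hmem j' h1 h2)⟩
  · rw [hqs]
    exact (Finset.mem_filter.1 hq).2.1
  · rw [hqs]
    exact (Finset.mem_filter.1 hq).2.2

/-- The history of row `i` in a reversed step which ends in the state `S`, when the labels in `Y`
have left the row. -/
noncomputable def State.history (σ : Finset Box) (S : State) (i : ℕ) (Y : Finset ℕ) (j : ℕ) :
    Finset ℕ :=
  rowHistory (fun j => S.filling (i, j)) (reverseCol σ S.shape i) Y j

/-- The filling of row `i` before a step which ends in the state `S`, when the labels in `Y` have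
left the row. -/
noncomputable def State.initialRow (σ : Finset Box) (k : ℕ) (S : State) (i : ℕ) (Y : Finset ℕ)
    (j : ℕ) : Finset ℕ :=
  if i ≤ k then S.history σ i Y j else if S.aux (i, j) = k then ∅ else maxPart (S.history σ i Y j)

/-- The labels that have entered row `i` if the labels in `Y` have left it. -/
noncomputable def State.incoming (σ : Finset Box) (k : ℕ) (S : State) (i : ℕ) (Y : Finset ℕ) :
    Finset ℕ :=
  (rowCols S.shape i ∪ {reverseCol σ S.shape i}).biUnion fun j =>
    S.history σ i Y j \ S.initialRow σ k i Y j

/-- The labels that have left row `M - n`. -/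
noncomputable def State.outgoing (σ : Finset Box) (k : ℕ) (S : State) (M : ℕ) : ℕ → Finset ℕ
  | 0 => ∅
  | n + 1 => S.incoming σ k (M - n) (State.outgoing σ k S M n)

theorem State.mem_incoming {σ : Finset Box} {k : ℕ} {S : State}
    (hsv : IsSetValuedTableau S.shape S.filling) {i : ℕ} {Y : Finset ℕ} {x : ℕ} :
    x ∈ S.incoming σ k i Y ↔ ∃ j, x ∈ S.history σ i Y j ∧ x ∉ S.initialRow σ k i Y j := by
  simp only [State.incoming, Finset.mem_biUnion, Finset.mem_sdiff, Finset.mem_union, mem_rowCols,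
    Finset.mem_singleton]
  constructor
  · rintro ⟨j, -, h⟩
    exact ⟨j, h⟩
  · rintro ⟨j, h⟩
    refine ⟨j, ?_, h⟩
    rcases rowHistory_nonempty ⟨x, h.1⟩ with h' | ⟨h', -⟩
    · exact Or.inl ((hsv.nonempty_iff _).1 h')
    · exact Or.inr h'

/-- The data of a reversed step that ends in the state `S`. -/
structure Reversal (σ : Finset Box) (k : ℕ) (S : State) (M : ℕ) (T₀ Z : Box → Finset ℕ)
    (In Out : ℕ → Finset ℕ) : Prop where
  history : ∀ i j, Z (i, j) =
    rowHistory (fun j => S.filling (i, j)) (reverseCol σ S.shape i) (Out i) j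
  initial : ∀ i j, T₀ (i, j) =
    if i ≤ k then Z (i, j) else if S.aux (i, j) = k then ∅ else maxPart (Z (i, j))
  mem_in : ∀ i x, x ∈ In i ↔ ∃ j, x ∈ Z (i, j) ∧ x ∉ T₀ (i, j)
  link : ∀ i, In (i + 1) = Out i
  out_top : ∀ i, M ≤ i → Out i = ∅

/-- The recursion starts at a row `M` beyond the shape, where nothing leaves, and passes the labels
upwards row by row. -/
theorem exists_reversal (σ : Finset Box) (k : ℕ) {S : State}
    (hsv : IsSetValuedTableau S.shape S.filling) :
    ∃ M T₀ Z In Out, Reversal σ k S M T₀ Z In Out := by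
  obtain ⟨M, hM⟩ : ∃ M, S.shape.sup Prod.fst < M := ⟨_, Nat.lt_succ_self _⟩
  have hMs : ∀ b ∈ S.shape, b.1 < M := fun b hb =>
    (Finset.le_sup (f := Prod.fst) hb).trans_lt hM
  have hOutM : ∀ i, M ≤ i → S.outgoing σ k M (M - i) = ∅ := by
    intro i hi
    rw [Nat.sub_eq_zero_of_le hi]
    rfl
  refine ⟨M, fun b => S.initialRow σ k b.1 (S.outgoing σ k M (M - b.1)) b.2,
    fun b => S.history σ b.1 (S.outgoing σ k M (M - b.1)) b.2,
    fun i => S.incoming σ k i (S.outgoing σ k M (M - i)), fun i => S.outgoing σ k M (M - i),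
    fun i j => rfl, fun i j => rfl, fun i x => State.mem_incoming hsv, fun i => ?_, hOutM⟩
  rcases Nat.lt_or_ge i M with hi | hi
  · have h1 : M - i = M - (i + 1) + 1 := by omega
    have h2 : M - (M - (i + 1)) = i + 1 := by omega
    rw [h1, State.outgoing, h2]
  · rw [hOutM i hi, hOutM (i + 1) (by omega)]
    refine Finset.eq_empty_of_forall_notMem fun x hx => ?_
    obtain ⟨j, hj, -⟩ := (State.mem_incoming hsv).1 hx
    rcases mem_rowHistory.1 hj with hj | hj | hj
    · have := hMs _ ((hsv.nonempty_iff _).1 ⟨x, hj⟩)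
      simp only at this
      omega
    · simp at hj
    · simp at hj

/-- The boxes added in a reversed step. -/
def State.IsRestored (σ : Finset Box) (S : State) (Out : ℕ → Finset ℕ) (b : Box) : Prop :=
  b.2 = reverseCol σ S.shape b.1 ∧ ∃ y ∈ Out b.1, ∀ j', ∀ v ∈ S.filling (b.1, j'), y ≤ v

namespace Reversal

variable {σ : Finset Box} {k M : ℕ} {S : State} {t : Box → ℕ} {T₀ Z : Box → Finset ℕ}
  {In Out : ℕ → Finset ℕ}

theorem mem_history (h : Reversal σ k S M T₀ Z In Out) {i j x : ℕ} :
    x ∈ Z (i, j) ↔ x ∈ S.filling (i, j) ∨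
      (x ∈ Out i ∧ (∃ v ∈ S.filling (i, j), v < x) ∧ ∀ j' > j, ∀ v ∈ S.filling (i, j'), x ≤ v) ∨
      (x ∈ Out i ∧ j = reverseCol σ S.shape i ∧ ∀ j', ∀ v ∈ S.filling (i, j'), x ≤ v) := by
  rw [h.history]
  exact mem_rowHistory

theorem in_empty (h : Reversal σ k S M T₀ Z In Out) {i : ℕ} (hi : i ≤ k) : In i = ∅ := by
  refine Finset.eq_empty_of_forall_notMem fun x hx => ?_
  obtain ⟨j, hj, hj0⟩ := (h.mem_in i x).1 hx
  rw [h.initial, if_pos hi] at hj0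
  exact hj0 hj

theorem out_empty (h : Reversal σ k S M T₀ Z In Out) {i : ℕ} (hi : i < k) : Out i = ∅ := by
  rw [← h.link]
  exact h.in_empty hi

theorem bounds_of_mem (h : Reversal σ k S M T₀ Z In Out) {i y : ℕ} (hy : y ∈ Out i) :
    k ≤ i ∧ i < M := by
  constructor
  · by_contra hk
    simp [h.out_empty (not_le.1 hk)] at hy
  · by_contra hM
    simp [h.out_top i (not_lt.1 hM)] at hy

theorem pos_of_mem (h : Reversal σ k S M T₀ Z In Out)
    (hsv : IsSetValuedTableau S.shape S.filling) : ∀ d i, M ≤ i + d → ∀ y ∈ Out i, 0 < y := by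
  intro d
  induction d with
  | zero =>
    intro i hi y hy
    have := (h.bounds_of_mem hy).2
    omega
  | succ d ih =>
    intro i hi y hy
    rw [← h.link, h.mem_in] at hy
    obtain ⟨j, hj, -⟩ := hy
    rcases h.mem_history.1 hj with hj | hj | hj
    · exact hsv.pos _ y hj
    · exact ih (i + 1) (by omega) y hj.1
    · exact ih (i + 1) (by omega) y hj.1

theorem history_nonempty_iff (h : Reversal σ k S M T₀ Z In Out)
    (hsv : IsSetValuedTableau S.shape S.filling) (b : Box) :
    (Z b).Nonempty ↔ b ∈ S.shape ∨ S.IsRestored σ Out b := by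
  obtain ⟨i, j⟩ := b
  constructor
  · intro hb
    rw [h.history] at hb
    rcases rowHistory_nonempty hb with h' | h'
    · exact Or.inl ((hsv.nonempty_iff _).1 h')
    · exact Or.inr h'
  · rintro (hb | ⟨h1, y, hy, h2⟩)
    · obtain ⟨x, hx⟩ := (hsv.nonempty_iff _).2 hb
      exact ⟨x, h.mem_history.2 (Or.inl hx)⟩
    · exact ⟨y, h.mem_history.2 (Or.inr (Or.inr ⟨hy, h1, h2⟩))⟩

/-- Follow `y` into row `i + 1`, at column `j`. If that box now holds a label at most `y`, strict
columns prevent `(i, j)` from being in the shape, and since there is a box beneath, the free place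
is above `σ`. Otherwise `(i + 1, j)` is itself restored, and the place over it is free as well. -/
theorem exists_above_of_mem (hσ : IsSkewShape σ) (h : Reversal σ k S M T₀ Z In Out)
    (hext : Extends σ S.shape) (hsv : IsSetValuedTableau S.shape S.filling)
    (hss : IsSemistandard S.shape S.filling) :
    ∀ d i, M ≤ i + d → ∀ y ∈ Out i, (∀ j', ∀ v ∈ S.filling (i, j'), y ≤ v) →
      ∃ j, AboveRegion σ (i, j) ∧ (i, j) ∉ S.shape ∧
        ((i + 1, j) ∈ S.shape ∨ S.IsRestored σ Out (i + 1, j)) := by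
  have hs := fun b => hsv.nonempty_iff b
  intro d
  induction d with
  | zero =>
    intro i hi y hy
    have := (h.bounds_of_mem hy).2
    omega
  | succ d ih =>
    intro i hi y hy hle
    rw [← h.link, h.mem_in] at hy
    obtain ⟨j, hj, -⟩ := hy
    have hor : (∃ w ∈ S.filling (i + 1, j), w ≤ y) ∨ S.IsRestored σ Out (i + 1, j) := by
      rcases h.mem_history.1 hj with hj | ⟨-, ⟨v, hv, hvy⟩, -⟩ | ⟨h1, h2, h3⟩
      · exact Or.inl ⟨y, hj, le_rfl⟩
      · exact Or.inl ⟨v, hv, hvy.le⟩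
      · exact Or.inr ⟨h2, y, h1, h3⟩
    rcases hor with ⟨w, hw, hwy⟩ | hnew
    · have hjs := (hs _).1 ⟨w, hw⟩
      have hn : (i, j) ∉ S.shape := by
        intro hn
        obtain ⟨v, hv⟩ := (hs _).2 hn
        have h1 := hss.col i (i + 1) j hn hjs (Nat.lt_succ_self i) v hv w hw
        have h2 := hle j v hv
        omega
      refine ⟨j, ?_, hn, Or.inl hjs⟩
      have hc : InCols σ ((i, j) : Box).2 := hext.inCols (b := (i + 1, j)) hjs
      rcases hc.trichotomy with h' | h' | h'
      · exact h'
      · exact absurd (hext.subset h') hn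
      · exact absurd (hext.mem_of_below (b := (i, j)) hjs ⟨Nat.le_succ i, le_rfl⟩ h') hn
    · have hnew' := hnew
      obtain ⟨h1, y', hy', h2⟩ := hnew
      obtain ⟨q, hq, hqs, -⟩ := ih (i + 1) (by omega) y' hy' h2
      obtain ⟨h3, h4, -⟩ := reverseCol_spec hq hqs
      simp only at h1
      rw [← h1] at h3 h4
      refine ⟨j, h3.of_le hσ ⟨Nat.le_succ i, le_rfl⟩ h3.inCols, fun hn => ?_, Or.inr hnew'⟩
      exact h4 (hext.mem_of_above hn ⟨Nat.le_succ i, le_rfl⟩ h3)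

theorem restored_spec (hσ : IsSkewShape σ) (h : Reversal σ k S M T₀ Z In Out)
    (hext : Extends σ S.shape) (hsv : IsSetValuedTableau S.shape S.filling)
    (hss : IsSemistandard S.shape S.filling) {i j : ℕ} (hb : S.IsRestored σ Out (i, j)) :
    j = reverseCol σ S.shape i ∧ AboveRegion σ (i, j) ∧ (i, j) ∉ S.shape ∧ k ≤ i ∧ i < M ∧
      (∀ j', AboveRegion σ (i, j') → (i, j') ∉ S.shape → j' ≤ j) ∧
      ∃ j' ≤ j, (i + 1, j') ∈ S.shape ∨ S.IsRestored σ Out (i + 1, j') := by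
  obtain ⟨h1, y, hy, h2⟩ := hb
  simp only at h1 hy h2
  obtain ⟨q, hq, hqs, hqn⟩ := h.exists_above_of_mem hσ hext hsv hss M i (by omega) y hy h2
  obtain ⟨h3, h4, h5⟩ := reverseCol_spec hq hqs
  rw [← h1] at h3 h4 h5
  obtain ⟨h6, h7⟩ := h.bounds_of_mem hy
  exact ⟨h1, h3, h4, h6, h7, h5, q, h5 q hq hqs, hqn⟩

theorem left_of_restored (hσ : IsSkewShape σ) (h : Reversal σ k S M T₀ Z In Out)
    (hext : Extends σ S.shape) (hsv : IsSetValuedTableau S.shape S.filling)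
    (hss : IsSemistandard S.shape S.filling) {i j j' : ℕ} (hb : S.IsRestored σ Out (i, j))
    (hj' : (i, j') ∈ S.shape) : j < j' := by
  obtain ⟨-, h1, h2, -⟩ := h.restored_spec hσ hext hsv hss hb
  by_contra hlt
  exact h2 (hext.mem_of_above hj' ⟨le_rfl, not_lt.1 hlt⟩ h1)

/-- Each restored box has in the next row, weakly to its left, a box of the shape or another
restored box; induction down the rows covers everything further south-east above `σ`. -/
theorem closed_of_restored (hσ : IsSkewShape σ) (h : Reversal σ k S M T₀ Z In Out)
    (hext : Extends σ S.shape) (hsv : IsSetValuedTableau S.shape S.filling)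
    (hss : IsSemistandard S.shape S.filling) :
    ∀ d b, M ≤ b.1 + d → S.IsRestored σ Out b → ∀ c, b ≤ c → AboveRegion σ c →
      c ∈ S.shape ∨ S.IsRestored σ Out c := by
  intro d
  induction d with
  | zero =>
    rintro ⟨i, j⟩ hd hb
    have := (h.restored_spec hσ hext hsv hss hb).2.2.2.2.1
    simp only at hd
    omega
  | succ d ih =>
    rintro ⟨i, j⟩ hd hb ⟨i', j'⟩ ⟨hi, hj⟩ hc
    obtain ⟨-, h1, h2, -, -, h3, q, hqj, hq⟩ := h.restored_spec hσ hext hsv hss hb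
    simp only at hi hj hd
    rcases hi.eq_or_lt with rfl | hi
    · by_cases hcs : (i, j') ∈ S.shape
      · exact Or.inl hcs
      · have := h3 j' hc hcs
        have : j' = j := le_antisymm this hj
        subst this
        exact Or.inr hb
    · have hle : ((i + 1, q) : Box) ≤ (i', j') := ⟨hi, hqj.trans hj⟩
      rcases hq with hq | hq
      · exact Or.inl (hext.mem_of_above hq hle hc)
      · exact ih (i + 1, q) (by simp only; omega) hq _ hle hc

theorem row (hσ : IsSkewShape σ) (h : Reversal σ (k + 1) S M T₀ Z In Out) (hS : Core σ k S t)
    (i : ℕ) : RowFlow (fun j => T₀ (i, j)) (fun j => S.filling (i, j)) (fun j => Z (i, j))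
      (In i) (Out i) := by
  have hs := fun b => hS.sv.nonempty_iff b
  rw [show (fun j => Z (i, j)) = rowHistory (fun j => S.filling (i, j))
    (reverseCol σ S.shape i) (Out i) from funext (h.history i)]
  refine rowFlow_of_final (C := rowCols S.shape i) ?_ ?_ ?_ ?_ ?_ ?_
  · intro j j' hj x hx y hy
    exact hS.ss.row i j j' ((hs _).1 ⟨x, hx⟩) ((hs _).1 ⟨y, hy⟩) hj x hx y hy
  · rintro ⟨y, hy⟩ j
    have := (h.bounds_of_mem hy).1
    exact hS.single _ (by simp only; omega)
  · exact fun j hj => mem_rowCols.2 ((hs _).1 hj)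
  · rintro ⟨y, hy, hle⟩ j hj
    exact h.left_of_restored hσ hS.ext hS.sv hS.ss ⟨rfl, y, hy, hle⟩ ((hs _).1 hj)
  · intro j
    rw [h.initial, ← h.history]
    by_cases hik : i ≤ k + 1
    · exact Or.inl (if_pos hik)
    rw [if_neg hik]
    by_cases hu : S.aux (i, j) = k + 1
    -- Boxes with `aux` label `k + 1` are last in their rows: any further right would have a smaller
    -- label, whereas all labels exceed `k`.
    · right; right
      obtain ⟨hjs, hjb⟩ := (hS.aux_pos_iff (b := (i, j))).1 (by omega)
      refine ⟨if_pos hu, (hs _).2 hjs, fun j' hj' => ?_⟩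
      rw [hs] at hj'
      by_contra hlt
      have hjb' : BelowRegion σ (i, j') := hjb.of_le hσ ⟨le_rfl, (not_le.1 hlt).le⟩
        (hS.ext.inCols hj')
      have h1 := hS.aux_strict.row i j j' (mem_below.2 ⟨hjs, hjb⟩) (mem_below.2 ⟨hj', hjb'⟩)
        (not_le.1 hlt)
      have h2 := hS.aux_gt _ (hS.aux_pos_iff.2 ⟨hj', hjb'⟩)
      omega
    · exact Or.inr (Or.inl (if_neg hu))
  · intro x
    rw [h.mem_in]
    simp only [h.history]

theorem initial_nonempty_iff (h : Reversal σ (k + 1) S M T₀ Z In Out) (hS : Core σ k S t)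
    (b : Box) : (T₀ b).Nonempty ↔ (b ∈ S.shape ∨ S.IsRestored σ Out b) ∧ S.aux b ≠ k + 1 := by
  rw [← h.history_nonempty_iff hS.sv]
  obtain ⟨i, j⟩ := b
  rw [h.initial]
  by_cases hik : i ≤ k + 1
  · have h2 : S.aux (i, j) ≠ k + 1 := by
      intro h2
      have := hS.aux_bdd (i, j) ((hS.aux_tab _).1 (by omega))
      simp only at this
      omega
    rw [if_pos hik, and_iff_left h2]
  · rw [if_neg hik]
    by_cases hu : S.aux (i, j) = k + 1
    · simp [hu]
    · rw [if_neg hu, and_iff_left hu]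
      exact ⟨fun ⟨x, hx⟩ => ⟨x, (mem_maxPart.1 hx).1⟩, maxPart_nonempty⟩

/-- The shape before a step. -/
theorem exists_shape (hσ : IsSkewShape σ) (hcol : ColsConvex σ)
    (h : Reversal σ (k + 1) S M T₀ Z In Out) (hS : Core σ k S t) :
    ∃ s₀, (∀ b, b ∈ s₀ ↔ (b ∈ S.shape ∨ S.IsRestored σ Out b) ∧ S.aux b ≠ k + 1) ∧
      (∀ b, AboveRegion σ b → (b ∈ s₀ ↔ b ∈ S.shape ∨ S.IsRestored σ Out b)) ∧
      (∀ b, BelowRegion σ b → (b ∈ s₀ ↔ b ∈ S.shape ∧ S.aux b ≠ k + 1)) ∧ Extends σ s₀ := by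
  classical
  have hNew := fun i j => h.restored_spec (i := i) (j := j) hσ hS.ext hS.sv hS.ss
  have haux_above : ∀ b, AboveRegion σ b → S.aux b = 0 := by
    intro b hb
    have := mt hS.aux_pos_iff.1 (fun h' => hb.not_belowRegion hσ h'.2)
    omega
  obtain ⟨s₀, hs₀⟩ : ∃ s₀ : Finset Box, ∀ b, b ∈ s₀ ↔
      (b ∈ S.shape ∨ S.IsRestored σ Out b) ∧ S.aux b ≠ k + 1 := by
    refine ⟨(S.shape ∪ Finset.range M ×ˢ σ.image Prod.snd).filter fun b =>
      (b ∈ S.shape ∨ S.IsRestored σ Out b) ∧ S.aux b ≠ k + 1, ?_⟩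
    rintro ⟨i, j⟩
    rw [Finset.mem_filter, and_iff_right_iff_imp]
    rintro ⟨hb | hb, -⟩
    · exact Finset.mem_union_left _ hb
    · obtain ⟨-, h1, -, -, h2, -⟩ := hNew i j hb
      obtain ⟨a, ha, haj⟩ := h1.inCols
      exact Finset.mem_union_right _ (Finset.mem_product.2
        ⟨Finset.mem_range.2 h2, Finset.mem_image.2 ⟨a, ha, haj⟩⟩)
  have hs₀above : ∀ b, AboveRegion σ b → (b ∈ s₀ ↔ b ∈ S.shape ∨ S.IsRestored σ Out b) := by
    intro b hb
    rw [hs₀, haux_above b hb]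
    simp
  have hs₀below : ∀ b, BelowRegion σ b → (b ∈ s₀ ↔ b ∈ S.shape ∧ S.aux b ≠ k + 1) := by
    intro b hb
    rw [hs₀]
    refine and_congr_left fun _ => or_iff_left fun hn => ?_
    exact (hNew b.1 b.2 hn).2.1.not_belowRegion hσ hb
  refine ⟨s₀, hs₀, hs₀above, hs₀below, extends_of_closed hσ hcol ?_ ?_ ?_ ?_ ?_⟩
  · rintro ⟨i, j⟩ hb
    rcases ((hs₀ _).1 hb).1 with hb | hb
    · exact hS.ext.isSkewShape.pos _ hb
    · obtain ⟨-, h1, -, h2, -⟩ := hNew i j hb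
      obtain ⟨a, ha, haj⟩ := h1.inCols
      exact ⟨by simp only; omega, haj ▸ (hσ.pos a ha).2⟩
  · intro b hb
    refine (hs₀ b).2 ⟨Or.inl (hS.ext.subset hb), fun h1 => ?_⟩
    exact (hS.aux_pos_iff.1 (show 0 < S.aux b by omega)).2.1 hb
  · rintro ⟨i, j⟩ hb
    rcases ((hs₀ _).1 hb).1 with hb | hb
    · exact hS.ext.inCols hb
    · exact (hNew i j hb).2.1.inCols
  · intro b c hb hb' hbc hc
    rw [hs₀above c hc]
    rcases (hs₀above b hb').1 hb with hb | hb
    · exact Or.inl (hS.ext.mem_of_above hb hbc hc)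
    · exact h.closed_of_restored hσ hS.ext hS.sv hS.ss M b (by omega) hb c hbc hc
  · intro b c hc hc' hbc hb
    obtain ⟨h1, h2⟩ := (hs₀below c hc').1 hc
    refine (hs₀below b hb).2 ⟨hS.ext.mem_of_below h1 hbc hb, ?_⟩
    -- The removed boxes carry the smallest `aux` label, so anything north-west of a surviving box
    -- survives.
    have h3 := hS.aux_anti hσ hb h1 hbc
    have h4 := hS.aux_gt c (hS.aux_pos_iff.2 ⟨h1, hc'⟩)
    omega

theorem semistandard (hσ : IsSkewShape σ) (h : Reversal σ (k + 1) S M T₀ Z In Out)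
    (hS : Core σ k S t) {s₀ : Finset Box}
    (hs₀ : ∀ b, b ∈ s₀ ↔ (b ∈ S.shape ∨ S.IsRestored σ Out b) ∧ S.aux b ≠ k + 1)
    (hext : Extends σ s₀) (hsv₀ : IsSetValuedTableau s₀ T₀) : IsSemistandard s₀ T₀ := by
  have hs := fun b => hS.sv.nonempty_iff b
  have hrow := h.row hσ hS
  have hNew := fun i j => h.restored_spec (i := i) (j := j) hσ hS.ext hS.sv hS.ss
  have hor : ∀ b ∈ s₀, b ∈ S.shape ∨ S.IsRestored σ Out b := fun b hb => ((hs₀ b).1 hb).1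
  refine IsSemistandard.of_succ hext.isSkewShape hsv₀ ?_ fun m => ?_
  · intro i j j' hj x hx y hy
    exact (hrow i).mono j j' hj x ((hrow i).sub0 j x hx) y ((hrow i).sub0 j' y hy)
  have h2 := hrow (m + 1)
  rw [h.link m] at h2
  refine (hrow m).col_lt' h2 ?_ ?_ ?_
  · intro j x hx y hy
    exact hS.ss.col m (m + 1) j ((hs _).1 ⟨x, hx⟩) ((hs _).1 ⟨y, hy⟩) (Nat.lt_succ_self m) x hx y hy
  · intro j hj hj'
    rw [hs] at hj' ⊢
    rw [hsv₀.nonempty_iff] at hj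
    rcases hor _ hj with hj | hj
    · exact hj
    · exact hS.ext.mem_of_above hj' ⟨Nat.le_succ m, le_rfl⟩ (hNew _ _ hj).2.1
  · intro j j' hjj' hj1 hj2 hj3
    rw [hs] at hj1 ⊢
    rw [hsv₀.nonempty_iff] at hj2 hj3
    have hc : InCols σ ((m, j') : Box).2 := hS.ext.inCols (b := (m + 1, j')) hj1
    rcases hc.trichotomy with h' | h' | h'
    -- If `(m, j')` were restored, it would be left of every box of `S` in its row and the only
    -- restored one there, so `(m, j)` could not exist.
    · have h3 : (m, j') ∈ s₀ := hext.mem_of_above (c := (m, j')) hj3 ⟨le_rfl, hjj'.le⟩ h'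
      rcases hor _ h3 with h4 | h4
      · exact h4
      · rcases hor _ hj3 with h5 | h5
        · have := h.left_of_restored hσ hS.ext hS.sv hS.ss h4 h5
          omega
        · have h6 := (hNew _ _ h4).1
          have h7 := (hNew _ _ h5).1
          omega
    · exact hS.ext.subset h'
    · exact hS.ext.mem_of_below (b := (m, j')) hj1 ⟨Nat.le_succ m, le_rfl⟩ h'

end Reversal

/-- Every state that can occur after a step comes from a state before it. -/
theorem Core.exists_initial {σ : Finset Box} (hσ : IsSkewShape σ) (hcol : ColsConvex σ) {k : ℕ}
    {S : State} {t : Box → ℕ} (h : Core σ k S t) :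
    ∃ S₀ t₀ Z In Out, Core σ (k + 1) S₀ t₀ ∧ Flow (k + 1) S₀ S t₀ t Z In Out := by
  classical
  obtain ⟨M, T₀, Z, In, Out, hR⟩ := exists_reversal σ (k + 1) h.sv
  have hrow := hR.row hσ h
  have hNew := fun i j => hR.restored_spec (i := i) (j := j) hσ h.ext h.sv h.ss
  have hleft := fun i j j' => hR.left_of_restored (i := i) (j := j) (j' := j') hσ h.ext h.sv h.ss
  obtain ⟨s₀, hs₀, hs₀above, hs₀below, hext⟩ := hR.exists_shape hσ hcol h
  have hsv₀ : IsSetValuedTableau s₀ T₀ := by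
    refine ⟨fun b => by rw [hR.initial_nonempty_iff h, hs₀], ?_⟩
    rintro ⟨i, j⟩ x hx
    rcases hR.mem_history.1 ((hrow i).sub0 j x hx) with h1 | h1 | h1
    · exact h.sv.pos _ x h1
    · exact hR.pos_of_mem h.sv M i (by omega) x h1.1
    · exact hR.pos_of_mem h.sv M i (by omega) x h1.1
  have hss₀ := hR.semistandard hσ h hs₀ hext hsv₀
  have hsingle : ∀ b : Box, k + 1 < b.1 → (T₀ b).card ≤ 1 := by
    rintro ⟨i, j⟩ hb
    rw [hR.initial, if_neg (not_le.2 hb)]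
    split_ifs
    · simp
    · exact card_maxPart_le_one _
  have hlink := hR.link
  have hin_empty : ∀ i ≤ k + 1, In i = ∅ := fun i hi => hR.in_empty hi
  clear hR
  generalize S.IsRestored σ Out = New at *
  -- Restored boxes get the label `k + 1`, which exceeds all of `t`; being leftmost in their rows,
  -- they keep the rows strict.
  set t₀ : Box → ℕ := fun b => if New b then k + 1 else t b with ht₀
  have ht_new : ∀ b, New b → t₀ b = k + 1 := fun b hb => by simp only [ht₀, if_pos hb]
  have hnot_new : ∀ b ∈ S.shape, ¬ New b := fun b hb hn => (hNew b.1 b.2 hn).2.2.1 hb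
  have ht_old : ∀ b ∈ S.shape, t₀ b = t b := fun b hb => by
    simp only [ht₀, if_neg (hnot_new b hb)]
  have ht_le : ∀ b, t₀ b ≤ k + 1 := by
    intro b
    simp only [ht₀]
    have := h.t_le b
    split_ifs <;> omega
  have ht_zero : ∀ b ∉ S.shape, t b = 0 := by
    intro b hb
    have := mt h.t_pos_iff.1 (fun h' => hb h'.1)
    omega
  have habove₀ : ∀ b, b ∈ above σ s₀ ↔ AboveRegion σ b ∧ (b ∈ S.shape ∨ New b) := by
    intro b
    rw [mem_above, and_comm]
    exact and_congr_right fun hb => hs₀above b hb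
  set u₀ : Box → ℕ := fun b => if S.aux b = k + 1 then 0 else S.aux b with hu₀
  have hbelow₀ : ∀ b, b ∈ below σ s₀ → b ∈ below σ S.shape ∧ u₀ b = S.aux b := by
    intro b hb
    obtain ⟨h1, h2⟩ := mem_below.1 hb
    obtain ⟨h3, h4⟩ := (hs₀below b h2).1 h1
    exact ⟨mem_below.2 ⟨h3, h2⟩, by simp only [hu₀, if_neg h4]⟩
  refine ⟨⟨s₀, T₀, u₀⟩, t₀, Z, In, Out, ⟨hext, fun b => ?_, ⟨fun i j j' hj hj' hlt => ?_,
    fun i i' j hi hi' hlt => ?_⟩, ?_, ht_le, fun b => ?_, ⟨fun i j j' hj hj' hlt => ?_,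
    fun i i' j hi hi' hlt => ?_⟩, fun b hb => ?_, fun b hb => ?_, hsv₀, hss₀, hsingle⟩,
    ⟨hrow, hlink, hin_empty, fun b => ?_, fun b => rfl⟩⟩
  · rw [habove₀]
    by_cases hb : New b
    · rw [ht_new b hb]
      simp [hb, (hNew b.1 b.2 hb).2.1]
    · simp only [ht₀, if_neg hb, hb, or_false]
      rw [h.t_pos_iff, and_comm]
  · obtain ⟨h1, h2⟩ := (habove₀ _).1 hj
    obtain ⟨h3, h4⟩ := (habove₀ _).1 hj'
    rcases h4 with h4 | h4
    · rw [ht_old _ h4]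
      rcases h2 with h2 | h2
      · rw [ht_old _ h2]
        exact h.t_strict.row i j j' (mem_above.2 ⟨h2, h1⟩) (mem_above.2 ⟨h4, h3⟩) hlt
      · rw [ht_new _ h2]
        exact Nat.lt_succ_of_le (h.t_le _)
    · rcases h2 with h2 | h2
      · have := hleft i j' j h4 h2
        omega
      · have h6 := (hNew _ _ h4).1
        have h7 := (hNew _ _ h2).1
        omega
  · obtain ⟨h1, h2⟩ := (habove₀ _).1 hi
    obtain ⟨h3, h4⟩ := (habove₀ _).1 hi'
    rcases h2 with h2 | h2
    · have h5 : (i', j) ∈ S.shape := h.ext.mem_of_above h2 ⟨hlt.le, le_rfl⟩ h3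
      rw [ht_old _ h2, ht_old _ h5]
      exact h.t_strict.col i i' j (mem_above.2 ⟨h2, h1⟩) (mem_above.2 ⟨h5, h3⟩) hlt
    · rw [ht_new _ h2]
      exact ht_le _
  · rintro ⟨i, j⟩ hb
    obtain ⟨h1, h2⟩ := (habove₀ _).1 hb
    rcases h2 with h2 | h2
    · rw [ht_old _ h2]
      exact h.t_bdd _ (mem_above.2 ⟨h2, h1⟩)
    · rw [ht_new _ h2]
      -- Labels leave only rows from `k + 1` on, which is the weak row bound.
      exact (hNew i j h2).2.2.2.1
  · rw [mem_below]
    constructor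
    · intro hb
      have h1 : S.aux b ≠ k + 1 := fun h1 => by simp only [hu₀, if_pos h1] at hb; omega
      simp only [hu₀, if_neg h1] at hb
      obtain ⟨h2, h3⟩ := h.aux_pos_iff.1 hb
      exact ⟨(hs₀below b h3).2 ⟨h2, h1⟩, h3⟩
    · intro hb
      obtain ⟨h1, h2⟩ := hbelow₀ b (mem_below.2 hb)
      simp only [h2]
      exact (h.aux_tab b).2 h1
  · simp only [(hbelow₀ _ hj).2, (hbelow₀ _ hj').2]
    exact h.aux_strict.row i j j' (hbelow₀ _ hj).1 (hbelow₀ _ hj').1 hlt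
  · simp only [(hbelow₀ _ hi).2, (hbelow₀ _ hi').2]
    exact h.aux_strict.col i i' j (hbelow₀ _ hi).1 (hbelow₀ _ hi').1 hlt
  · simp only [(hbelow₀ _ hb).2]
    exact h.aux_bdd b (hbelow₀ _ hb).1
  · have h1 : S.aux b ≠ k + 1 := fun h1 => by simp only [hu₀, if_pos h1] at hb; omega
    simp only [hu₀, if_neg h1] at hb ⊢
    have := h.aux_gt b hb
    omega
  · by_cases hb : New b
    · rw [if_pos (ht_new b hb)]
      exact ht_zero b (hNew b.1 b.2 hb).2.2.1
    · have := h.t_le b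
      simp only [ht₀, if_neg hb]
      rw [if_neg (by omega)]

end SkewInsertion

namespace SkewInsertion

/-! ### Composing the steps -/

/-- The pairs of a state before step `k` and a tableau of the boxes still to be swept out, with
prescribed content and total excess. -/
structure Stage (σ : Finset Box) (c e : ℕ → ℕ) (k : ℕ) (p : State × (Box → ℕ)) : Prop where
  core : Core σ k p.1 p.2
  content : ∀ v, svContent p.1.shape p.1.filling v = c v
  total : ∀ m, totalExcess σ p.1.shape p.1.filling p.1.aux p.2 m = e m

/-- Step `k` of the algorithm, together with its effect on the boxes still to be swept out. -/
def stepMap (σ : Finset Box) (k : ℕ) (p : State × (Box → ℕ)) : State × (Box → ℕ) :=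
  (State.step (lastRow σ) k p.2 p.1, dropLabel k p.2)

theorem bijOn_stepMap {σ : Finset Box} (hσ : IsSkewShape σ) (hcol : ColsConvex σ) (c e : ℕ → ℕ)
    (k : ℕ) :
    Set.BijOn (stepMap σ (k + 1)) {p | Stage σ c e (k + 1) p} {p | Stage σ c e k p} := by
  refine ⟨?_, ?_, ?_⟩
  · rintro ⟨S, t⟩ h
    obtain ⟨h1, -, h3, h4⟩ := h.core.step hσ hcol
    exact ⟨h1, fun v => (h3 v).trans (h.content v), fun m => (h4 m).trans (h.total m)⟩
  · rintro ⟨S, t⟩ h ⟨S', t'⟩ h' heq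
    obtain ⟨h1, ⟨Z, In, Out, h2⟩, -⟩ := h.core.step hσ hcol
    obtain ⟨h1', ⟨Z', In', Out', h2'⟩, -⟩ := h'.core.step hσ hcol
    simp only [stepMap, Prod.mk.injEq] at heq
    simp only at h2 h2' h1'
    rw [← heq.1, ← heq.2] at h2'
    obtain ⟨h3, h4⟩ := h2.initial_unique h.core h'.core h1 h2'
    simp only at h3 h4
    rw [h3, h4]
  · rintro ⟨S, t⟩ h
    obtain ⟨S₀, t₀, Z, In, Out, h1, h2⟩ := h.core.exists_initial hσ hcol
    obtain ⟨h3, ⟨Z', In', Out', h4⟩, h5, h6⟩ := h1.step hσ hcol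
    -- The actual step and the constructed flow start at the same state, so they end at the same
    -- state.
    obtain ⟨h7, h8⟩ := h4.final_unique h1 h3 h.core h2
    rw [h7] at h5
    rw [h7, h8] at h6
    refine ⟨(S₀, t₀), ⟨h1, fun v => (h5 v).symm.trans (h.content v),
      fun m => (h6 m).symm.trans (h.total m)⟩, ?_⟩
    simp only [stepMap]
    rw [h7, h8]

/-- The steps `k, k - 1, …, 1`. -/
def runMap (σ : Finset Box) : ℕ → State × (Box → ℕ) → State × (Box → ℕ)
  | 0 => id
  | k + 1 => runMap σ k ∘ stepMap σ (k + 1)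

theorem bijOn_runMap {σ : Finset Box} (hσ : IsSkewShape σ) (hcol : ColsConvex σ) (c e : ℕ → ℕ)
    (k : ℕ) : Set.BijOn (runMap σ k) {p | Stage σ c e k p} {p | Stage σ c e 0 p} := by
  induction k with
  | zero => exact Set.bijOn_id _
  | succ k ih => exact ih.comp (bijOn_stepMap hσ hcol c e k)

theorem State.sweepBoxes_congr {T' t : Box → ℕ} {k : ℕ} (h : ∀ b, T' b = k ↔ t b = k) (r : ℕ) :
    State.sweepBoxes T' r k = State.sweepBoxes t r k := by
  have : State.sweepBox T' k = State.sweepBox t k := by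
    funext S i
    unfold State.sweepBox
    simp only [h]
  unfold State.sweepBoxes
  rw [this]

/-- The algorithm consults the original `T'` throughout, whereas `runMap` zeroes labels as they are
processed. Step `m` sees only the label `m > 0`, on which both agree. -/
theorem runMap_fst (σ : Finset Box) (T' : Box → ℕ) (k : ℕ) (S : State) (t : Box → ℕ)
    (h : ∀ b m, 0 < m → m ≤ k → (T' b = m ↔ t b = m)) :
    (runMap σ k (S, t)).1 = State.run T' (lastRow σ) k S := by
  induction k generalizing S t with
  | zero => rfl
  | succ k ih =>
    rw [State.run, State.sweepBoxes_congr (fun b => h b (k + 1) (Nat.succ_pos k) le_rfl)]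
    refine ih _ _ fun b m hm hmk => ?_
    rw [h b m hm (by omega)]
    show t b = m ↔ (if t b = k + 1 then 0 else t b) = m
    split_ifs <;> omega

theorem bijOn_inputs {σ : Finset Box} (hσ : IsSkewShape σ) (c e : ℕ → ℕ) :
    Set.BijOn (fun p : Triple => ((⟨p.1, p.2.2, fun _ => 0⟩ : State), p.2.1)) (inputs σ c e)
      {p | Stage σ c e (lastRow σ) p} := by
  have hlast : ∀ a ∈ σ, a.1 ≤ lastRow σ := fun a ha => Finset.le_sup (f := Prod.fst) ha
  refine ⟨?_, ?_, ?_⟩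
  · rintro ⟨l, T', T⟩ ⟨⟨h1, h2, h3, h4, h5⟩, h6, h7, h8, h9⟩
    simp only at h1 h2 h3 h4 h5 h6 h7 h8 h9
    have hnot : ∀ b ∈ l, ¬ BelowRegion σ b := by
      intro b hb hb'
      have := mem_below.2 ⟨hb, hb'⟩
      simp [h2] at this
    refine ⟨⟨h1, h3, h4, h5, fun b => ?_, fun b => ?_, ?_, ?_, ?_, h6, h7, fun b hb => ?_⟩, h8,
      fun m => ?_⟩
    · by_contra hb
      have hmem := (h3 b).1 (show 0 < T' b by simp only at hb; omega)
      obtain ⟨a, ha, -, hlt⟩ := (mem_above.1 hmem).2.2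
      have := h5 b hmem
      have := hlast a ha
      simp only at hb
      omega
    · simp [h2]
    · simp only [h2]
      exact ⟨fun i j j' hj => absurd hj (Finset.notMem_empty _),
        fun i i' j hj => absurd hj (Finset.notMem_empty _)⟩
    · simp only [h2]
      exact fun b hb => absurd hb (Finset.notMem_empty _)
    · exact fun b hb => absurd hb (lt_irrefl 0)
    · have : ¬ (T b).Nonempty := by
        rw [h6.nonempty_iff]
        intro hbl
        obtain ⟨a, ha, hab⟩ := h1.inCols hbl
        have := hlast a ha
        refine hnot b hbl ⟨fun hbσ => ?_, a, ha, hab, by omega⟩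
        have := hlast b hbσ
        omega
      rw [Finset.not_nonempty_iff_eq_empty] at this
      simp [this]
    · simp only [totalExcess, h9, reducedExcess, h2]
      simp [content]
  · rintro ⟨l, T', T⟩ - ⟨m, U', U⟩ - heq
    simp only [Prod.mk.injEq, State.mk.injEq] at heq
    obtain ⟨⟨rfl, rfl, -⟩, rfl⟩ := heq
    rfl
  · rintro ⟨S, t⟩ ⟨h, hc, he⟩
    simp only at h hc he
    -- The first box under `σ` in a column is in a row at most `lastRow σ + 1`, so its `aux` label
    -- would be at most `lastRow σ` by the row bound and greater than it by `aux_gt`.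
    have hbelow : below σ S.shape = ∅ := by
      refine Finset.eq_empty_of_forall_notMem fun b hb => ?_
      obtain ⟨hb, hb'⟩ := mem_below.1 hb
      obtain ⟨hbσ, a, ha, hab, hlt⟩ := hb'
      obtain ⟨m, hm, hmax⟩ := Finset.exists_max_image (σ.filter fun a => a.2 = b.2) Prod.fst
        ⟨a, Finset.mem_filter.2 ⟨ha, hab⟩⟩
      obtain ⟨hm, hmb⟩ := Finset.mem_filter.1 hm
      have hcσ : ((m.1 + 1, b.2) : Box) ∉ σ := by
        intro hc
        have := hmax _ (Finset.mem_filter.2 ⟨hc, rfl⟩)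
        simp only at this
        omega
      have hbr : BelowRegion σ (m.1 + 1, b.2) := ⟨hcσ, m, hm, hmb, Nat.lt_succ_self _⟩
      have hmlt : m.1 < b.1 := by
        by_contra hle
        exact hbσ (hσ.mem_of_le_of_le ha hm ⟨hlt.le, hab.le⟩ ⟨not_lt.1 hle, hmb.ge⟩)
      have hcs := h.ext.mem_of_below (b := (m.1 + 1, b.2)) hb ⟨hmlt, le_rfl⟩ hbr
      have h1 := h.aux_bdd _ (mem_below.2 ⟨hcs, hbr⟩)
      have h2 := h.aux_gt _ (h.aux_pos_iff.2 ⟨hcs, hbr⟩)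
      have h3 := hlast m hm
      simp only at h1
      omega
    have haux : S.aux = fun _ => 0 := by
      funext b
      have := mt (h.aux_tab b).1 (by simp [hbelow])
      omega
    refine ⟨(S.shape, t, S.filling), ⟨⟨h.ext, hbelow, h.t_tab, h.t_strict, h.t_bdd⟩, h.sv, h.ss, hc,
      fun m => ?_⟩, ?_⟩
    · have := he m
      simp only [totalExcess, hbelow] at this
      simp only [reducedExcess]
      rw [← this]
      simp [content]
    · simp only
      rw [← haux]

/-- At `k = 0` there is no label left for `t`, hence nothing above `σ`. All rows are singly
labelled, so the excess vanishes and `totalExcess` is the content of `aux`. -/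
theorem bijOn_outputs {σ : Finset Box} (c e : ℕ → ℕ) :
    Set.BijOn (fun p : State × (Box → ℕ) => ((p.1.shape, p.1.aux, p.1.filling) : Triple))
      {p | Stage σ c e 0 p} (outputs σ c e) := by
  refine ⟨?_, ?_, ?_⟩
  · rintro ⟨S, t⟩ ⟨h, hc, he⟩
    simp only at h hc he
    have habove : above σ S.shape = ∅ := by
      refine Finset.eq_empty_of_forall_notMem fun b hb => ?_
      have h1 := (h.t_tab b).2 hb
      have h2 := h.t_le b
      omega
    have hexc : ∀ m, excess S.shape S.filling m = 0 := fun m => excess_eq_zero fun b hb _ =>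
      h.sv.card_eq_one hb (h.single b (h.ext.isSkewShape.pos b hb).1)
    refine ⟨⟨h.ext, habove, h.aux_tab, h.aux_strict, h.aux_bdd, fun m => ?_⟩, h.sv, h.ss, hc, hexc⟩
    have := he m
    rw [totalExcess, hexc, habove] at this
    simpa [content] using this
  · rintro ⟨S, t⟩ h ⟨S', t'⟩ h' heq
    simp only [Prod.mk.injEq] at heq
    have h1 : t = t' := funext fun b => by
      have h1 := h.core.t_le b
      have h2 := h'.core.t_le b
      simp only at h1 h2
      omega
    subst h1
    cases S
    cases S'
    simp only at heq
    obtain ⟨rfl, rfl, rfl⟩ := heq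
    rfl
  · rintro ⟨m, u, T⟩ ⟨⟨h1, h2, h3, h4, h5, h6⟩, h7, h8, h9, h10⟩
    simp only at h1 h2 h3 h4 h5 h6 h7 h8 h9 h10
    refine ⟨(⟨m, T, u⟩, fun _ => 0), ⟨⟨h1, fun b => ?_, ?_, ?_, fun b => le_rfl, h3, h4, h5,
      fun b hb => hb, h7, h8, ?_⟩, h9, fun i => ?_⟩, rfl⟩
    · simp [h2]
    · simp only [h2]
      exact ⟨fun i j j' hj => absurd hj (Finset.notMem_empty _),
        fun i i' j hj => absurd hj (Finset.notMem_empty _)⟩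
    · simp only [h2]
      exact fun b hb => absurd hb (Finset.notMem_empty _)
    · rintro ⟨i, j⟩ -
      have h11 := sum_rowCols_eq_excess h7 i
      rw [h10, Nat.cast_eq_zero] at h11
      by_cases hj : (i, j) ∈ m
      · have := Finset.sum_eq_zero_iff.1 h11 j (mem_rowCols.2 hj)
        simp only
        omega
      · have : ¬ (T (i, j)).Nonempty := fun h => hj ((h7.nonempty_iff _).1 h)
        rw [Finset.not_nonempty_iff_eq_empty] at this
        simp [this]
    · simp only [totalExcess, h10, h2, h6]
      simp [content]

theorem bijOn_algorithm {σ : Finset Box} (hσ : IsSkewShape σ) (hcol : ColsConvex σ)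
    (c e : ℕ → ℕ) : Set.BijOn (algorithm σ) (inputs σ c e) (outputs σ c e) := by
  refine ((bijOn_outputs c e).comp
    ((bijOn_runMap hσ hcol c e (lastRow σ)).comp (bijOn_inputs hσ c e))).congr fun p _ => ?_
  have := runMap_fst σ p.2.1 (lastRow σ) ⟨p.1, p.2.2, fun _ => 0⟩ p.2.1 (fun _ _ _ _ => Iff.rfl)
  simp only [Function.comp, algorithm]
  rw [this]

/-! ### Finiteness -/

theorem finite_functions {β : Type*} (D : Finset Box) {V : Set β} (hV : V.Finite) (d : β) :
    {f : Box → β | (∀ b ∈ D, f b ∈ V) ∧ ∀ b ∉ D, f b = d}.Finite := by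
  refine Set.Finite.of_injOn (f := fun f (b : D) => f b) (t := Set.univ.pi fun _ => V) ?_ ?_
    (Set.Finite.pi fun _ => hV)
  · rintro f ⟨hf, -⟩ b -
    exact hf b b.2
  · rintro f ⟨-, hf⟩ g ⟨-, hg⟩ hfg
    funext b
    by_cases hb : b ∈ D
    · exact congrFun hfg ⟨b, hb⟩
    · rw [hf b hb, hg b hb]

theorem finite_pairs (D : Finset Box) (N : ℕ) {P : Set (Finset Box × (Box → ℕ))}
    (hP : ∀ p ∈ P, p.1 ⊆ D ∧ ∀ b, p.2 b ≤ N ∧ (0 < p.2 b → b ∈ D)) : P.Finite := by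
  refine Set.Finite.subset ((D.powerset.finite_toSet).prod
    (finite_functions D (Set.finite_Iic N) 0)) fun p hp => ?_
  obtain ⟨h1, h2⟩ := hP p hp
  refine ⟨Finset.mem_coe.2 (Finset.mem_powerset.2 h1), fun b _ => (h2 b).1, fun b hb => ?_⟩
  by_contra hne
  exact hb ((h2 b).2 (Nat.pos_of_ne_zero hne))

theorem inputPairs_finite (σ : Finset Box) : (inputPairs σ).Finite := by
  have hlast : ∀ a ∈ σ, a.1 ≤ lastRow σ := fun a ha => Finset.le_sup (f := Prod.fst) ha
  refine finite_pairs (Finset.range (lastRow σ + 1) ×ˢ σ.image Prod.snd) (lastRow σ) ?_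
  rintro ⟨l, t⟩ ⟨h1, h2, h3, h4, h5⟩
  simp only at h1 h2 h3 h4 h5 ⊢
  have hsub : l ⊆ Finset.range (lastRow σ + 1) ×ˢ σ.image Prod.snd := by
    intro b hb
    obtain ⟨a, ha, hab⟩ := h1.inCols hb
    refine Finset.mem_product.2 ⟨Finset.mem_range.2 ?_, Finset.mem_image.2 ⟨a, ha, hab⟩⟩
    by_contra hlt
    have h6 := hlast a ha
    have h7 : BelowRegion σ b := ⟨fun hbσ => hlt (Nat.lt_succ_of_le (hlast b hbσ)), a, ha, hab,
      by omega⟩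
    have := mem_below.2 ⟨hb, h7⟩
    simp [h2] at this
  refine ⟨hsub, fun b => ?_⟩
  by_cases hb : 0 < t b
  · have hmem := (h3 b).1 hb
    have hbD := hsub (mem_above.1 hmem).1
    refine ⟨(h5 b hmem).trans ?_, fun _ => hbD⟩
    exact Nat.le_of_lt_succ (Finset.mem_range.1 (Finset.mem_product.1 hbD).1)
  · exact ⟨by omega, fun h => absurd h hb⟩

/-- Weakly decreasing columns and the bound on the first box under `σ` keep all labels at most
`lastRow σ`, so the number of boxes below `σ` is a partial sum `N` of `e`. No column can then
descend more than `N` rows past `lastRow σ`. -/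
theorem outputPairs_finite {σ : Finset Box} (hσ : IsSkewShape σ) (e : ℕ → ℕ) :
    (outputPairs σ e).Finite := by
  have hlast : ∀ a ∈ σ, a.1 ≤ lastRow σ := fun a ha => Finset.le_sup (f := Prod.fst) ha
  set N := ∑ m ∈ Finset.range (lastRow σ + 1), e m with hN
  refine finite_pairs (Finset.range (lastRow σ + N + 1) ×ˢ σ.image Prod.snd) (lastRow σ) ?_
  rintro ⟨l, u⟩ ⟨h1, h2, h3, h4, h5, h6⟩
  simp only at h1 h2 h3 h4 h5 h6 ⊢
  have hle : ∀ b ∈ below σ l, u b ≤ lastRow σ := by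
    intro b hb
    obtain ⟨hbl, hb'⟩ := mem_below.1 hb
    obtain ⟨hbσ, a, ha, hab, hlt⟩ := hb'
    obtain ⟨m, hm, hmax⟩ := Finset.exists_max_image (σ.filter fun a => a.2 = b.2) Prod.fst
      ⟨a, Finset.mem_filter.2 ⟨ha, hab⟩⟩
    obtain ⟨hm, hmb⟩ := Finset.mem_filter.1 hm
    have hcσ : ((m.1 + 1, b.2) : Box) ∉ σ := by
      intro hc
      have := hmax _ (Finset.mem_filter.2 ⟨hc, rfl⟩)
      simp only at this
      omega
    have hbr : BelowRegion σ (m.1 + 1, b.2) := ⟨hcσ, m, hm, hmb, Nat.lt_succ_self _⟩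
    have hmlt : m.1 < b.1 := by
      by_contra hle
      exact hbσ (hσ.mem_of_le_of_le ha hm ⟨hlt.le, hab.le⟩ ⟨not_lt.1 hle, hmb.ge⟩)
    have hcs := mem_below.2
      ⟨h1.mem_of_below (b := (m.1 + 1, b.2)) hbl ⟨hmlt, le_rfl⟩ hbr, hbr⟩
    have h7 := h5 _ hcs
    have h8 := hlast m hm
    have h9 : u b ≤ u (m.1 + 1, b.2) := by
      rcases (Nat.succ_le_of_lt hmlt).eq_or_lt with h9 | h9
      · exact le_of_eq (congrArg u (Prod.ext h9.symm rfl))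
      · exact h4.col _ _ _ hcs hb h9
    simp only at h7
    omega
  have hcard : (below σ l).card = N := by
    rw [hN, Finset.card_eq_sum_card_fiberwise (f := u) (t := Finset.range (lastRow σ + 1))
      (fun b hb => Finset.mem_coe.2 (Finset.mem_range.2 (Nat.lt_succ_of_le (hle b hb))))]
    exact Finset.sum_congr rfl fun m _ => h6 m
  have hrow : ∀ b ∈ l, b.1 ≤ lastRow σ + N := by
    intro b hb
    rcases (h1.inCols hb).trichotomy with h' | h' | h'
    · have := mem_above.2 ⟨hb, h'⟩
      simp [h2] at this
    · have := hlast b h'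
      omega
    · obtain ⟨hbσ, a, ha, hab, hlt⟩ := h'
      have hsub : (Finset.Ioc (lastRow σ) b.1).image (fun i => ((i, b.2) : Box)) ⊆ below σ l := by
        intro c hc
        obtain ⟨i, hi, rfl⟩ := Finset.mem_image.1 hc
        obtain ⟨hi1, hi2⟩ := Finset.mem_Ioc.1 hi
        have hc' : BelowRegion σ (i, b.2) := by
          refine ⟨fun hiσ => ?_, a, ha, hab, ?_⟩
          · have := hlast _ hiσ
            simp only at this
            omega
          · have := hlast a ha
            simp only
            omega
        exact mem_below.2 ⟨h1.mem_of_below hb ⟨hi2, le_rfl⟩ hc', hc'⟩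
      have := Finset.card_le_card hsub
      rw [Finset.card_image_of_injective _ (fun i i' h => congrArg Prod.fst h), Nat.card_Ioc,
        hcard] at this
      omega
  have hsub : l ⊆ Finset.range (lastRow σ + N + 1) ×ˢ σ.image Prod.snd := by
    intro b hb
    obtain ⟨a, ha, hab⟩ := h1.inCols hb
    exact Finset.mem_product.2 ⟨Finset.mem_range.2 (Nat.lt_succ_of_le (hrow b hb)),
      Finset.mem_image.2 ⟨a, ha, hab⟩⟩
  refine ⟨hsub, fun b => ?_⟩
  by_cases hb : 0 < u b
  · have hmem := (h3 b).1 hb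
    exact ⟨hle b hmem, fun _ => hsub (mem_below.1 hmem).1⟩
  · exact ⟨by omega, fun h => absurd h hb⟩

/-- The content decides which labels occur, so all tableaux in the set use the finitely many labels
of any one of them. -/
theorem SS_finite (c : ℕ → ℕ) (s : Finset Box) (d : ℕ → ℤ) : (SS c d s).Finite := by
  have hpos : ∀ T ∈ SS c d s, ∀ x, 0 < c x ↔ ∃ b ∈ s, x ∈ T b := by
    rintro T ⟨-, -, h, -⟩ x
    rw [← h x, svContent, Finset.card_pos]
    simp [Finset.Nonempty, and_comm]
  rcases (SS c d s).eq_empty_or_nonempty with h | ⟨T₀, hT₀⟩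
  · rw [h]
    exact Set.finite_empty
  refine Set.Finite.subset (finite_functions s ((s.biUnion T₀).powerset.finite_toSet) ∅) ?_
  intro T hT
  refine ⟨fun b hb => ?_, fun b hb => ?_⟩
  · rw [Finset.mem_coe, Finset.mem_powerset]
    intro x hx
    obtain ⟨b', hb', hx'⟩ := (hpos T₀ hT₀ x).1 ((hpos T hT x).2 ⟨b, hb, hx⟩)
    exact Finset.mem_biUnion.2 ⟨b', hb', hx'⟩
  · rw [← Finset.not_nonempty_iff_eq_empty, hT.1.nonempty_iff]
    exact hb

/-! ### Counting triples by their pairs -/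

theorem ncard_triples {α β γ : Type*} {P : Set (α × β)} (hP : P.Finite) (F : α × β → Set γ)
    (hF : ∀ p, (F p).Finite) :
    {p : α × β × γ | (p.1, p.2.1) ∈ P ∧ p.2.2 ∈ F (p.1, p.2.1)}.ncard =
      ∑ᶠ p ∈ P, (F p).ncard := by
  have : Fintype P := hP.fintype
  have : ∀ p : P, Finite (F p) := fun p => (hF p).to_subtype
  let φ : {p : α × β × γ | (p.1, p.2.1) ∈ P ∧ p.2.2 ∈ F (p.1, p.2.1)} ≃ Σ p : P, F p :=
    { toFun := fun p => ⟨⟨(p.1.1, p.1.2.1), p.2.1⟩, ⟨p.1.2.2, p.2.2⟩⟩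
      invFun := fun q => ⟨(q.1.1.1, q.1.1.2, q.2.1), q.1.2, q.2.2⟩
      left_inv := fun _ => rfl
      right_inv := fun _ => rfl }
  rw [← Nat.card_coe_set_eq, Nat.card_congr φ, Nat.card_sigma,
    ← finsum_set_coe_eq_finsum_mem (s := P) (f := fun p => (F p).ncard), finsum_eq_sum_of_fintype]
  simp only [Nat.card_coe_set_eq]

end SkewInsertion

theorem proposition3p7 (σ : Finset SkewInsertion.Box) (hσ : SkewInsertion.IsSkewShape σ)
    (hconn : SkewInsertion.IsConnectedShape σ) (c e : ℕ → ℕ) :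
    Set.BijOn (SkewInsertion.algorithm σ)
      (SkewInsertion.inputs σ c e) (SkewInsertion.outputs σ c e) ∧
    (SkewInsertion.inputPairs σ).Finite ∧
    (SkewInsertion.outputPairs σ e).Finite ∧
    (∀ (s : Finset SkewInsertion.Box) (d : ℕ → ℤ), (SkewInsertion.SS c d s).Finite) ∧
    ∑ᶠ p ∈ SkewInsertion.inputPairs σ,
        (SkewInsertion.SS c (SkewInsertion.reducedExcess σ e p) p.1).ncard =
      ∑ᶠ p ∈ SkewInsertion.outputPairs σ e,
        (SkewInsertion.SS c (fun _ => 0) p.1).ncard := by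
  -- Connectedness enters only through the convexity of the set of columns.
  have hbij := SkewInsertion.bijOn_algorithm hσ (hconn.colsConvex hσ) c e
  refine ⟨hbij, SkewInsertion.inputPairs_finite σ, SkewInsertion.outputPairs_finite hσ e,
    SkewInsertion.SS_finite c, ?_⟩
  rw [← SkewInsertion.ncard_triples (SkewInsertion.inputPairs_finite σ)
      (fun p => SkewInsertion.SS c (SkewInsertion.reducedExcess σ e p) p.1)
      (fun p => SkewInsertion.SS_finite c _ _),
    ← SkewInsertion.ncard_triples (SkewInsertion.outputPairs_finite hσ e)
      (fun p => SkewInsertion.SS c (fun _ => 0) p.1) (fun p => SkewInsertion.SS_finite c _ _),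
    ← Nat.card_coe_set_eq, ← Nat.card_coe_set_eq]
  exact Nat.card_congr (Set.BijOn.equiv _ hbij)
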